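/- **Setting.** Let $\mathbb K$ be a field of characteristic zero. A noncrossing partition is a partition $\pi$ of $[n]=\{1,\dots,n\}$ such that there are no blocks $b\ne b'$ of $\pi$ and $x,z\in b$, $y,t\in b'$ with $x<y<z<t$; $|\pi|$ is its number of blocks. Let $\mathbb K[\mathcal{NCP}]$ be the free commutative algebra generated by all noncrossing partitions of the sets $[n]$, $n\ge 1$ (the partition of $\emptyset$ is identified with the unit). For a union $s$ of blocks of $\pi$, $\pi_{|s}$ is the noncrossing partition of $[|s|]$ obtained from the blocks of $\pi$ contained in $s$ by the increasing bijection $s\to[|s|]$. A set $I$ of blocks of $\pi$, of union $I'$, is an ideal if every connected component (maximal interval) of $I'$ is a union of blocks of $\pi$. Define multiplicative coproducts on $\mathbb K[\mathcal{NCP}]$ by $$\Delta(\pi)=\sum_{I\text{ ideal of }\pi}\pi_{|[n]\setminus I'}\otimes\prod_{c\text{ component of }I'}\pi_{|c},\qquad \delta(\pi)=\sum_{\sigma}\sigma\otimes\prod_{b\in\sigma}\pi_{|b},$$ the second sum being over all noncrossing partitions $\sigma$ of $[n]$ coarser than (or equal to) $\pi$. The counit $\varepsilon$ of $\Delta$ vanishes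 on all noncrossing partitions of nonempty sets; the counit of $\delta$ is $1$ on $\pi$ if $|\pi|=1$ and $0$ otherwise. On $\mathbb K[X]$ consider the multiplicative coproducts with $\Delta(X)=X\otimes1+1\otimes X$ (counit $P\mapsto P(0)$) and $\delta(X)=X\otimes X$ (counit $P\mapsto P(1)$). A double bialgebra morphism is an algebra morphism compatible with both coproducts and both counits. An antipode, for an algebra $A$ with product $m$, coproduct $\Delta$ and counit $\varepsilon$, is a linear map $S:A\to A$ with $m(S\otimes\mathrm{Id})\Delta=m(\mathrm{Id}\otimes S)\Delta=\varepsilon(\cdot)1$. Let $J_n=\{\{1\},\dots,\{n\}\}$. For $n\ge1$ let $\mathrm{Part}(n)$ be the set of $(k_1,\dots,k_n)\in\mathbb N^n$ with $1k_1+\dots+nk_n=n$; for $\pi$ noncrossing on $[n]$ let $p(\pi)=(p_1(\pi),\dots,p_n(\pi))\in\mathrm{Part}(n)$, where $p_i(\pi)$ is the number of blocks of cardinality $i$. Let $\sim_\pi$ be the equivalence on the blocks of $\pi$ for which $b\sim_\pi b'$ if there are blocks $b_1,\dots,b_k$ ($k\ge 1$) of $\pi$ with $\max b_i+1=\min b_{i+1}$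 for $1\le i<k$ and $(b_1,b_k)=(b,b')$ or $(b',b)$. Let $\mathrm{cat}_m=\frac1{m+1}\binom{2m}{m}$ and $$\lambda_{(k_1,\dots,k_n)}=(-1)^{k_1+\dots+k_n}\sum_{\substack{\pi\text{ noncrossing partition of }[n]\\ p(\pi)=(k_1,\dots,k_n)}}\ \prod_{C\in\pi/\sim_\pi}\mathrm{cat}_{|C|}.$$ Finally, let $H_{\mathrm{FdB}}=\mathbb K[x_n\mid n\ge1]$ be the Faà di Bruno algebra, with the coproduct for which $\Delta(x_n)$ is the coefficient of $x^{n+1}$ in $F\circ G$, where $F=x+\sum_{m\ge1}(x_m\otimes1)x^{m+1}$ and $G=x+\sum_{m\ge1}(1\otimes x_m)x^{m+1}$, and with the counit vanishing on all $x_n$. **Proposition.** There is a unique double bialgebra morphism $\phi:\mathbb K[\mathcal{NCP}]\to\mathbb K[X]$; put $\mu_{\mathcal{NCP}}(\pi)=\phi(\pi)(-1)$. Both $(\mathbb K[\mathcal{NCP}],\Delta)$ and $(H_{\mathrm{FdB}},\Delta)$ have a unique antipode, denoted $S$ and $S_{\mathrm{FdB}}$. Moreover: 1. For every $n\ge1$,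 $$S(J_n)=\sum_{\pi\text{ noncrossing partition of }[n]}\mu_{\mathcal{NCP}}(\pi)\prod_{b\in\pi}J_{|b|}=\sum_{(k_1,\dots,k_n)\in\mathrm{Part}(n)}\lambda_{(k_1,\dots,k_n)}\,J_1^{k_1}\cdots J_n^{k_n},$$ and the coefficient of the monomial $J_1^{n}$ in $S(J_n)$ is $(-1)^n\mathrm{cat}_n$. 2. The algebra morphism $\Phi:H_{\mathrm{FdB}}\to\mathbb K[\mathcal{NCP}]$, $x_n\mapsto J_n$, is compatible with coproducts, counits and antipodes. 3. For every sequence $(a_n)_{n\ge1}$ in $\mathbb K$, the inverse for composition of the formal series $x+\sum_{n\ge1}a_nx^{n+1}$ is $x+\sum_{n\ge1}b_nx^{n+1}$ with $$b_n=\sum_{(k_1,\dots,k_n)\in\mathrm{Part}(n)}\lambda_{(k_1,\dots,k_n)}\,a_1^{k_1}\cdots a_n^{k_n},$$ and $b_n$ is the value of $S_{\mathrm{FdB}}(x_n)\in\mathbb K[x_1,x_2,\dots]$ at $x_i=a_i$ ($i\geq 1$). In particular, for every $n\ge1$, $\lambda_{(n,0,\dots,0)}=(-1)^n\mathrm{cat}_n$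 and $\lambda_{(0,\dots,0,1)}=-1$. -/

import Mathlib

open scoped TensorProduct

noncomputable section

/-- A noncrossing partition of `[n]`, with `[n]` modelled by `Fin n`. -/
@[ext]
structure NCPartition (n : ℕ) extends Finpartition (Finset.univ : Finset (Fin n)) where
  noncrossing : ∀ b ∈ parts, ∀ b' ∈ parts, b ≠ b' →
    ∀ x ∈ b, ∀ z ∈ b, ∀ y ∈ b', ∀ t ∈ b', ¬ (x < y ∧ y < z ∧ z < t)

namespace NCPartition

variable {n : ℕ}

instance : Finite (NCPartition n) :=
  Finite.of_injective (fun π : NCPartition n => π.parts) (fun _ _ h => NCPartition.ext h)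

instance : Fintype (NCPartition n) := Fintype.ofFinite _

/-- The noncrossing partition `J_n = {{1}, …, {n}}`. -/
def J (n : ℕ) : NCPartition n where
  toFinpartition := ⊥
  noncrossing := by
    intro b hb b' _ _ x hx z hz y _ t _ h
    obtain ⟨a, _, rfl⟩ := Finpartition.mem_bot_iff.1 hb
    rw [Finset.mem_singleton] at hx hz
    subst hx hz
    exact lt_asymm h.1 h.2.1

/-- The partition induced by `π` on a subset `s` of `[n]`, relabelled by the increasing bijection
between `s` and `[|s|]`.  When `s` is a union of blocks, its blocks are the images under that
bijection of the blocks of `π` contained in `s`. -/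
def restrict (π : NCPartition n) (s : Finset (Fin n)) : NCPartition s.card where
  toFinpartition := Finpartition.ofExistsUnique
    ((π.parts.image fun b => Finset.univ.filter fun i => s.orderEmbOfFin rfl i ∈ b).erase ∅)
    (fun _ _ => Finset.subset_univ _)
    (by
      intro i _
      obtain ⟨b, ⟨hb, hi⟩, hu⟩ :=
        π.existsUnique_mem (Finset.mem_univ (s.orderEmbOfFin rfl i))
      refine ⟨Finset.univ.filter fun j => s.orderEmbOfFin rfl j ∈ b, ⟨?_, by simpa using hi⟩, ?_⟩
      · refine Finset.mem_erase.2 ⟨?_, Finset.mem_image_of_mem _ hb⟩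
        exact Finset.ne_empty_of_mem (a := i) (by simpa using hi)
      · rintro t ⟨ht, hit⟩
        obtain ⟨c, hc, rfl⟩ := Finset.mem_image.1 (Finset.mem_erase.1 ht).2
        rw [hu c ⟨hc, by simpa using hit⟩])
    (Finset.notMem_erase _ _)
  noncrossing := by
    intro b hb b' hb' hne x hx z hz y hy t ht h
    obtain ⟨c, hc, rfl⟩ := Finset.mem_image.1 (Finset.mem_erase.1 hb).2
    obtain ⟨c', hc', rfl⟩ := Finset.mem_image.1 (Finset.mem_erase.1 hb').2
    simp only [Finset.mem_filter, Finset.mem_univ, true_and] at hx hz hy ht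
    refine π.noncrossing c hc c' hc' ?_ _ hx _ hz _ hy _ ht ?_
    · rintro rfl
      exact hne rfl
    · simpa using h

/-- The connected component of `i` in `s ⊆ [n]`: all `j ∈ s` such that `s` contains the whole
interval between `i` and `j`. -/
def component (s : Finset (Fin n)) (i : Fin n) : Finset (Fin n) :=
  s.filter fun j => Finset.uIcc i j ⊆ s

/-- The connected components (maximal intervals) of `s ⊆ [n]`. -/
def components (s : Finset (Fin n)) : Finset (Finset (Fin n)) :=
  s.image (component s)

/-- A set `I` of blocks of `π` is an ideal if each connected component of the union of the elements
of `I` is a union of blocks of `π`. -/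
def IsIdeal (π : NCPartition n) (I : Finset (Finset (Fin n))) : Prop :=
  I ⊆ π.parts ∧
    ∀ c ∈ components (I.biUnion id), ∃ T ⊆ π.parts, T.biUnion id = c

/-- `max b + 1 = min b'`. -/
def Follows (b b' : Finset (Fin n)) : Prop :=
  ∃ i ∈ b, ∃ j ∈ b', (∀ x ∈ b, x ≤ i) ∧ (∀ y ∈ b', j ≤ y) ∧ (i : ℕ) + 1 = (j : ℕ)

/-- The relation `∼_π` on the blocks of `π`: there is a chain of blocks `b_1, …, b_k` of `π`
with `max b_i + 1 = min b_{i+1}` which links `b` and `b'`, in one order or the other. -/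
def Related (π : NCPartition n) (b b' : Finset (Fin n)) : Prop :=
  let step : Finset (Fin n) → Finset (Fin n) → Prop :=
    fun c c' => c ∈ π.parts ∧ c' ∈ π.parts ∧ Follows c c'
  Relation.ReflTransGen step b b' ∨ Relation.ReflTransGen step b' b

open Classical in
/-- The set `π / ∼_π` of equivalence classes of blocks. -/
def classes (π : NCPartition n) : Finset (Finset (Finset (Fin n))) :=
  π.parts.image fun b => π.parts.filter fun b' => π.Related b b'

/-- `∏_{X ∈ π/∼_π} cat_{|X|}`. -/
def catProd (π : NCPartition n) : ℕ := ∏ X ∈ π.classes, catalan X.card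

/-- `p(π) = (p_1(π), …, p_n(π))`, where `p_i(π)` is the number of blocks of cardinality `i`;
the entry with index `i : Fin n` is `p_{i+1}(π)`. -/
def blockType (π : NCPartition n) : Fin n → ℕ :=
  fun i => (π.parts.filter fun b => b.card = (i : ℕ) + 1).card

end NCPartition

/-- The set `Part(n)` of all `(k_1, …, k_n) ∈ ℕ^n` with `1 k_1 + ⋯ + n k_n = n`;
the entry with index `i : Fin n` is `k_{i+1}`. -/
def intPartitions (n : ℕ) : Finset (Fin n → ℕ) :=
  (Fintype.piFinset fun _ : Fin n => Finset.range (n + 1)).filter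
    fun k => ∑ i : Fin n, ((i : ℕ) + 1) * k i = n

theorem mem_intPartitions {n : ℕ} {k : Fin n → ℕ} :
    k ∈ intPartitions n ↔ ∑ i : Fin n, ((i : ℕ) + 1) * k i = n := by
  refine ⟨fun h => (Finset.mem_filter.1 h).2, fun h => Finset.mem_filter.2 ⟨?_, h⟩⟩
  refine Fintype.mem_piFinset.2 fun i => Finset.mem_range.2 ?_
  have h1 : ((i : ℕ) + 1) * k i ≤ n :=
    (Finset.single_le_sum (f := fun j : Fin n => ((j : ℕ) + 1) * k j)
      (fun _ _ => Nat.zero_le _) (Finset.mem_univ i)).trans_eq h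
  nlinarith [Nat.zero_le ((i : ℕ) * k i)]

/-- The scalar `(-1)^{k_1 + ⋯ + k_n} ∑_{p(π) = k} ∏_{X ∈ π/∼_π} cat_{|X|}`. -/
def typeCoeff (n : ℕ) (k : Fin n → ℕ) : ℤ :=
  (-1) ^ (∑ i, k i) *
    ∑ π ∈ (Finset.univ : Finset (NCPartition n)).filter (fun π => π.blockType = k),
      (π.catProd : ℤ)

/-- The antipode axioms, for linear endomorphisms `S` of an algebra `A` with coproduct `Δ` and
counit `ε`: `S` is a two-sided inverse of `id` for the convolution product. -/
def IsAntipode {K A : Type*} [CommSemiring K] [CommSemiring A] [Algebra K A]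
    (Δ : A →ₐ[K] A ⊗[K] A) (ε : A →ₐ[K] K) (S : A →ₗ[K] A) : Prop :=
  LinearMap.mul' K A ∘ₗ S.rTensor A ∘ₗ Δ.toLinearMap = Algebra.linearMap K A ∘ₗ ε.toLinearMap ∧
  LinearMap.mul' K A ∘ₗ S.lTensor A ∘ₗ Δ.toLinearMap = Algebra.linearMap K A ∘ₗ ε.toLinearMap

section NCAlgebra

variable (K : Type*) [Field K]

/-- `K[NCP]`: the free commutative algebra generated by all noncrossing partitions of the
nonempty sets `[n]`. -/
abbrev NCAlg : Type _ := MvPolynomial (Σ n : ℕ+, NCPartition n) K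

variable {K}

/-- The element of `K[NCP]` given by `π`; the partition of the empty set gives the unit. -/
def NCAlg.of {n : ℕ} (π : NCPartition n) : NCAlg K :=
  if h : 0 < n then MvPolynomial.X (⟨⟨n, h⟩, π⟩ : Σ n : ℕ+, NCPartition n) else 1

variable (K)

/-- The element `J_n` of `K[NCP]`. -/
def NCAlg.J (n : ℕ) : NCAlg K := NCAlg.of (NCPartition.J n)

open Classical in
/-- The coproduct `Δ`: on a noncrossing partition `π` of `[n]`,
`Δ(π) = ∑_{I ideal of π} π_{|[n]∖I} ⊗ ∏_{c component of I} π_{|c}`. -/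
def NCAlg.comul : NCAlg K →ₐ[K] NCAlg K ⊗[K] NCAlg K :=
  MvPolynomial.aeval fun p : (Σ n : ℕ+, NCPartition n) =>
    ∑ I ∈ p.2.parts.powerset.filter (fun I => p.2.IsIdeal I),
      NCAlg.of (p.2.restrict (I.biUnion id)ᶜ) ⊗ₜ[K]
        ∏ c ∈ NCPartition.components (I.biUnion id), NCAlg.of (p.2.restrict c)

/-- The counit of `Δ`: it vanishes on all noncrossing partitions. -/
def NCAlg.counit : NCAlg K →ₐ[K] K := MvPolynomial.aeval fun _ => 0

open Classical in
/-- The coproduct `δ`: on a noncrossing partition `π`,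
`δ(π) = ∑_∼ π/∼ ⊗ ∏_{x class of ∼} π_{|x}` over the equivalences `∼` on the blocks of `π` such that
`π/∼` is noncrossing.  Such an equivalence is determined by `σ = π/∼`, which is any noncrossing
partition coarser than `π`, and the classes of `∼` correspond to the blocks of `σ`. -/
def NCAlg.delta : NCAlg K →ₐ[K] NCAlg K ⊗[K] NCAlg K :=
  MvPolynomial.aeval fun p : (Σ n : ℕ+, NCPartition n) =>
    ∑ σ ∈ (Finset.univ : Finset (NCPartition p.1)).filter
        (fun σ => p.2.toFinpartition ≤ σ.toFinpartition),
      NCAlg.of σ ⊗ₜ[K] ∏ x ∈ σ.parts, NCAlg.of (p.2.restrict x)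

/-- The counit of `δ`: it is `1` on noncrossing partitions with one block and `0` on the others. -/
def NCAlg.deltaCounit : NCAlg K →ₐ[K] K :=
  MvPolynomial.aeval fun p : (Σ n : ℕ+, NCPartition n) => if p.2.parts.card = 1 then 1 else 0

/-- Morphisms of double bialgebras from `(K[NCP], ·, Δ, δ)` to `(K[X], ·, Δ, δ)`, where
`Δ(X) = X ⊗ 1 + 1 ⊗ X` and `δ(X) = X ⊗ X` in `K[X]`, with counits `P ↦ P(0)` and `P ↦ P(1)`. -/
structure IsDoubleBialgebraHom (φ : NCAlg K →ₐ[K] Polynomial K) : Prop where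
  map_comul : (Algebra.TensorProduct.map φ φ).comp (NCAlg.comul K) =
    (Polynomial.aeval
      ((Polynomial.X : Polynomial K) ⊗ₜ[K] (1 : Polynomial K) +
        (1 : Polynomial K) ⊗ₜ[K] (Polynomial.X : Polynomial K))).comp φ
  map_counit : NCAlg.counit K = (Polynomial.aeval (0 : K)).comp φ
  map_delta : (Algebra.TensorProduct.map φ φ).comp (NCAlg.delta K) =
    (Polynomial.aeval
      ((Polynomial.X : Polynomial K) ⊗ₜ[K] (Polynomial.X : Polynomial K))).comp φ
  map_deltaCounit : NCAlg.deltaCounit K = (Polynomial.aeval (1 : K)).comp φ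

end NCAlgebra

section FaaDiBruno

/-- The formal series `x + ∑_{n ≥ 1} a_n x^{n+1}`. -/
def fdbSeries {R : Type*} [CommRing R] (a : ℕ+ → R) : PowerSeries R :=
  PowerSeries.mk fun m =>
    match m with
    | 0 => 0
    | 1 => 1
    | k + 2 => a k.succPNat

variable (K : Type*) [Field K]

/-- The Faà di Bruno algebra `K[x_n ∣ n ≥ 1]`. -/
abbrev FdB : Type _ := MvPolynomial ℕ+ K

/-- The Faà di Bruno coproduct, given by `Δ(x_n)(f, g) = x_n(f ∘ g)`: `Δ(x_n)` is the coefficient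
of `x^{n+1}` in `F ∘ G`, for `F = x + ∑ (x_n ⊗ 1) x^{n+1}` and `G = x + ∑ (1 ⊗ x_n) x^{n+1}`. -/
def FdB.comul : FdB K →ₐ[K] FdB K ⊗[K] FdB K :=
  MvPolynomial.aeval fun n : ℕ+ =>
    PowerSeries.coeff ((n : ℕ) + 1)
      (PowerSeries.subst
        (fdbSeries fun m => (1 : FdB K) ⊗ₜ[K] (MvPolynomial.X m : FdB K))
        (fdbSeries fun m => (MvPolynomial.X m : FdB K) ⊗ₜ[K] (1 : FdB K)))

/-- The counit of the Faà di Bruno Hopf algebra: evaluation at the series `x`. -/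
def FdB.counit : FdB K →ₐ[K] K := MvPolynomial.aeval fun _ => 0

/-- The morphism `x_n ↦ J_n` from the Faà di Bruno Hopf algebra to `K[NCP]`. -/
def FdB.toNCAlg : FdB K →ₐ[K] NCAlg K := MvPolynomial.aeval fun n : ℕ+ => NCAlg.J K n

end FaaDiBruno

end

noncomputable section

namespace NCPartition

variable {n m : ℕ}

/-- `x` and `y` lie in the same block of `π`. -/
def Same (π : NCPartition n) (x y : Fin n) : Prop := ∃ b ∈ π.parts, x ∈ b ∧ y ∈ b

theorem same_iff_mem {π : NCPartition n} {b : Finset (Fin n)} (hb : b ∈ π.parts) {x y : Fin n}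
    (hx : x ∈ b) : π.Same x y ↔ y ∈ b := by
  refine ⟨fun ⟨c, hc, hxc, hyc⟩ => ?_, fun hy => ⟨b, hb, hx, hy⟩⟩
  rwa [π.eq_of_mem_parts hb hc hx hxc]

theorem Same.refl (π : NCPartition n) (x : Fin n) : π.Same x x := by
  obtain ⟨b, hb, hx⟩ := π.exists_mem (Finset.mem_univ x)
  exact ⟨b, hb, hx, hx⟩

theorem Same.symm {π : NCPartition n} {x y : Fin n} (h : π.Same x y) : π.Same y x := by
  obtain ⟨b, hb, hx, hy⟩ := h
  exact ⟨b, hb, hy, hx⟩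

theorem Same.trans {π : NCPartition n} {x y z : Fin n} (h : π.Same x y) (h' : π.Same y z) :
    π.Same x z := by
  obtain ⟨b, hb, hx, hy⟩ := h
  exact ⟨b, hb, hx, (same_iff_mem hb hy).1 h'⟩

theorem exists_block (π : NCPartition n) (x : Fin n) : ∃ b ∈ π.parts, x ∈ b :=
  π.exists_mem (Finset.mem_univ x)

theorem parts_subset_of_same {π ρ : NCPartition n} (h : ∀ x y, π.Same x y ↔ ρ.Same x y) :
    π.parts ⊆ ρ.parts := by
  intro b hb
  obtain ⟨x, hx⟩ := π.nonempty_of_mem_parts hb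
  obtain ⟨c, hc, hxc⟩ := ρ.exists_block x
  have : b = c := by
    ext y
    rw [← same_iff_mem hb hx, h, same_iff_mem hc hxc]
  rwa [this]

theorem ext_same {π ρ : NCPartition n} (h : ∀ x y, π.Same x y ↔ ρ.Same x y) : π = ρ :=
  NCPartition.ext ((parts_subset_of_same h).antisymm
    (parts_subset_of_same fun x y => (h x y).symm))

theorem le_iff_same {π ρ : NCPartition n} :
    π.toFinpartition ≤ ρ.toFinpartition ↔ ∀ x y, π.Same x y → ρ.Same x y := by
  constructor
  · rintro h x y ⟨b, hb, hx, hy⟩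
    obtain ⟨c, hc, hbc⟩ := h hb
    exact ⟨c, hc, hbc hx, hbc hy⟩
  · intro h b hb
    obtain ⟨x, hx⟩ := π.nonempty_of_mem_parts hb
    obtain ⟨c, hc, hxc⟩ := ρ.exists_block x
    exact ⟨c, hc, fun y hy => (same_iff_mem hc hxc).1 (h x y ⟨b, hb, hx, hy⟩)⟩

theorem same_restrict (π : NCPartition n) (s : Finset (Fin n)) (i j : Fin s.card) :
    (π.restrict s).Same i j ↔ π.Same (s.orderEmbOfFin rfl i) (s.orderEmbOfFin rfl j) := by
  constructor
  · rintro ⟨b, hb, hi, hj⟩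
    obtain ⟨c, hc, rfl⟩ := Finset.mem_image.1 (Finset.mem_erase.1 hb).2
    exact ⟨c, hc, by simpa using hi, by simpa using hj⟩
  · rintro ⟨c, hc, hi, hj⟩
    refine ⟨Finset.univ.filter fun i => s.orderEmbOfFin rfl i ∈ c,
      Finset.mem_erase.2 ⟨Finset.ne_empty_of_mem (a := i) (by simpa using hi),
        Finset.mem_image_of_mem _ hc⟩, by simpa using hi, by simpa using hj⟩

theorem same_J {x y : Fin n} : (J n).Same x y ↔ x = y := by
  constructor
  · rintro ⟨b, hb, hx, hy⟩
    obtain ⟨a, _, rfl⟩ := Finpartition.mem_bot_iff.1 hb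
    rw [Finset.mem_singleton] at hx hy
    rw [hx, hy]
  · rintro rfl
    exact Same.refl _ _

/-- The restriction of `π` to the image of an increasing map is the partition pulled back along
it. -/
theorem restrict_eq_of_same_iff {π : NCPartition n} {s : Finset (Fin n)} {ρ : NCPartition m}
    (e : Fin m ↪o Fin n) (he : Finset.univ.map e.toEmbedding = s)
    (h : ∀ i j, ρ.Same i j ↔ π.Same (e i) (e j)) :
    ∃ hm : s.card = m, hm ▸ π.restrict s = ρ := by
  have hm : s.card = m := by rw [← he]; simp
  subst hm
  refine ⟨rfl, ext_same fun i j => ?_⟩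
  rw [h, same_restrict]
  have : e = s.orderEmbOfFin rfl := by
    refine Finset.orderEmbOfFin_unique' rfl fun x => ?_
    have hx := Finset.mem_map_of_mem e.toEmbedding (Finset.mem_univ x)
    rwa [he] at hx
  rw [this]

/-- The set of all `y` such that `f` takes the same value at `x` and `y`, and no smaller value in
between. -/
def level (f : Fin n → ℕ) (x : Fin n) : Finset (Fin n) :=
  Finset.univ.filter fun y => f y = f x ∧ ∀ z ∈ Finset.uIcc x y, f x ≤ f z

theorem mem_level {f : Fin n → ℕ} {x y : Fin n} :
    y ∈ level f x ↔ f y = f x ∧ ∀ z ∈ Finset.uIcc x y, f x ≤ f z := by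
  simp [level]

theorem mem_level_self (f : Fin n → ℕ) (x : Fin n) : x ∈ level f x := by
  simp [mem_level]

theorem level_eq_of_mem {f : Fin n → ℕ} {x y : Fin n} (h : y ∈ level f x) :
    level f y = level f x := by
  rw [mem_level] at h
  ext z
  rw [mem_level, mem_level, h.1]
  refine and_congr_right fun _ => ⟨fun H w hw => ?_, fun H w hw => ?_⟩
  · rcases Finset.mem_union.1 (Finset.uIcc_subset_uIcc_union_uIcc (b := y) hw) with h1 | h1
    exacts [h.2 w h1, H w h1]
  · rcases Finset.mem_union.1 (Finset.uIcc_subset_uIcc_union_uIcc (b := x) hw) with h1 | h1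
    exacts [h.2 w (Finset.uIcc_comm x y ▸ h1), H w h1]

/-- The noncrossing partition of `[n]` into the sets `level f x`. -/
def ofFun (f : Fin n → ℕ) : NCPartition n where
  toFinpartition := Finpartition.ofExistsUnique (Finset.univ.image (level f))
    (fun _ _ => Finset.subset_univ _)
    (by
      intro x _
      refine ⟨level f x, ⟨Finset.mem_image_of_mem _ (Finset.mem_univ x), mem_level_self f x⟩, ?_⟩
      rintro t ⟨ht, hx⟩
      obtain ⟨y, -, rfl⟩ := Finset.mem_image.1 ht
      exact (level_eq_of_mem hx).symm)
    (by
      intro h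
      obtain ⟨y, -, hy⟩ := Finset.mem_image.1 h
      exact Finset.notMem_empty y (hy ▸ mem_level_self f y))
  noncrossing := by
    intro b hb b' hb' hne x hx z hz y hy t ht h
    obtain ⟨u, -, rfl⟩ := Finset.mem_image.1 hb
    obtain ⟨v, -, rfl⟩ := Finset.mem_image.1 hb'
    rw [← level_eq_of_mem hx] at hz hne
    rw [← level_eq_of_mem hy] at ht hne
    rw [mem_level] at hz ht
    have h1 := hz.2 y (by rw [Finset.mem_uIcc']; exact Or.inl ⟨h.1.le, h.2.1.le⟩)
    have h2 := ht.2 z (by rw [Finset.mem_uIcc']; exact Or.inl ⟨h.2.1.le, h.2.2.le⟩)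
    refine hne (level_eq_of_mem ?_).symm
    rw [mem_level]
    refine ⟨by omega, fun w hw => hz.2 w ?_⟩
    rw [Finset.uIcc_of_le h.1.le, Finset.mem_Icc] at hw
    rw [Finset.mem_uIcc']
    exact Or.inl ⟨hw.1, hw.2.trans h.2.1.le⟩

theorem parts_ofFun (f : Fin n → ℕ) : (ofFun f).parts = Finset.univ.image (level f) := rfl

theorem same_ofFun {f : Fin n → ℕ} {x y : Fin n} : (ofFun f).Same x y ↔ y ∈ level f x :=
  same_iff_mem (Finset.mem_image_of_mem _ (Finset.mem_univ x)) (mem_level_self f x)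

end NCPartition

namespace NCAlg
variable {K : Type*} [Field K] {n m : ℕ}

theorem of_eq_one (π : NCPartition 0) : (of π : NCAlg K) = 1 := by
  simp [of]

theorem of_pos (π : NCPartition n) (h : 0 < n) :
    (of π : NCAlg K) = MvPolynomial.X (⟨⟨n, h⟩, π⟩ : Σ n : ℕ+, NCPartition n) := by
  simp [of, h]

theorem of_restrict_eq {π : NCPartition n} {s : Finset (Fin n)} {ρ : NCPartition m}
    (e : Fin m ↪o Fin n) (he : Finset.univ.map e.toEmbedding = s)
    (h : ∀ i j, ρ.Same i j ↔ π.Same (e i) (e j)) :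
    (of (π.restrict s) : NCAlg K) = of ρ := by
  obtain ⟨rfl, rfl⟩ := NCPartition.restrict_eq_of_same_iff e he h
  rfl

theorem of_restrict_univ (π : NCPartition n) :
    (of (π.restrict Finset.univ) : NCAlg K) = of π :=
  of_restrict_eq (RelEmbedding.refl _) (by ext; simp) (by simp)

theorem of_restrict_empty (π : NCPartition n) :
    (of (π.restrict ∅) : NCAlg K) = 1 := of_eq_one _

theorem of_restrict_restrict (π : NCPartition n) (s : Finset (Fin n)) (t : Finset (Fin s.card)) :
    (of ((π.restrict s).restrict t) : NCAlg K) =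
      of (π.restrict (t.map (s.orderEmbOfFin rfl).toEmbedding)) := by
  refine (of_restrict_eq ((t.orderEmbOfFin rfl).trans (s.orderEmbOfFin rfl)) ?_ ?_).symm
  · ext x
    simp only [Finset.mem_map, Finset.mem_univ, true_and]
    constructor
    · rintro ⟨i, rfl⟩
      exact ⟨t.orderEmbOfFin rfl i, Finset.orderEmbOfFin_mem _ _ _, rfl⟩
    · rintro ⟨i, hi, rfl⟩
      have : i ∈ Set.range (t.orderEmbOfFin rfl) := by rwa [Finset.range_orderEmbOfFin]
      obtain ⟨j, rfl⟩ := this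
      exact ⟨j, rfl⟩
  · intro i j
    rw [NCPartition.same_restrict, NCPartition.same_restrict]
    rfl

theorem of_restrict_J (s : Finset (Fin n)) :
    (of ((NCPartition.J n).restrict s) : NCAlg K) = NCAlg.J K s.card := by
  refine of_restrict_eq (s.orderEmbOfFin rfl) ?_ ?_
  · exact Finset.map_orderEmbOfFin_univ _ _
  · intro i j
    rw [NCPartition.same_J, NCPartition.same_J, (s.orderEmbOfFin rfl).injective.eq_iff]

end NCAlg

namespace NCPartition

variable {n m : ℕ}

theorem mem_component {s : Finset (Fin n)} {i j : Fin n} :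
    j ∈ component s i ↔ j ∈ s ∧ Finset.uIcc i j ⊆ s := by
  simp [component]

theorem component_subset (s : Finset (Fin n)) (i : Fin n) : component s i ⊆ s :=
  Finset.filter_subset _ _

theorem mem_component_self {s : Finset (Fin n)} {i : Fin n} (hi : i ∈ s) : i ∈ component s i := by
  simp [mem_component, hi]

theorem component_eq_of_mem {s : Finset (Fin n)} {i j : Fin n} (h : j ∈ component s i) :
    component s j = component s i := by
  rw [mem_component] at h
  ext z
  rw [mem_component, mem_component]
  refine and_congr_right fun _ => ⟨fun H => ?_, fun H => ?_⟩
  · exact (Finset.uIcc_subset_uIcc_union_uIcc (b := j)).trans (Finset.union_subset h.2 H)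
  · refine (Finset.uIcc_subset_uIcc_union_uIcc (b := i)).trans (Finset.union_subset ?_ H)
    rw [Finset.uIcc_comm]
    exact h.2

theorem mem_components {s c : Finset (Fin n)} :
    c ∈ components s ↔ ∃ i ∈ s, component s i = c := by
  simp [components]

theorem component_eq_of_mem_components {s c : Finset (Fin n)} (hc : c ∈ components s) {i : Fin n}
    (hi : i ∈ c) : component s i = c := by
  obtain ⟨j, -, rfl⟩ := mem_components.1 hc
  exact component_eq_of_mem hi

theorem subset_of_mem_components {s c : Finset (Fin n)} (hc : c ∈ components s) : c ⊆ s := by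
  obtain ⟨j, -, rfl⟩ := mem_components.1 hc
  exact component_subset s j

theorem components_nonempty {s c : Finset (Fin n)} (hc : c ∈ components s) : c.Nonempty := by
  obtain ⟨j, hj, rfl⟩ := mem_components.1 hc
  exact ⟨j, mem_component_self hj⟩

theorem component_mem_components {s : Finset (Fin n)} {i : Fin n} (hi : i ∈ s) :
    component s i ∈ components s := Finset.mem_image_of_mem _ hi

theorem components_pairwiseDisjoint (s : Finset (Fin n)) :
    (components s : Set (Finset (Fin n))).PairwiseDisjoint id := by
  intro c hc d hd hne
  refine Finset.disjoint_left.2 fun x hx hx' => hne ?_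
  rw [← component_eq_of_mem_components hc hx, component_eq_of_mem_components hd hx']

theorem biUnion_components (s : Finset (Fin n)) : (components s).biUnion id = s := by
  ext x
  rw [Finset.mem_biUnion]
  exact ⟨fun ⟨c, hc, hx⟩ => subset_of_mem_components hc hx,
    fun hx => ⟨_, component_mem_components hx, mem_component_self hx⟩⟩

theorem uIcc_subset_of_mem_components {s c : Finset (Fin n)} (hc : c ∈ components s) {x y : Fin n}
    (hx : x ∈ c) (hy : y ∈ c) : Finset.uIcc x y ⊆ c := by
  have h1 := component_eq_of_mem_components hc hx
  rw [← h1, mem_component] at hy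
  intro z hz
  rw [← h1, mem_component]
  refine ⟨hy.2 hz, fun w hw => hy.2 ?_⟩
  exact Finset.uIcc_subset_uIcc Finset.left_mem_uIcc hz hw

theorem exists_mem_of_biUnion {π : NCPartition n} {I : Finset (Finset (Fin n))}
    (hI : I ⊆ π.parts) {x y : Fin n} (hx : x ∈ I.biUnion id) (h : π.Same x y) :
    y ∈ I.biUnion id := by
  obtain ⟨b, hb, hxb⟩ := Finset.mem_biUnion.1 hx
  exact Finset.mem_biUnion.2 ⟨b, hb, (same_iff_mem (hI hb) hxb).1 h⟩

theorem mem_iff_subset_biUnion {π : NCPartition n} {I : Finset (Finset (Fin n))}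
    (hI : I ⊆ π.parts) {b : Finset (Fin n)} (hb : b ∈ π.parts) :
    b ∈ I ↔ b ⊆ I.biUnion id := by
  constructor
  · exact fun h => Finset.subset_biUnion_of_mem id h
  · intro h
    obtain ⟨x, hx⟩ := π.nonempty_of_mem_parts hb
    obtain ⟨c, hc, hxc⟩ := Finset.mem_biUnion.1 (h hx)
    rwa [π.eq_of_mem_parts hb (hI hc) hx hxc]

theorem isIdeal_iff {π : NCPartition n} {I : Finset (Finset (Fin n))} (hI : I ⊆ π.parts) :
    π.IsIdeal I ↔ ∀ x ∈ I.biUnion id, ∀ y, π.Same x y → y ∈ component (I.biUnion id) x := by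
  constructor
  · rintro ⟨-, h⟩ x hx y hxy
    obtain ⟨T, hT, hc⟩ := h _ (component_mem_components hx)
    rw [← hc]
    refine exists_mem_of_biUnion hT ?_ hxy
    rw [hc]
    exact mem_component_self hx
  · intro h
    refine ⟨hI, fun c hc => ⟨π.parts.filter (· ⊆ c), Finset.filter_subset _ _, ?_⟩⟩
    refine (Finset.biUnion_subset.2 fun b hb => (Finset.mem_filter.1 hb).2).antisymm fun x hx => ?_
    obtain ⟨b, hb, hxb⟩ := π.exists_block x
    refine Finset.mem_biUnion.2 ⟨b, Finset.mem_filter.2 ⟨hb, fun y hy => ?_⟩, hxb⟩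
    rw [← component_eq_of_mem_components hc hx]
    exact h x (subset_of_mem_components hc hx) y ⟨b, hb, hxb, hy⟩

/-- The functions with values smaller than `k` on `s`, and equal to `k` outside `s`. -/
def funcs (s : Finset (Fin n)) (k : ℕ) : Finset (Fin n → ℕ) :=
  Fintype.piFinset fun x => if x ∈ s then Finset.range k else {k}

theorem mem_funcs {s : Finset (Fin n)} {k : ℕ} {f : Fin n → ℕ} :
    f ∈ funcs s k ↔ (∀ x ∈ s, f x < k) ∧ ∀ x ∉ s, f x = k := by
  rw [funcs, Fintype.mem_piFinset]
  constructor
  · intro h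
    refine ⟨fun x hx => by simpa [hx] using h x, fun x hx => by simpa [hx] using h x⟩
  · rintro ⟨h1, h2⟩ x
    by_cases hx : x ∈ s
    · simpa [hx] using h1 x hx
    · simpa [hx] using h2 x hx

/-- The function which agrees with `f` on `s` and takes the value `k` outside `s`. -/
def localize (s : Finset (Fin n)) (k : ℕ) (f : Fin n → ℕ) : Fin n → ℕ :=
  fun x => if x ∈ s then f x else k

theorem localize_localize {s t : Finset (Fin n)} (h : s ⊆ t) (k : ℕ) (f : Fin n → ℕ) :
    localize s k (localize t k f) = localize s k f := by
  ext x
  by_cases hx : x ∈ s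
  · simp [localize, hx, h hx]
  · simp [localize, hx]

theorem sum_funcs_mul_sum_funcs {A : Type*} [CommSemiring A] {s t : Finset (Fin n)}
    (hst : Disjoint s t) (k : ℕ) (F G : (Fin n → ℕ) → A) :
    (∑ f ∈ funcs s k, F f) * ∑ f ∈ funcs t k, G f =
      ∑ f ∈ funcs (s ∪ t) k, F (localize s k f) * G (localize t k f) := by
  rw [Finset.sum_mul_sum, ← Finset.sum_product']
  refine Finset.sum_nbij' (fun p x => if x ∈ s then p.1 x else p.2 x)
    (fun f => (localize s k f, localize t k f)) ?_ ?_ ?_ ?_ ?_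
  · rintro ⟨f, g⟩ h
    simp only [Finset.mem_product, mem_funcs] at h ⊢
    refine ⟨fun x hx => ?_, fun x hx => ?_⟩
    · by_cases hxs : x ∈ s
      · simpa [hxs] using h.1.1 x hxs
      · simpa [hxs] using h.2.1 x ((Finset.mem_union.1 hx).resolve_left hxs)
    · rw [Finset.mem_union, not_or] at hx
      simpa [hx.1] using h.2.2 x hx.2
  · intro f h
    simp only [Finset.mem_product, mem_funcs] at h ⊢
    refine ⟨⟨fun x hx => ?_, fun x hx => by simp [localize, hx]⟩,
      ⟨fun x hx => ?_, fun x hx => by simp [localize, hx]⟩⟩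
    · simpa [localize, hx] using h.1 x (Finset.mem_union_left _ hx)
    · simpa [localize, hx] using h.1 x (Finset.mem_union_right _ hx)
  · rintro ⟨f, g⟩ h
    simp only [Finset.mem_product, mem_funcs] at h
    refine Prod.ext (funext fun x => ?_) (funext fun x => ?_)
    · by_cases hx : x ∈ s
      · simp [localize, hx]
      · simp [localize, hx, h.1.2 x hx]
    · by_cases hx : x ∈ t
      · simp [localize, hx, Finset.disjoint_right.1 hst hx]
      · simp [localize, hx, h.2.2 x hx]
  · intro f h
    rw [mem_funcs] at h
    ext x
    by_cases hx : x ∈ s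
    · simp [localize, hx]
    · by_cases hx' : x ∈ t
      · simp [localize, hx, hx']
      · simp [localize, hx, hx', h.2 x (by simp [hx, hx'])]
  · rintro ⟨f, g⟩ h
    simp only [Finset.mem_product, mem_funcs] at h
    have h1 : localize s k (fun x => if x ∈ s then f x else g x) = f := by
      ext x
      by_cases hx : x ∈ s
      · simp [localize, hx]
      · simp [localize, hx, h.1.2 x hx]
    have h2 : localize t k (fun x => if x ∈ s then f x else g x) = g := by
      ext x
      by_cases hx : x ∈ t
      · simp [localize, hx, Finset.disjoint_right.1 hst hx]
      · simp [localize, hx, h.2.2 x hx]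
    dsimp only
    rw [h1, h2]

theorem funcs_empty (k : ℕ) : funcs (∅ : Finset (Fin n)) k = {fun _ => k} := by
  ext f
  rw [mem_funcs, Finset.mem_singleton, funext_iff]
  simp

theorem prod_sum_funcs {A : Type*} [CommSemiring A] (P : Finset (Finset (Fin n)))
    (hP : (P : Set (Finset (Fin n))).PairwiseDisjoint id) (k : ℕ)
    (g : Finset (Fin n) → (Fin n → ℕ) → A) :
    ∏ c ∈ P, ∑ f ∈ funcs c k, g c f =
      ∑ f ∈ funcs (P.biUnion id) k, ∏ c ∈ P, g c (localize c k f) := by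
  induction P using Finset.induction_on with
  | empty => simp [funcs_empty]
  | insert c P hc ih =>
    have hd : Disjoint c (P.biUnion id) := by
      rw [Finset.disjoint_biUnion_right]
      intro d hd
      exact hP (by simp) (by simp [hd]) (by rintro rfl; exact hc hd)
    rw [Finset.prod_insert hc, ih (hP.subset (by simp)), sum_funcs_mul_sum_funcs hd,
      Finset.biUnion_insert]
    refine Finset.sum_congr rfl fun f _ => ?_
    rw [Finset.prod_insert hc]
    congr 1
    refine Finset.prod_congr rfl fun d hd => ?_
    have hdP : d ⊆ P.biUnion id := Finset.subset_biUnion_of_mem id hd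
    rw [localize_localize hdP]

theorem sum_funcs_mul_sum_funcs_compl {A : Type*} [CommSemiring A] (T : Finset (Fin n))
    (k l : ℕ) (F G : (Fin n → ℕ) → A) :
    (∑ f ∈ funcs Tᶜ k, F f) * ∑ f ∈ funcs T l, G f =
      ∑ f ∈ (funcs Finset.univ (k + l)).filter (fun f => ∀ x, x ∈ T ↔ k ≤ f x),
        F (fun x => min (f x) k) * G (localize T l fun x => f x - k) := by
  rw [Finset.sum_mul_sum, ← Finset.sum_product']
  have key : ∀ f g : Fin n → ℕ, f ∈ funcs Tᶜ k → g ∈ funcs T l →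
      (fun x => min (if x ∈ T then k + g x else f x) k) = f ∧
      (localize T l fun x => (if x ∈ T then k + g x else f x) - k) = g := by
    intro f g hf hg
    rw [mem_funcs] at hf hg
    refine ⟨funext fun x => ?_, funext fun x => ?_⟩
    · by_cases hx : x ∈ T
      · simp [hx, hf.2 x (by simp [hx])]
      · simpa [hx] using (hf.1 x (by simp [hx])).le
    · by_cases hx : x ∈ T
      · simp [localize, hx]
      · simp [localize, hx, hg.2 x hx]
  refine Finset.sum_nbij' (fun p x => if x ∈ T then k + p.2 x else p.1 x)
    (fun f => (fun x => min (f x) k, localize T l fun x => f x - k)) ?_ ?_ ?_ ?_ ?_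
  · rintro ⟨f, g⟩ h
    simp only [Finset.mem_product, mem_funcs, Finset.mem_filter] at h ⊢
    refine ⟨⟨fun x _ => ?_, fun x hx => absurd (Finset.mem_univ x) hx⟩, fun x => ?_⟩
    · by_cases hx : x ∈ T
      · simpa [hx] using h.2.1 x hx
      · have := h.1.1 x (by simp [hx])
        simp only [hx, if_false]
        omega
    · by_cases hx : x ∈ T
      · simp [hx]
      · simpa [hx] using h.1.1 x (by simp [hx])
  · intro f h
    simp only [Finset.mem_product, mem_funcs, Finset.mem_filter] at h ⊢
    refine ⟨⟨fun x hx => ?_, fun x hx => ?_⟩, ⟨fun x hx => ?_, fun x hx => by simp [localize, hx]⟩⟩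
    · rw [Finset.mem_compl, h.2 x] at hx
      omega
    · rw [Finset.mem_compl, not_not, h.2 x] at hx
      omega
    · have h1 := h.1.1 x (Finset.mem_univ x)
      have h2 := (h.2 x).1 hx
      simp only [localize, hx, if_true]
      omega
  · rintro ⟨f, g⟩ h
    rw [Finset.mem_product] at h
    exact Prod.ext (key f g h.1 h.2).1 (key f g h.1 h.2).2
  · intro f h
    rw [Finset.mem_filter] at h
    ext x
    have hx := h.2 x
    by_cases hxT : x ∈ T
    · simp only [localize, hxT, if_true]
      have := hx.1 hxT
      omega
    · simp only [hxT, if_false]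
      rw [hx] at hxT
      omega
  · rintro ⟨f, g⟩ h
    rw [Finset.mem_product] at h
    obtain ⟨h1, h2⟩ := key f g h.1 h.2
    dsimp only
    rw [h1, h2]

/-- The blocks of `π` inside `s` lie in the level sets of `f`. -/
def Compat (π : NCPartition n) (s : Finset (Fin n)) (f : Fin n → ℕ) : Prop :=
  ∀ x ∈ s, ∀ y ∈ s, π.Same x y → y ∈ level f x

open Classical in
/-- The product of the restrictions of `π` to the level sets of `f` meeting `s`, if these are
unions of blocks. -/
def weight (K : Type*) [Field K] (π : NCPartition n) (s : Finset (Fin n)) (f : Fin n → ℕ) :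
    NCAlg K :=
  if π.Compat s f then ∏ b ∈ s.image (level f), NCAlg.of (π.restrict b) else 0

/-- The sum over all colourings of `s` with `k` colours of the products of the restrictions of `π`
to the level sets. -/
def colorSum (K : Type*) [Field K] (π : NCPartition n) (s : Finset (Fin n)) (k : ℕ) : NCAlg K :=
  ∑ f ∈ funcs s k, π.weight K s f

theorem level_comp {s : Finset (Fin n)} {k : ℕ} {f : Fin n → ℕ} (hf : f ∈ funcs s k)
    (i : Fin s.card) :
    (level (f ∘ s.orderEmbOfFin rfl) i).map (s.orderEmbOfFin rfl).toEmbedding =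
      level f (s.orderEmbOfFin rfl i) := by
  rw [mem_funcs] at hf
  set e := s.orderEmbOfFin rfl with he
  have hr : ∀ y ∈ s, ∃ j, e j = y := fun y hy => by
    have : y ∈ Set.range e := by rwa [he, Finset.range_orderEmbOfFin]
    exact this
  have hs : ∀ j, e j ∈ s := fun j => Finset.orderEmbOfFin_mem _ _ _
  ext y
  simp only [Finset.mem_map, mem_level, Function.comp_apply]
  constructor
  · rintro ⟨j, ⟨h1, h2⟩, rfl⟩
    refine ⟨h1, fun z hz => ?_⟩
    by_cases hzs : z ∈ s
    · obtain ⟨w, rfl⟩ := hr z hzs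
      refine h2 w ?_
      rw [Finset.mem_uIcc'] at hz ⊢
      simpa using hz
    · rw [hf.2 z hzs]
      exact (hf.1 _ (hs i)).le
  · rintro ⟨h1, h2⟩
    have hy : y ∈ s := by
      by_contra hy
      rw [hf.2 y hy] at h1
      exact absurd (hf.1 _ (hs i)) (by omega)
    obtain ⟨j, rfl⟩ := hr y hy
    refine ⟨j, ⟨h1, fun w hw => h2 _ ?_⟩, rfl⟩
    rw [Finset.mem_uIcc'] at hw ⊢
    simpa using hw

theorem weight_restrict (K : Type*) [Field K] (π : NCPartition n) {s : Finset (Fin n)} {k : ℕ}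
    {f : Fin n → ℕ} (hf : f ∈ funcs s k) :
    (π.restrict s).weight K Finset.univ (f ∘ s.orderEmbOfFin rfl) = π.weight K s f := by
  classical
  have hr : ∀ y ∈ s, ∃ j, s.orderEmbOfFin rfl j = y := fun y hy => by
    have : y ∈ Set.range (s.orderEmbOfFin rfl) := by rwa [Finset.range_orderEmbOfFin]
    exact this
  have hs : ∀ j, s.orderEmbOfFin rfl j ∈ s := fun j => Finset.orderEmbOfFin_mem _ _ _
  have hc : (π.restrict s).Compat Finset.univ (f ∘ s.orderEmbOfFin rfl) ↔ π.Compat s f := by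
    constructor
    · intro h x hx y hy hxy
      obtain ⟨i, rfl⟩ := hr x hx
      obtain ⟨j, rfl⟩ := hr y hy
      rw [← level_comp hf]
      exact Finset.mem_map_of_mem _
        (h i (Finset.mem_univ _) j (Finset.mem_univ _) ((same_restrict _ _ _ _).2 hxy))
    · intro h i _ j _ hij
      have := h _ (hs i) _ (hs j) ((same_restrict _ _ _ _).1 hij)
      rw [← level_comp hf] at this
      simpa using this
  have hi : s.image (level f) = (Finset.univ.image (level (f ∘ s.orderEmbOfFin rfl))).image
      (fun b => b.map (s.orderEmbOfFin rfl).toEmbedding) := by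
    ext b
    simp only [Finset.mem_image, Finset.mem_univ, true_and, exists_exists_eq_and, level_comp hf]
    constructor
    · rintro ⟨x, hx, rfl⟩
      obtain ⟨i, rfl⟩ := hr x hx
      exact ⟨i, rfl⟩
    · rintro ⟨i, rfl⟩
      exact ⟨_, hs i, rfl⟩
  rw [weight, weight, hi, Finset.prod_image fun _ _ _ _ h => Finset.map_injective _ h]
  simp only [hc, NCAlg.of_restrict_restrict]

theorem colorSum_restrict (K : Type*) [Field K] (π : NCPartition n) (s : Finset (Fin n)) (k : ℕ) :
    (π.restrict s).colorSum K Finset.univ k = π.colorSum K s k := by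
  refine Finset.sum_nbij' (fun g => Function.extend (s.orderEmbOfFin rfl) g fun _ => k)
    (fun f => f ∘ s.orderEmbOfFin rfl) ?_ ?_ ?_ ?_ ?_
  · intro g hg
    rw [mem_funcs] at hg ⊢
    constructor
    · intro x hx
      have : x ∈ Set.range (s.orderEmbOfFin rfl) := by rwa [Finset.range_orderEmbOfFin]
      obtain ⟨i, rfl⟩ := this
      rw [(s.orderEmbOfFin rfl).injective.extend_apply]
      exact hg.1 i (Finset.mem_univ i)
    · intro x hx
      rw [Function.extend_apply']
      rintro ⟨i, rfl⟩
      exact hx (Finset.orderEmbOfFin_mem _ _ _)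
  · intro f hf
    rw [mem_funcs] at hf ⊢
    exact ⟨fun i _ => hf.1 _ (Finset.orderEmbOfFin_mem _ _ _), fun i hi =>
      absurd (Finset.mem_univ i) hi⟩
  · intro g _
    ext i
    simp [(s.orderEmbOfFin rfl).injective.extend_apply]
  · intro f hf
    rw [mem_funcs] at hf
    ext x
    by_cases hx : x ∈ s
    · have : x ∈ Set.range (s.orderEmbOfFin rfl) := by rwa [Finset.range_orderEmbOfFin]
      obtain ⟨i, rfl⟩ := this
      simp [(s.orderEmbOfFin rfl).injective.extend_apply]
    · rw [Function.extend_apply', hf.2 x hx]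
      rintro ⟨i, rfl⟩
      exact hx (Finset.orderEmbOfFin_mem _ _ _)
  · intro g hg
    have hg' : Function.extend (s.orderEmbOfFin rfl) g (fun _ => k) ∈ funcs s k := by
      rw [mem_funcs] at hg ⊢
      constructor
      · intro x hx
        have : x ∈ Set.range (s.orderEmbOfFin rfl) := by rwa [Finset.range_orderEmbOfFin]
        obtain ⟨i, rfl⟩ := this
        rw [(s.orderEmbOfFin rfl).injective.extend_apply]
        exact hg.1 i (Finset.mem_univ i)
      · intro x hx
        rw [Function.extend_apply']
        rintro ⟨i, rfl⟩
        exact hx (Finset.orderEmbOfFin_mem _ _ _)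
    rw [← weight_restrict K π hg']
    congr 1
    ext i
    simp [(s.orderEmbOfFin rfl).injective.extend_apply]

end NCPartition

namespace NCPartition

variable {n : ℕ}

theorem level_min {f : Fin n → ℕ} {k : ℕ} {x : Fin n} (hx : f x < k) :
    level (fun y => min (f y) k) x = level f x := by
  ext y
  simp only [mem_level]
  refine and_congr (by omega) (forall₂_congr fun z _ => by omega)

theorem level_localize_sub {f : Fin n → ℕ} {k l : ℕ} {c T : Finset (Fin n)}
    (hT : ∀ x, x ∈ T ↔ k ≤ f x) (hl : ∀ x, f x < k + l) (hc : c ∈ components T) {x : Fin n}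
    (hx : x ∈ c) :
    level (localize c l (localize T l fun y => f y - k)) x = level f x := by
  have hcT := subset_of_mem_components hc
  rw [localize_localize hcT]
  have hv : ∀ y ∈ c, localize c l (fun y => f y - k) y = f y - k := fun y hy => by
    simp [localize, hy]
  have hv' : ∀ y ∉ c, localize c l (fun y => f y - k) y = l := fun y hy => by
    simp [localize, hy]
  have hkx := (hT x).1 (hcT hx)
  have hlx := hl x
  ext y
  rw [mem_level, mem_level, hv x hx]
  constructor
  · rintro ⟨h1, h2⟩
    have hy : y ∈ c := by
      by_contra hy
      rw [hv' y hy] at h1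
      omega
    have hky := (hT y).1 (hcT hy)
    rw [hv y hy] at h1
    refine ⟨by omega, fun z hz => ?_⟩
    have hzc := uIcc_subset_of_mem_components hc hx hy hz
    have h3 := h2 z hz
    have hkz := (hT z).1 (hcT hzc)
    rw [hv z hzc] at h3
    omega
  · rintro ⟨h1, h2⟩
    have hi : Finset.uIcc x y ⊆ T := fun z hz => (hT z).2 (hkx.trans (h2 z hz))
    have hy : y ∈ c := by
      rw [← component_eq_of_mem_components hc hx, mem_component]
      exact ⟨(hT y).2 (by omega), hi⟩
    rw [hv y hy, h1]
    refine ⟨rfl, fun z hz => ?_⟩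
    have hzc := uIcc_subset_of_mem_components hc hx hy hz
    rw [hv z hzc]
    have := h2 z hz
    omega

theorem level_subset_component {f : Fin n → ℕ} {k : ℕ} {c T : Finset (Fin n)}
    (hT : ∀ x, x ∈ T ↔ k ≤ f x) (hc : c ∈ components T) {x : Fin n} (hx : x ∈ c) :
    level f x ⊆ c := by
  intro y hy
  rw [mem_level] at hy
  have hkx := (hT x).1 (subset_of_mem_components hc hx)
  rw [← component_eq_of_mem_components hc hx, mem_component]
  exact ⟨(hT y).2 (by omega), fun z hz => (hT z).2 (hkx.trans (hy.2 z hz))⟩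

theorem weight_congr (K : Type*) [Field K] (π : NCPartition n) {s : Finset (Fin n)}
    {f g : Fin n → ℕ} (h : ∀ x ∈ s, level f x = level g x) : π.weight K s f = π.weight K s g := by
  have h1 : π.Compat s f ↔ π.Compat s g :=
    forall₂_congr fun x hx => forall₂_congr fun y _ => by rw [h x hx]
  have h2 : s.image (level f) = s.image (level g) := Finset.image_congr fun x hx => h x hx
  by_cases h : π.Compat s g
  · rw [weight, weight, if_pos h, if_pos (h1.2 h), h2]
  · rw [weight, weight, if_neg h, if_neg (mt h1.1 h)]

theorem weight_univ_eq_mul (K : Type*) [Field K] {π : NCPartition n}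
    {I : Finset (Finset (Fin n))} (hI : π.IsIdeal I) {k : ℕ} {f : Fin n → ℕ}
    (hT : ∀ x, x ∈ I.biUnion id ↔ k ≤ f x) :
    π.weight K Finset.univ f =
      π.weight K (I.biUnion id)ᶜ f * ∏ c ∈ components (I.biUnion id), π.weight K c f := by
  classical
  have hI' := (isIdeal_iff hI.1).1 hI
  set T := I.biUnion id with hTdef
  have hcompat : π.Compat Finset.univ f ↔
      π.Compat Tᶜ f ∧ ∀ c ∈ components T, π.Compat c f := by
    constructor
    · exact fun h => ⟨fun x _ y _ => h x (Finset.mem_univ x) y (Finset.mem_univ y),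
        fun c _ x _ y _ => h x (Finset.mem_univ x) y (Finset.mem_univ y)⟩
    · rintro ⟨h1, h2⟩ x _ y _ hxy
      by_cases hx : x ∈ T
      · exact h2 _ (component_mem_components hx) x (mem_component_self hx) y (hI' x hx y hxy) hxy
      · refine h1 x (by simpa using hx) y ?_ hxy
        rw [Finset.mem_compl]
        exact fun hy => hx (exists_mem_of_biUnion hI.1 hy hxy.symm)
  by_cases h : π.Compat Finset.univ f
  · obtain ⟨h1, h2⟩ := hcompat.1 h
    rw [weight, weight, if_pos h, if_pos h1]
    have hu : (Finset.univ : Finset (Fin n)).image (level f) =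
        Tᶜ.image (level f) ∪ (components T).biUnion fun c => c.image (level f) := by
      ext b
      simp only [Finset.mem_image, Finset.mem_union, Finset.mem_biUnion, Finset.mem_univ, true_and]
      constructor
      · rintro ⟨x, rfl⟩
        by_cases hx : x ∈ T
        · exact Or.inr ⟨_, component_mem_components hx, x, mem_component_self hx, rfl⟩
        · exact Or.inl ⟨x, by simpa using hx, rfl⟩
      · rintro (⟨x, -, rfl⟩ | ⟨c, -, x, -, rfl⟩) <;> exact ⟨x, rfl⟩
    rw [hu, Finset.prod_union, Finset.prod_biUnion]
    · congr 1
      refine Finset.prod_congr rfl fun c hc => ?_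
      rw [weight, if_pos (h2 c hc)]
    · intro c hc d hd hne
      refine Finset.disjoint_left.2 fun b hb hb' => ?_
      obtain ⟨x, hx, rfl⟩ := Finset.mem_image.1 hb
      obtain ⟨y, hy, hxy⟩ := Finset.mem_image.1 hb'
      have hxd : x ∈ d := level_subset_component hT hd hy (hxy ▸ mem_level_self f x)
      exact Finset.disjoint_left.1 (components_pairwiseDisjoint T hc hd hne) hx hxd
    · refine Finset.disjoint_left.2 fun b hb hb' => ?_
      obtain ⟨x, hx, rfl⟩ := Finset.mem_image.1 hb
      obtain ⟨c, hc, hb'⟩ := Finset.mem_biUnion.1 hb'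
      obtain ⟨y, hy, hxy⟩ := Finset.mem_image.1 hb'
      have hxd : x ∈ c := level_subset_component hT hc hy (hxy ▸ mem_level_self f x)
      exact Finset.mem_compl.1 hx (subset_of_mem_components hc hxd)
  · rw [weight, if_neg h]
    rw [hcompat, not_and_or] at h
    rcases h with h | h
    · rw [weight, if_neg h, zero_mul]
    · push Not at h
      obtain ⟨c, hc, h⟩ := h
      rw [Finset.prod_eq_zero hc, mul_zero]
      rw [weight, if_neg h]

theorem sum_weight_eq_colorSum_mul (K : Type*) [Field K] {π : NCPartition n}
    {I : Finset (Finset (Fin n))} (hI : π.IsIdeal I) (k l : ℕ) :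
    ∑ f ∈ (funcs Finset.univ (k + l)).filter (fun f => ∀ x, x ∈ I.biUnion id ↔ k ≤ f x),
        π.weight K Finset.univ f =
      π.colorSum K (I.biUnion id)ᶜ k *
        ∏ c ∈ components (I.biUnion id), π.colorSum K c l := by
  have h := prod_sum_funcs (components (I.biUnion id)) (components_pairwiseDisjoint _) l
    (fun c f => π.weight K c f)
  rw [biUnion_components] at h
  unfold colorSum
  rw [h, sum_funcs_mul_sum_funcs_compl]
  refine Finset.sum_congr rfl fun f hf => ?_
  rw [Finset.mem_filter, mem_funcs] at hf
  obtain ⟨⟨hl, -⟩, hT⟩ := hf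
  rw [weight_univ_eq_mul K hI hT]
  congr 1
  · refine weight_congr K π fun x hx => (level_min ?_).symm
    rw [Finset.mem_compl, hT x] at hx
    omega
  · refine Finset.prod_congr rfl fun c hc => weight_congr K π fun x hx => ?_
    rw [level_localize_sub hT (fun x => hl x (Finset.mem_univ x)) hc hx]

theorem filter_le_isIdeal {π : NCPartition n} {f : Fin n → ℕ} (hf : π.Compat Finset.univ f)
    (k : ℕ) :
    π.IsIdeal (π.parts.filter fun b => ∀ x ∈ b, k ≤ f x) ∧
      ∀ x, x ∈ (π.parts.filter fun b => ∀ x ∈ b, k ≤ f x).biUnion id ↔ k ≤ f x := by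
  have hT : ∀ x, x ∈ (π.parts.filter fun b => ∀ x ∈ b, k ≤ f x).biUnion id ↔ k ≤ f x := by
    intro x
    constructor
    · intro h
      obtain ⟨b, hb, hx⟩ := Finset.mem_biUnion.1 h
      exact (Finset.mem_filter.1 hb).2 x hx
    · intro h
      obtain ⟨b, hb, hx⟩ := π.exists_block x
      refine Finset.mem_biUnion.2 ⟨b, Finset.mem_filter.2 ⟨hb, fun y hy => ?_⟩, hx⟩
      have := hf x (Finset.mem_univ x) y (Finset.mem_univ y) ⟨b, hb, hx, hy⟩
      rw [mem_level] at this
      omega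
  refine ⟨(isIdeal_iff (Finset.filter_subset _ _)).2 fun x hx y hxy => ?_, hT⟩
  have := hf x (Finset.mem_univ x) y (Finset.mem_univ y) hxy
  rw [mem_level] at this
  rw [hT] at hx
  rw [mem_component, hT]
  exact ⟨by omega, fun z hz => (hT z).2 (hx.trans (this.2 z hz))⟩

open Classical in
/-- Splitting the colours `0, …, k + l - 1` into the first `k` ones and the last `l` ones. -/
theorem colorSum_add (K : Type*) [Field K] (π : NCPartition n) (k l : ℕ) :
    π.colorSum K Finset.univ (k + l) =
      ∑ I ∈ π.parts.powerset.filter (fun I => π.IsIdeal I),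
        π.colorSum K (I.biUnion id)ᶜ k *
          ∏ c ∈ components (I.biUnion id), π.colorSum K c l := by
  have h0 : π.colorSum K Finset.univ (k + l) =
      ∑ f ∈ (funcs Finset.univ (k + l)).filter (fun f => π.Compat Finset.univ f),
        π.weight K Finset.univ f := by
    rw [colorSum, Finset.sum_filter_of_ne]
    intro f _ h
    by_contra h'
    exact h (by rw [weight, if_neg h'])
  rw [h0, ← Finset.sum_fiberwise_of_maps_to
    (t := π.parts.powerset.filter (fun I => π.IsIdeal I))
    (g := fun f => π.parts.filter fun b => ∀ x ∈ b, k ≤ f x)]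
  · refine Finset.sum_congr rfl fun I hI => ?_
    have hI' := (Finset.mem_filter.1 hI).2
    rw [← sum_weight_eq_colorSum_mul K hI']
    rw [Finset.filter_filter]
    have h1 : ∀ f, π.Compat Finset.univ f →
        ((π.parts.filter fun b => ∀ x ∈ b, k ≤ f x) = I ↔
          ∀ x, x ∈ I.biUnion id ↔ k ≤ f x) := by
      intro f hf
      constructor
      · rintro rfl
        exact (filter_le_isIdeal hf k).2
      · intro h
        ext b
        rw [Finset.mem_filter]
        constructor
        · rintro ⟨hb, hb'⟩
          rw [mem_iff_subset_biUnion hI'.1 hb]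
          exact fun x hx => (h x).2 (hb' x hx)
        · intro hb
          refine ⟨hI'.1 hb, fun x hx => (h x).1 ?_⟩
          exact Finset.mem_biUnion.2 ⟨b, hb, hx⟩
    refine Finset.sum_subset_zero_on_sdiff ?_ ?_ fun _ _ => rfl
    · intro f hf
      rw [Finset.mem_filter] at hf ⊢
      exact ⟨hf.1, (h1 f hf.2.1).1 hf.2.2⟩
    · intro f hf
      rw [Finset.mem_sdiff, Finset.mem_filter, Finset.mem_filter] at hf
      rw [weight, if_neg]
      exact fun h => hf.2 ⟨hf.1.1, h, (h1 f h).2 hf.1.2⟩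
  · intro f hf
    have := (filter_le_isIdeal (Finset.mem_filter.1 hf).2 k).1
    exact Finset.mem_filter.2 ⟨Finset.mem_powerset.2 (Finset.filter_subset _ _), this⟩

end NCPartition

namespace NCPartition

variable {n : ℕ}

theorem level_comp_strictMonoOn {f : Fin n → ℕ} {u : ℕ → ℕ}
    (hu : StrictMonoOn u (Set.range f)) : level (u ∘ f) = level f := by
  ext x y
  simp only [mem_level, Function.comp_apply]
  refine and_congr (hu.injOn.eq_iff ⟨y, rfl⟩ ⟨x, rfl⟩) (forall₂_congr fun z _ => ?_)
  exact hu.le_iff_le ⟨x, rfl⟩ ⟨z, rfl⟩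

theorem ofFun_congr {f g : Fin n → ℕ} (h : level f = level g) : ofFun f = ofFun g :=
  ext_same fun x y => by rw [same_ofFun, same_ofFun, h]

theorem mem_funcs_univ {k : ℕ} {f : Fin n → ℕ} :
    f ∈ funcs Finset.univ k ↔ ∀ x, f x < k := by
  simp [mem_funcs]

open Classical in
/-- The number of functions from `[n]` to `{0, …, k - 1}` with `σ` as level partition. -/
def count (σ : NCPartition n) (k : ℕ) : ℕ :=
  ((funcs Finset.univ k).filter fun f => ofFun f = σ).card

open Classical in
/-- The number of surjections from `[n]` to `{0, …, k - 1}` with `σ` as level partition. -/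
def surjCount (σ : NCPartition n) (k : ℕ) : ℕ :=
  ((funcs Finset.univ k).filter fun f =>
    Finset.univ.image f = Finset.range k ∧ ofFun f = σ).card

open Classical in
theorem card_filter_image_eq (σ : NCPartition n) {k : ℕ} {A : Finset ℕ}
    (hA : A ⊆ Finset.range k) :
    ((funcs Finset.univ k).filter fun f => Finset.univ.image f = A ∧ ofFun f = σ).card =
      σ.surjCount A.card := by
  have hfin : {a | a ∈ A}.Finite := A.finite_toSet
  have hcard : ∀ h : {a | a ∈ A}.Finite, h.toFinset.card = A.card := by
    intro h
    congr 1
    ext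
    simp
  have hnth : ∀ i < A.card, Nat.nth (· ∈ A) i ∈ A ∧ Nat.count (· ∈ A) (Nat.nth (· ∈ A) i) = i :=
    fun i hi => ⟨Nat.nth_mem i fun hf => by rwa [hcard], Nat.count_nth fun hf => by rwa [hcard]⟩
  have hcount : ∀ a ∈ A, Nat.count (· ∈ A) a < A.card := by
    intro a ha
    rw [← hcard hfin]
    exact Nat.count_lt_card hfin ha
  have hmono : StrictMonoOn (Nat.count (· ∈ A)) (A : Set ℕ) := fun a ha b _ hab =>
    Nat.count_strict_mono ha hab
  have hmono' : StrictMonoOn (Nat.nth (· ∈ A)) (Finset.range A.card : Set ℕ) := by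
    intro i hi j hj hij
    rw [Finset.coe_range] at hi hj
    refine Nat.nth_strictMonoOn hfin ?_ ?_ hij <;> simpa [hcard]
  refine Finset.card_nbij' (fun f => Nat.count (· ∈ A) ∘ f) (fun g => Nat.nth (· ∈ A) ∘ g)
    ?_ ?_ ?_ ?_
  · intro f hf
    simp only [Finset.coe_filter, Set.mem_ofPred_eq, mem_funcs_univ] at hf ⊢
    obtain ⟨h1, rfl, rfl⟩ := hf
    refine ⟨fun x => hcount _ (by simp), ?_, ofFun_congr (level_comp_strictMonoOn ?_)⟩
    · rw [← Finset.image_image]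
      ext i
      rw [Finset.mem_image, Finset.mem_range]
      constructor
      · rintro ⟨a, ha, rfl⟩
        exact hcount a ha
      · intro hi
        exact ⟨_, hnth i hi⟩
    · simpa using hmono
  · intro g hg
    simp only [Finset.coe_filter, Set.mem_ofPred_eq, mem_funcs_univ] at hg ⊢
    obtain ⟨h1, h2, rfl⟩ := hg
    refine ⟨fun x => Finset.mem_range.1 (hA (hnth _ (h1 x)).1), ?_,
      ofFun_congr (level_comp_strictMonoOn ?_)⟩
    · rw [← Finset.image_image, h2]
      ext a
      rw [Finset.mem_image]
      constructor
      · rintro ⟨i, hi, rfl⟩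
        exact (hnth i (Finset.mem_range.1 hi)).1
      · intro ha
        exact ⟨_, Finset.mem_range.2 (hcount a ha), Nat.nth_count ha⟩
    · have := hmono'
      rw [← h2] at this
      simpa using this
  · intro f hf
    simp only [Finset.coe_filter, Set.mem_ofPred_eq] at hf
    ext x
    exact Nat.nth_count (by rw [← hf.2.1]; simp)
  · intro g hg
    simp only [Finset.coe_filter, Set.mem_ofPred_eq, mem_funcs_univ] at hg
    ext x
    exact (hnth _ (hg.1 x)).2

theorem surjCount_eq_zero (σ : NCPartition n) {k : ℕ} (h : n < k) : σ.surjCount k = 0 := by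
  classical
  rw [surjCount, Finset.card_eq_zero, Finset.filter_eq_empty_iff]
  rintro f - ⟨hf, -⟩
  have := Finset.card_image_le (s := Finset.univ) (f := f)
  rw [hf] at this
  simp at this
  omega

theorem count_eq_sum (σ : NCPartition n) (k : ℕ) :
    σ.count k = ∑ m ∈ Finset.range (n + 1), k.choose m * σ.surjCount m := by
  classical
  have h1 : σ.count k = ∑ A ∈ (Finset.range k).powerset, σ.surjCount A.card := by
    rw [count, Finset.card_eq_sum_card_fiberwise (f := fun f => Finset.univ.image f)
      (t := (Finset.range k).powerset)]
    · refine Finset.sum_congr rfl fun A hA => ?_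
      rw [← card_filter_image_eq σ (Finset.mem_powerset.1 hA), Finset.filter_filter]
      simp only [and_comm]
    · intro f hf
      simp only [Finset.coe_filter, Set.mem_ofPred_eq, mem_funcs_univ] at hf
      simp only [Finset.coe_powerset, Set.mem_preimage, Set.mem_powerset_iff, Finset.coe_subset]
      intro i hi
      obtain ⟨x, -, rfl⟩ := Finset.mem_image.1 hi
      exact Finset.mem_range.2 (hf.1 x)
  rw [h1, Finset.sum_powerset_apply_card (fun m => σ.surjCount m), Finset.card_range]
  simp only [smul_eq_mul]
  rcases le_total k n with h | h
  · refine Finset.sum_subset (Finset.range_mono (by omega)) fun m _ hm => ?_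
    rw [Nat.choose_eq_zero_of_lt (by simpa using hm), zero_mul]
  · refine (Finset.sum_subset (Finset.range_mono (by omega)) fun m _ hm => ?_).symm
    rw [surjCount_eq_zero σ (by simpa using hm), mul_zero]

/-- The polynomial whose value at each natural number `k` is `σ.count k`. -/
def countPoly (K : Type*) [Field K] (σ : NCPartition n) : Polynomial K :=
  ∑ m ∈ Finset.range (n + 1),
    Polynomial.C ((σ.surjCount m : K) * (m.factorial : K)⁻¹) * descPochhammer K m

theorem eval_countPoly (K : Type*) [Field K] [CharZero K] (σ : NCPartition n) (k : ℕ) :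
    (σ.countPoly K).eval (k : K) = σ.count k := by
  rw [countPoly, Polynomial.eval_finsetSum, count_eq_sum, Nat.cast_sum]
  refine Finset.sum_congr rfl fun m _ => ?_
  rw [Polynomial.eval_mul, Polynomial.eval_C, descPochhammer_eval_eq_descFactorial,
    Nat.descFactorial_eq_factorial_mul_choose]
  have : (m.factorial : K) ≠ 0 := Nat.cast_ne_zero.2 m.factorial_ne_zero
  push_cast
  field_simp

theorem colorSum_eq_sum_count (K : Type*) [Field K] (π : NCPartition n) (k : ℕ)
    [DecidablePred fun σ : NCPartition n => π.toFinpartition ≤ σ.toFinpartition] :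
    π.colorSum K Finset.univ k =
      ∑ σ ∈ (Finset.univ : Finset (NCPartition n)).filter
        (fun σ => π.toFinpartition ≤ σ.toFinpartition),
        (σ.count k : K) • ∏ x ∈ σ.parts, (NCAlg.of (π.restrict x) : NCAlg K) := by
  classical
  rw [colorSum, ← Finset.sum_fiberwise_of_maps_to (t := Finset.univ) (g := ofFun)
    fun _ _ => Finset.mem_univ _, Finset.sum_filter]
  refine Finset.sum_congr rfl fun σ _ => ?_
  have hc : ∀ f, ofFun f = σ → (π.Compat Finset.univ f ↔
      π.toFinpartition ≤ σ.toFinpartition) := by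
    rintro f rfl
    rw [le_iff_same]
    simp [Compat, same_ofFun]
  split_ifs with h
  · rw [Finset.sum_congr rfl (g := fun _ => ∏ x ∈ σ.parts, (NCAlg.of (π.restrict x) : NCAlg K)),
      Finset.sum_const, count, Nat.cast_smul_eq_nsmul]
    intro f hf
    have hf := (Finset.mem_filter.1 hf).2
    rw [weight, if_pos ((hc f hf).2 h), ← hf, parts_ofFun]
  · refine Finset.sum_eq_zero fun f hf => ?_
    rw [weight, if_neg]
    rw [hc f (Finset.mem_filter.1 hf).2]
    exact h

theorem colorSum_zero_eq_one (K : Type*) [Field K] (π : NCPartition 0) (k : ℕ) :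
    π.colorSum K Finset.univ k = 1 := by
  have h : funcs (Finset.univ : Finset (Fin 0)) k = {fun _ => k} := by
    ext f
    simp [mem_funcs, Subsingleton.elim f fun _ => k]
  have hc : π.Compat Finset.univ fun _ => k := fun x => x.elim0
  rw [colorSum, h, Finset.sum_singleton, weight, if_pos hc]
  simp

end NCPartition

namespace NCAlg

variable {K : Type*} [Field K]

theorem algHom_ext_of {B : Type*} [Semiring B] [Algebra K B] {a b : NCAlg K →ₐ[K] B}
    (h : ∀ (n : ℕ) (π : NCPartition n), 0 < n → a (of π) = b (of π)) : a = b := by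
  refine MvPolynomial.algHom_ext fun p => ?_
  have := h p.1 p.2 p.1.pos
  rwa [of_pos p.2 p.1.pos] at this

/-- The convolution of algebra morphisms from `K[NCP]` to a commutative algebra. -/
def conv {B : Type*} [CommSemiring B] [Algebra K B] (a b : NCAlg K →ₐ[K] B) : NCAlg K →ₐ[K] B :=
  (Algebra.TensorProduct.lift a b fun _ _ => Commute.all _ _).comp (comul K)

theorem comp_conv {B C : Type*} [CommSemiring B] [Algebra K B] [CommSemiring C] [Algebra K C]
    (g : B →ₐ[K] C) (a b : NCAlg K →ₐ[K] B) :
    g.comp (conv a b) = conv (g.comp a) (g.comp b) := by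
  rw [conv, conv, ← AlgHom.comp_assoc]
  congr 1
  refine Algebra.TensorProduct.ext ?_ ?_ <;> ext <;> simp

open Classical in
theorem comul_of {n : ℕ} (π : NCPartition n) (hn : 0 < n) :
    comul K (of π) = ∑ I ∈ π.parts.powerset.filter (fun I => π.IsIdeal I),
      of (π.restrict (I.biUnion id)ᶜ) ⊗ₜ[K]
        ∏ c ∈ NCPartition.components (I.biUnion id), of (π.restrict c) := by
  rw [of_pos π hn, comul, MvPolynomial.aeval_X]
  rfl

open Classical in
theorem conv_of {B : Type*} [CommSemiring B] [Algebra K B] (a b : NCAlg K →ₐ[K] B) {n : ℕ}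
    (π : NCPartition n) (hn : 0 < n) :
    conv a b (of π) = ∑ I ∈ π.parts.powerset.filter (fun I => π.IsIdeal I),
      a (of (π.restrict (I.biUnion id)ᶜ)) *
        ∏ c ∈ NCPartition.components (I.biUnion id), b (of (π.restrict c)) := by
  rw [conv, AlgHom.comp_apply, comul_of π hn, map_sum]
  refine Finset.sum_congr rfl fun I _ => ?_
  rw [Algebra.TensorProduct.lift_tmul, map_prod]

open Classical in
theorem delta_of {n : ℕ} (π : NCPartition n) (hn : 0 < n) :
    delta K (of π) = ∑ σ ∈ (Finset.univ : Finset (NCPartition n)).filter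
        (fun σ => π.toFinpartition ≤ σ.toFinpartition),
      of σ ⊗ₜ[K] ∏ x ∈ σ.parts, of (π.restrict x) := by
  rw [of_pos π hn, delta, MvPolynomial.aeval_X]
  rfl

variable (K)

/-- The morphism to `K[X]` which sends `π` to the polynomial counting the colourings with `π` as
level partition. -/
def toPoly : NCAlg K →ₐ[K] Polynomial K :=
  MvPolynomial.aeval fun p : (Σ n : ℕ+, NCPartition n) => p.2.countPoly K

/-- The character given by evaluating `toPoly` at `t`. -/
def char (t : K) : NCAlg K →ₐ[K] K := (Polynomial.aeval t).comp (toPoly K)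

/-- The endomorphism `(char t ⊗ id) ∘ δ`. -/
def scale (t : K) : NCAlg K →ₐ[K] NCAlg K :=
  (Algebra.TensorProduct.lift ((Algebra.ofId K (NCAlg K)).comp (char K t)) (AlgHom.id K _)
    fun _ _ => Commute.all _ _).comp (delta K)

/-- The morphism to `K[NCP][X]` whose value at `t` is `scale t`. -/
def scalePoly : NCAlg K →ₐ[K] Polynomial (NCAlg K) :=
  (Algebra.TensorProduct.lift
    ((Polynomial.mapAlgHom (Algebra.ofId K (NCAlg K))).comp (toPoly K))
    (Algebra.ofId (NCAlg K) (Polynomial (NCAlg K)) |>.restrictScalars K)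
    fun _ _ => Commute.all _ _).comp (delta K)

/-- Evaluation at a scalar of polynomials with coefficients in `K[NCP]`. -/
def evalAt (t : K) : Polynomial (NCAlg K) →ₐ[K] NCAlg K :=
  (Polynomial.aeval (algebraMap K (NCAlg K) t)).restrictScalars K

theorem evalAt_comp_scalePoly (t : K) : (evalAt K t).comp (scalePoly K) = scale K t := by
  rw [scalePoly, scale, ← AlgHom.comp_assoc]
  congr 1
  refine Algebra.TensorProduct.ext ?_ ?_
  · refine AlgHom.ext fun x => ?_
    simp [evalAt, char]
  · ext
    simp [evalAt]

variable {K}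

theorem char_of (t : K) {n : ℕ} (π : NCPartition n) (hn : 0 < n) :
    char K t (of π) = (π.countPoly K).eval t := by
  rw [of_pos π hn, char, AlgHom.comp_apply, toPoly, MvPolynomial.aeval_X]
  simp

theorem scale_of (t : K) {n : ℕ} (π : NCPartition n) (hn : 0 < n)
    [DecidablePred fun σ : NCPartition n => π.toFinpartition ≤ σ.toFinpartition] :
    scale K t (of π) = ∑ σ ∈ (Finset.univ : Finset (NCPartition n)).filter
        (fun σ => π.toFinpartition ≤ σ.toFinpartition),
      char K t (of σ) • ∏ x ∈ σ.parts, (of (π.restrict x) : NCAlg K) := by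
  rw [scale, AlgHom.comp_apply, delta_of π hn, map_sum]
  refine Finset.sum_congr (by congr) fun σ _ => ?_
  rw [Algebra.TensorProduct.lift_tmul, Algebra.smul_def]
  rfl

theorem evalAt_comp_ofId (t : K) (g : NCAlg K →ₐ[K] NCAlg K) :
    (evalAt K t).comp ((Algebra.ofId (NCAlg K)
      (Polynomial (NCAlg K)) |>.restrictScalars K).comp g) = g := by
  ext
  simp [evalAt]

theorem evalAt_comp_shift (t : K) (l : ℕ) :
    (evalAt K t).comp ((Polynomial.aeval (R := NCAlg K)
      (Polynomial.X + Polynomial.C (l : NCAlg K)) |>.restrictScalars K).comp (scalePoly K)) =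
      scale K (t + l) := by
  rw [← evalAt_comp_scalePoly, ← AlgHom.comp_assoc]
  congr 1
  refine AlgHom.ext fun p => ?_
  have h : Polynomial.eval₂ Polynomial.C (Polynomial.X + (l : Polynomial (NCAlg K))) p =
    p.comp (Polynomial.X + (l : Polynomial (NCAlg K))) := rfl
  simp [evalAt, Polynomial.aeval_def, h]

variable [CharZero K]

theorem scale_natCast_of (k : ℕ) {n : ℕ} (π : NCPartition n) :
    scale K k (of π) = π.colorSum K Finset.univ k := by
  classical
  rcases n.eq_zero_or_pos with rfl | hn
  · rw [of_eq_one, map_one, NCPartition.colorSum_zero_eq_one]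
  · rw [scale_of _ π hn, NCPartition.colorSum_eq_sum_count]
    refine Finset.sum_congr rfl fun σ _ => ?_
    rw [char_of _ σ hn, NCPartition.eval_countPoly]

theorem conv_scale_natCast (k l : ℕ) :
    conv (scale K k) (scale K l) = scale K ((k : K) + l) := by
  refine algHom_ext_of fun n π hn => ?_
  rw [conv_of _ _ π hn, ← Nat.cast_add, scale_natCast_of, NCPartition.colorSum_add]
  refine Finset.sum_congr rfl fun I _ => ?_
  rw [scale_natCast_of, NCPartition.colorSum_restrict]
  congr 1
  refine Finset.prod_congr rfl fun c _ => ?_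
  rw [scale_natCast_of, NCPartition.colorSum_restrict]

/-- Polynomials over `K[NCP]` which agree at all natural numbers agree at all scalars. -/
theorem evalAt_eq_of_natCast {p q : Polynomial (NCAlg K)}
    (h : ∀ k : ℕ, evalAt K k p = evalAt K k q) : p = q := by
  refine Polynomial.eq_of_infinite_eval_eq p q ?_
  refine (Set.infinite_range_of_injective (Nat.cast_injective (R := NCAlg K))).mono ?_
  rintro _ ⟨k, rfl⟩
  have := h k
  simpa [evalAt, Polynomial.coe_aeval_eq_eval] using this

theorem conv_scale_right_natCast (t : K) (l : ℕ) :
    conv (scale K t) (scale K l) = scale K (t + l) := by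
  have key : conv (scalePoly K) ((Algebra.ofId (NCAlg K)
      (Polynomial (NCAlg K)) |>.restrictScalars K).comp (scale K l)) =
      (Polynomial.aeval (R := NCAlg K)
      (Polynomial.X + Polynomial.C (l : NCAlg K)) |>.restrictScalars K).comp (scalePoly K) := by
    refine AlgHom.ext fun x => evalAt_eq_of_natCast fun k => ?_
    rw [← AlgHom.comp_apply, ← AlgHom.comp_apply, comp_conv, evalAt_comp_ofId, evalAt_comp_shift,
      evalAt_comp_scalePoly, conv_scale_natCast]
  rw [← evalAt_comp_shift, ← key, comp_conv, evalAt_comp_ofId, evalAt_comp_scalePoly]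

theorem conv_scale_left_natCast (t : K) (l : ℕ) :
    conv (scale K l) (scale K t) = scale K (t + l) := by
  have key : conv ((Algebra.ofId (NCAlg K)
      (Polynomial (NCAlg K)) |>.restrictScalars K).comp (scale K l)) (scalePoly K) =
      (Polynomial.aeval (R := NCAlg K)
      (Polynomial.X + Polynomial.C (l : NCAlg K)) |>.restrictScalars K).comp (scalePoly K) := by
    refine AlgHom.ext fun x => evalAt_eq_of_natCast fun k => ?_
    rw [← AlgHom.comp_apply, ← AlgHom.comp_apply, comp_conv, evalAt_comp_ofId, evalAt_comp_shift,
      evalAt_comp_scalePoly, conv_scale_natCast, add_comm]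
  rw [← evalAt_comp_shift, ← key, comp_conv, evalAt_comp_ofId, evalAt_comp_scalePoly]

end NCAlg

namespace NCPartition

variable {n : ℕ}

theorem card_parts_eq_one_iff (π : NCPartition n) (hn : 0 < n) :
    π.parts.card = 1 ↔ ∀ x y, π.Same x y := by
  rw [Finset.card_eq_one]
  constructor
  · rintro ⟨b, hb⟩ x y
    obtain ⟨c, hc, hx⟩ := π.exists_block x
    obtain ⟨d, hd, hy⟩ := π.exists_block y
    have hc' := hc
    rw [hb, Finset.mem_singleton] at hc hd
    subst hd
    subst hc
    exact ⟨c, hc', hx, hy⟩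
  · intro h
    obtain ⟨b, hb, hx⟩ := π.exists_block ⟨0, hn⟩
    refine ⟨b, Finset.eq_singleton_iff_unique_mem.2 ⟨hb, fun c hc => ?_⟩⟩
    obtain ⟨y, hy⟩ := π.nonempty_of_mem_parts hc
    exact π.eq_of_mem_parts hc hb hy ((same_iff_mem hb hx).1 (h _ y))

end NCPartition

namespace NCAlg

variable {K : Type*} [Field K] {n : ℕ}

theorem counit_of (π : NCPartition n) (hn : 0 < n) : counit K (of π) = 0 := by
  rw [of_pos π hn, counit, MvPolynomial.aeval_X]

theorem deltaCounit_of (π : NCPartition n) (hn : 0 < n) :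
    deltaCounit K (of π) = if π.parts.card = 1 then 1 else 0 := by
  rw [of_pos π hn, deltaCounit, MvPolynomial.aeval_X]
  rfl

open Classical in
theorem deltaCounit_of_restrict (π : NCPartition n) (s : Finset (Fin n)) :
    deltaCounit K (of (π.restrict s)) = if ∀ x ∈ s, ∀ y ∈ s, π.Same x y then 1 else 0 := by
  rcases s.eq_empty_or_nonempty with rfl | hs
  · rw [of_restrict_empty, map_one, if_pos (by simp)]
  · rw [deltaCounit_of _ hs.card_pos]
    refine if_congr ?_ rfl rfl
    rw [NCPartition.card_parts_eq_one_iff _ hs.card_pos]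
    constructor
    · intro h x hx y hy
      have hx' : x ∈ Set.range (s.orderEmbOfFin rfl) := by rwa [Finset.range_orderEmbOfFin]
      have hy' : y ∈ Set.range (s.orderEmbOfFin rfl) := by rwa [Finset.range_orderEmbOfFin]
      obtain ⟨i, rfl⟩ := hx'
      obtain ⟨j, rfl⟩ := hy'
      exact (NCPartition.same_restrict _ _ _ _).1 (h i j)
    · intro h i j
      rw [NCPartition.same_restrict]
      exact h _ (Finset.orderEmbOfFin_mem _ _ _) _ (Finset.orderEmbOfFin_mem _ _ _)

theorem deltaCounit_comp_scale (t : K) : (deltaCounit K).comp (scale K t) = char K t := by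
  classical
  refine algHom_ext_of fun n π hn => ?_
  rw [AlgHom.comp_apply, scale_of t π hn, map_sum, Finset.sum_eq_single π]
  · rw [map_smul, map_prod, Finset.prod_eq_one, smul_eq_mul, mul_one]
    intro b hb
    rw [deltaCounit_of_restrict, if_pos]
    exact fun x hx y hy => ⟨b, hb, hx, hy⟩
  · intro σ hσ hne
    rw [Finset.mem_filter, NCPartition.le_iff_same] at hσ
    have : ∃ x y, σ.Same x y ∧ ¬ π.Same x y := by
      by_contra! h
      exact hne (NCPartition.ext_same fun x y => ⟨h x y, hσ.2 x y⟩)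
    obtain ⟨x, y, ⟨b, hb, hx, hy⟩, h⟩ := this
    rw [map_smul, map_prod, Finset.prod_eq_zero hb, smul_zero]
    rw [deltaCounit_of_restrict, if_neg]
    exact fun H => h (H x hx y hy)
  · intro h
    simp at h

theorem lift_char_comp_delta (s t : K) :
    (Algebra.TensorProduct.lift (char K s) (char K t) fun _ _ => Commute.all _ _).comp (delta K) =
      (char K t).comp (scale K s) := by
  rw [scale, ← AlgHom.comp_assoc]
  congr 1
  refine Algebra.TensorProduct.ext ?_ ?_ <;> ext <;> simp

variable [CharZero K]

theorem scale_zero : scale K 0 = (Algebra.ofId K (NCAlg K)).comp (counit K) := by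
  refine algHom_ext_of fun n π hn => ?_
  rw [AlgHom.comp_apply, counit_of π hn, map_zero, ← Nat.cast_zero, scale_natCast_of]
  refine Finset.sum_eq_zero fun f hf => ?_
  rw [NCPartition.mem_funcs_univ] at hf
  exact absurd (hf ⟨0, hn⟩) (Nat.not_lt_zero _)

theorem scale_one : scale K 1 = AlgHom.id K (NCAlg K) := by
  refine algHom_ext_of fun n π hn => ?_
  rw [AlgHom.id_apply, ← Nat.cast_one, scale_natCast_of]
  have h : NCPartition.funcs (Finset.univ : Finset (Fin n)) 1 = {fun _ => 0} := by
    ext f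
    rw [NCPartition.mem_funcs_univ, Finset.mem_singleton, funext_iff]
    simp
  have hl : ∀ x : Fin n, NCPartition.level (fun _ => 0) x = Finset.univ := fun x => by
    simp [NCPartition.level]
  have hi : (Finset.univ : Finset (Fin n)).image (NCPartition.level fun _ => 0) =
      {Finset.univ} := by
    ext b
    simp only [Finset.mem_image, Finset.mem_univ, true_and, hl, Finset.mem_singleton, eq_comm]
    exact ⟨fun ⟨_, h⟩ => h, fun h => ⟨⟨0, hn⟩, h⟩⟩
  have hc : π.Compat Finset.univ fun _ => 0 := fun x _ y _ _ => by simp [hl]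
  rw [NCPartition.colorSum, h, Finset.sum_singleton, NCPartition.weight, if_pos hc, hi,
    Finset.prod_singleton, of_restrict_univ]

theorem char_zero : char K 0 = counit K := by
  rw [← deltaCounit_comp_scale, scale_zero]
  ext
  simp

theorem char_one : char K 1 = deltaCounit K := by
  rw [← deltaCounit_comp_scale, scale_one, AlgHom.comp_id]

theorem conv_char_natCast (k l : ℕ) : conv (char K k) (char K l) = char K ((k : K) + l) := by
  rw [← deltaCounit_comp_scale, ← deltaCounit_comp_scale, ← comp_conv, conv_scale_natCast,
    deltaCounit_comp_scale]

theorem char_comp_scale_natCast (k l : ℕ) :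
    (char K l).comp (scale K k) = char K ((k : K) * l) := by
  induction k with
  | zero =>
    rw [Nat.cast_zero, scale_zero, zero_mul, char_zero]
    ext
    simp
  | succ k ih =>
    have h := conv_scale_natCast (K := K) k 1
    rw [Nat.cast_one] at h
    rw [Nat.cast_add, Nat.cast_one, ← h, comp_conv, ih, scale_one, AlgHom.comp_id,
      ← Nat.cast_mul, conv_char_natCast]
    congr 1
    push_cast
    ring

end NCAlg

section Polynomial

variable {K : Type*} [Field K] [CharZero K]

theorem polynomial_eq_of_eval_natCast {R : Type*} [CommRing R] [IsDomain R] [CharZero R]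
    {p q : Polynomial R} (h : ∀ k : ℕ, p.eval (k : R) = q.eval (k : R)) : p = q := by
  refine Polynomial.eq_of_infinite_eval_eq p q ?_
  refine (Set.infinite_range_of_injective (Nat.cast_injective (R := R))).mono ?_
  rintro _ ⟨k, rfl⟩
  exact h k

/-- An element of `K[X] ⊗ K[X]` is determined by its values at all pairs of natural numbers. -/
theorem tensor_polynomial_ext {y z : Polynomial K ⊗[K] Polynomial K}
    (h : ∀ k l : ℕ, Algebra.TensorProduct.lift (Polynomial.aeval (k : K))
        (Polynomial.aeval (l : K)) (fun _ _ => Commute.all _ _) y =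
      Algebra.TensorProduct.lift (Polynomial.aeval (k : K))
        (Polynomial.aeval (l : K)) (fun _ _ => Commute.all _ _) z) : y = z := by
  have key : ∀ k l : ℕ, Algebra.TensorProduct.lift (Polynomial.aeval (k : K))
        (Polynomial.aeval (l : K)) (fun _ _ => Commute.all _ _) =
      ((Polynomial.aeval (k : K)).comp
        ((Polynomial.aeval (R := Polynomial K) (l : Polynomial K)).restrictScalars K)).comp
        (polyEquivTensor K (Polynomial K)).symm.toAlgHom := by
    intro k l
    refine Algebra.TensorProduct.ext ?_ ?_ <;> ext <;>
      simp [polyEquivTensor_symm_apply_tmul_eq_smul]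
  apply (polyEquivTensor K (Polynomial K)).symm.injective
  refine polynomial_eq_of_eval_natCast fun l => polynomial_eq_of_eval_natCast fun k => ?_
  have h1 := h k l
  rw [key k l] at h1
  simpa [Polynomial.coe_aeval_eq_eval] using h1

theorem NCAlg.isDoubleBialgebraHom_toPoly : IsDoubleBialgebraHom K (NCAlg.toPoly K) where
  map_counit := NCAlg.char_zero.symm
  map_deltaCounit := NCAlg.char_one.symm
  map_comul := by
    refine AlgHom.ext fun x => tensor_polynomial_ext fun k l => ?_
    have h1 : (Algebra.TensorProduct.lift (Polynomial.aeval (k : K))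
        (Polynomial.aeval (l : K)) (fun _ _ => Commute.all _ _)).comp
        ((Algebra.TensorProduct.map (NCAlg.toPoly K) (NCAlg.toPoly K)).comp (NCAlg.comul K)) =
        NCAlg.conv (NCAlg.char K k) (NCAlg.char K l) := by
      rw [NCAlg.conv, ← AlgHom.comp_assoc]
      congr 1
      refine Algebra.TensorProduct.ext ?_ ?_ <;> ext <;> simp [NCAlg.char]
    have h2 : (Algebra.TensorProduct.lift (Polynomial.aeval (k : K))
        (Polynomial.aeval (l : K)) (fun _ _ => Commute.all _ _)).comp
        ((Polynomial.aeval ((Polynomial.X : Polynomial K) ⊗ₜ[K] (1 : Polynomial K) +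
        (1 : Polynomial K) ⊗ₜ[K] (Polynomial.X : Polynomial K))).comp (NCAlg.toPoly K)) =
        NCAlg.char K ((k : K) + l) := by
      rw [NCAlg.char, ← AlgHom.comp_assoc]
      congr 1
      ext
      simp
    exact AlgHom.congr_fun (h1.trans ((NCAlg.conv_char_natCast k l).trans h2.symm)) x
  map_delta := by
    refine AlgHom.ext fun x => tensor_polynomial_ext fun k l => ?_
    have h1 : (Algebra.TensorProduct.lift (Polynomial.aeval (k : K))
        (Polynomial.aeval (l : K)) (fun _ _ => Commute.all _ _)).comp
        ((Algebra.TensorProduct.map (NCAlg.toPoly K) (NCAlg.toPoly K)).comp (NCAlg.delta K)) =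
        (NCAlg.char K l).comp (NCAlg.scale K k) := by
      rw [← NCAlg.lift_char_comp_delta, ← AlgHom.comp_assoc]
      congr 1
      refine Algebra.TensorProduct.ext ?_ ?_ <;> ext <;> simp [NCAlg.char]
    have h2 : (Algebra.TensorProduct.lift (Polynomial.aeval (k : K))
        (Polynomial.aeval (l : K)) (fun _ _ => Commute.all _ _)).comp
        ((Polynomial.aeval ((Polynomial.X : Polynomial K) ⊗ₜ[K] (Polynomial.X : Polynomial K))).comp
          (NCAlg.toPoly K)) = NCAlg.char K ((k : K) * l) := by
      rw [NCAlg.char, ← AlgHom.comp_assoc]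
      congr 1
      ext
      simp
    exact AlgHom.congr_fun (h1.trans ((NCAlg.char_comp_scale_natCast k l).trans h2.symm)) x

theorem NCAlg.eq_toPoly {φ : NCAlg K →ₐ[K] Polynomial K} (h : IsDoubleBialgebraHom K φ) :
    φ = NCAlg.toPoly K := by
  have key : ∀ k : ℕ, (Polynomial.aeval (k : K)).comp φ = NCAlg.char K k := by
    intro k
    induction k with
    | zero => rw [Nat.cast_zero, ← h.map_counit, NCAlg.char_zero]
    | succ k ih =>
      have h1 := NCAlg.conv_char_natCast (K := K) k 1
      rw [Nat.cast_one] at h1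
      rw [Nat.cast_add, Nat.cast_one, ← h1, ← ih, NCAlg.char_one, h.map_deltaCounit]
      have h2 := congrArg (AlgHom.comp (Algebra.TensorProduct.lift (Polynomial.aeval (k : K))
        (Polynomial.aeval (1 : K)) (fun _ _ => Commute.all _ _))) h.map_comul
      have h3 : (Algebra.TensorProduct.lift (Polynomial.aeval (k : K))
        (Polynomial.aeval (1 : K)) (fun _ _ => Commute.all _ _)).comp
          (Polynomial.aeval ((Polynomial.X : Polynomial K) ⊗ₜ[K] (1 : Polynomial K) +
        (1 : Polynomial K) ⊗ₜ[K] (Polynomial.X : Polynomial K))) =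
          Polynomial.aeval ((k : K) + 1) := by
        ext
        simp
      have h4 : (Algebra.TensorProduct.lift (Polynomial.aeval (k : K))
        (Polynomial.aeval (1 : K)) (fun _ _ => Commute.all _ _)).comp
          (Algebra.TensorProduct.map φ φ) = Algebra.TensorProduct.lift
          ((Polynomial.aeval (k : K)).comp φ) ((Polynomial.aeval (1 : K)).comp φ)
          (fun _ _ => Commute.all _ _) := by
        refine Algebra.TensorProduct.ext ?_ ?_ <;> ext <;> simp
      rw [← AlgHom.comp_assoc, ← AlgHom.comp_assoc, h3, h4] at h2
      exact h2.symm
  refine AlgHom.ext fun x => polynomial_eq_of_eval_natCast fun k => ?_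
  have := AlgHom.congr_fun (key k) x
  simpa [NCAlg.char, Polynomial.coe_aeval_eq_eval] using this

end Polynomial

section Antipode

variable {K A : Type*} [Field K] [CommRing A] [Algebra K A]

theorem isAntipode_of_lift {Δ : A →ₐ[K] A ⊗[K] A} {ε : A →ₐ[K] K} {S : A →ₐ[K] A}
    (h1 : (Algebra.TensorProduct.lift S (AlgHom.id K A) fun _ _ => Commute.all _ _).comp Δ =
      (Algebra.ofId K A).comp ε)
    (h2 : (Algebra.TensorProduct.lift (AlgHom.id K A) S fun _ _ => Commute.all _ _).comp Δ =
      (Algebra.ofId K A).comp ε) : IsAntipode Δ ε S.toLinearMap := by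
  have e1 : LinearMap.mul' K A ∘ₗ S.toLinearMap.rTensor A =
      (Algebra.TensorProduct.lift S (AlgHom.id K A) fun _ _ => Commute.all _ _).toLinearMap := by
    ext
    simp
  have e2 : LinearMap.mul' K A ∘ₗ S.toLinearMap.lTensor A =
      (Algebra.TensorProduct.lift (AlgHom.id K A) S fun _ _ => Commute.all _ _).toLinearMap := by
    ext
    simp
  constructor
  · rw [← LinearMap.comp_assoc, e1, ← AlgHom.comp_toLinearMap, h1]
    rfl
  · rw [← LinearMap.comp_assoc, e2, ← AlgHom.comp_toLinearMap, h2]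
    rfl

/-- The endomorphism `a ⊗ b ↦ Δ(a) (1 ⊗ b)`. -/
def comulTwist (Δ : A →ₐ[K] A ⊗[K] A) : A ⊗[K] A →ₐ[K] A ⊗[K] A :=
  Algebra.TensorProduct.lift Δ Algebra.TensorProduct.includeRight fun _ _ => Commute.all _ _

theorem antipode_unique {Δ : A →ₐ[K] A ⊗[K] A} {ε : A →ₐ[K] K}
    (h : Function.Surjective (comulTwist Δ)) {S T : A →ₗ[K] A} (hS : IsAntipode Δ ε S)
    (hT : IsAntipode Δ ε T) : S = T := by
  have key : ∀ S : A →ₗ[K] A, IsAntipode Δ ε S → ∀ z,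
      LinearMap.mul' K A (S.rTensor A (comulTwist Δ z)) =
        LinearMap.mul' K A ((Algebra.linearMap K A ∘ₗ ε.toLinearMap).rTensor A z) := by
    intro S hS z
    induction z using TensorProduct.induction_on with
    | zero => simp
    | add x y hx hy => simp only [map_add, hx, hy]
    | tmul a b =>
      have h1 : ∀ y : A ⊗[K] A, LinearMap.mul' K A (S.rTensor A (y * (1 ⊗ₜ b))) =
          LinearMap.mul' K A (S.rTensor A y) * b := by
        intro y
        induction y using TensorProduct.induction_on with
        | zero => simp
        | add x y hx hy => simp only [add_mul, map_add, hx, hy]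
        | tmul c d => simp [mul_assoc]
      have h2 := LinearMap.congr_fun hS.1 a
      simp only [LinearMap.comp_apply, AlgHom.toLinearMap_apply] at h2
      simp only [comulTwist, Algebra.TensorProduct.lift_tmul,
        Algebra.TensorProduct.includeRight_apply]
      rw [h1, h2]
      simp
  ext a
  obtain ⟨z, hz⟩ := h (a ⊗ₜ 1)
  have h1 := key S hS z
  rw [← key T hT z, hz] at h1
  simpa using h1

theorem comulTwist_surjective {σ : Type*} (w : σ → ℕ)
    (Δ : MvPolynomial σ K →ₐ[K] MvPolynomial σ K ⊗[K] MvPolynomial σ K)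
    (h : ∀ p (B : Subalgebra K (MvPolynomial σ K ⊗[K] MvPolynomial σ K)),
      (∀ b, 1 ⊗ₜ b ∈ B) → (∀ q, w q < w p → MvPolynomial.X q ⊗ₜ 1 ∈ B) →
      Δ (MvPolynomial.X p) - MvPolynomial.X p ⊗ₜ 1 ∈ B) :
    Function.Surjective (comulTwist Δ) := by
  rw [← AlgHom.range_eq_top]
  have h1 : ∀ b, (1 : MvPolynomial σ K) ⊗ₜ[K] b ∈ (comulTwist Δ).range := fun b =>
    ⟨1 ⊗ₜ b, by simp [comulTwist]⟩
  have h2 : ∀ m p, w p = m →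
      (MvPolynomial.X p : MvPolynomial σ K) ⊗ₜ[K] (1 : MvPolynomial σ K) ∈
        (comulTwist Δ).range := by
    intro m
    induction m using Nat.strong_induction_on with
    | _ m ih =>
      intro p hp
      have h3 := h p _ h1 fun q hq => ih (w q) (hp ▸ hq) q rfl
      have h4 : Δ (MvPolynomial.X p) ∈ (comulTwist Δ).range :=
        ⟨MvPolynomial.X p ⊗ₜ 1, by simp [comulTwist, ← Algebra.TensorProduct.one_def]⟩
      have := Subalgebra.sub_mem _ h4 h3
      rwa [sub_sub_cancel] at this
  have h3 : (comulTwist Δ).range.comap (Algebra.TensorProduct.includeLeft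
      (R := K) (S := K) (A := MvPolynomial σ K) (B := MvPolynomial σ K)) = ⊤ := by
    rw [eq_top_iff, ← MvPolynomial.adjoin_range_X, Algebra.adjoin_le_iff]
    rintro _ ⟨p, rfl⟩
    exact h2 _ p rfl
  rw [eq_top_iff]
  rintro z -
  induction z using TensorProduct.induction_on with
  | zero => exact Subalgebra.zero_mem _
  | add x y hx hy => exact Subalgebra.add_mem _ hx hy
  | tmul a b =>
    have h4 : a ∈ (comulTwist Δ).range.comap (Algebra.TensorProduct.includeLeft
      (R := K) (S := K) (A := MvPolynomial σ K) (B := MvPolynomial σ K)) := by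
      rw [h3]
      trivial
    rw [Subalgebra.mem_comap, Algebra.TensorProduct.includeLeft_apply] at h4
    have := Subalgebra.mul_mem _ h4 (h1 b)
    simpa using this

theorem NCAlg.comulTwist_comul_surjective :
    Function.Surjective (comulTwist (NCAlg.comul K)) := by
  classical
  refine comulTwist_surjective (fun p => (p.1 : ℕ)) _ fun p B h1 h2 => ?_
  obtain ⟨n, π⟩ := p
  have hp : (MvPolynomial.X ⟨n, π⟩ : NCAlg K) = NCAlg.of π := (NCAlg.of_pos π n.pos).symm
  rw [hp, NCAlg.comul_of π n.pos]
  have he : (∅ : Finset (Finset (Fin n))) ∈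
      π.parts.powerset.filter (fun I => π.IsIdeal I) := by
    rw [Finset.mem_filter]
    exact ⟨Finset.empty_mem_powerset _, (NCPartition.isIdeal_iff (Finset.empty_subset _)).2
      (by simp)⟩
  rw [← Finset.add_sum_erase _ _ he]
  have h0 : NCPartition.components (∅ : Finset (Fin n)) = ∅ := by simp [NCPartition.components]
  rw [Finset.biUnion_empty, Finset.compl_empty, NCAlg.of_restrict_univ, h0, Finset.prod_empty,
    add_sub_cancel_left]
  refine Subalgebra.sum_mem _ fun I hI => ?_
  rw [Finset.mem_erase, Finset.mem_filter] at hI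
  obtain ⟨hne, -, hI⟩ := hI
  set T := I.biUnion id with hT
  have hlt : Tᶜ.card < n := by
    obtain ⟨b, hb⟩ := Finset.nonempty_iff_ne_empty.2 hne
    obtain ⟨x, hx⟩ := π.nonempty_of_mem_parts (hI.1 hb)
    have hxT : x ∈ T := Finset.mem_biUnion.2 ⟨b, hb, hx⟩
    have := Finset.card_pos.2 ⟨x, hxT⟩
    rw [Finset.card_compl, Fintype.card_fin]
    have := n.pos
    omega
  have h3 : (NCAlg.of (π.restrict Tᶜ) : NCAlg K) ⊗ₜ[K] (1 : NCAlg K) ∈ B := by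
    rcases Nat.eq_zero_or_pos Tᶜ.card with h | h
    · have : Tᶜ = ∅ := Finset.card_eq_zero.1 h
      rw [this, NCAlg.of_restrict_empty]
      exact h1 1
    · rw [NCAlg.of_pos _ h]
      exact h2 _ hlt
  have := Subalgebra.mul_mem _ h3 (h1 (∏ c ∈ NCPartition.components T, NCAlg.of (π.restrict c)))
  simpa using this

theorem NCAlg.isAntipode_scale [CharZero K] :
    IsAntipode (NCAlg.comul K) (NCAlg.counit K) (NCAlg.scale K (-1)).toLinearMap := by
  have h1 := NCAlg.conv_scale_right_natCast (K := K) (-1) 1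
  have h2 := NCAlg.conv_scale_left_natCast (K := K) (-1) 1
  rw [Nat.cast_one, neg_add_cancel, NCAlg.scale_one, NCAlg.scale_zero] at h1 h2
  exact isAntipode_of_lift h1 h2

theorem NCAlg.eq_scale [CharZero K] {S : NCAlg K →ₗ[K] NCAlg K}
    (hS : IsAntipode (NCAlg.comul K) (NCAlg.counit K) S) :
    S = (NCAlg.scale K (-1)).toLinearMap :=
  antipode_unique NCAlg.comulTwist_comul_surjective hS NCAlg.isAntipode_scale

end Antipode

namespace NCPartition

variable {n : ℕ}

theorem Same.of_lt {π : NCPartition n} {x y z t : Fin n} (hxz : π.Same x z) (hyt : π.Same y t)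
    (h1 : x < y) (h2 : y < z) (h3 : z < t) : π.Same x y := by
  obtain ⟨b, hb, hx, hz⟩ := hxz
  obtain ⟨c, hc, hy, ht⟩ := hyt
  by_contra h
  refine π.noncrossing b hb c hc ?_ x hx z hz y hy t ht ⟨h1, h2, h3⟩
  rintro rfl
  exact h ⟨b, hb, hx, hy⟩

open Classical in
/-- The elements on the left of `b` which are linked to an element on the right of `b`. -/
def outside (π : NCPartition n) (b : Finset (Fin n)) : Finset (Fin n) :=
  Finset.univ.filter fun u => (∀ x ∈ b, u < x) ∧ ∃ y, π.Same u y ∧ ∀ x ∈ b, x < y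

theorem mem_outside {π : NCPartition n} {b : Finset (Fin n)} {u : Fin n} :
    u ∈ π.outside b ↔ (∀ x ∈ b, u < x) ∧ ∃ y, π.Same u y ∧ ∀ x ∈ b, x < y := by
  simp [outside]

/-- Two linked elements, one on each side of an element of another block, enclose that block. -/
theorem mem_outside_of_between {π : NCPartition n} {b : Finset (Fin n)} (hb : b ∈ π.parts)
    {u y w : Fin n} (h : π.Same u y) (hw : w ∈ b) (hu : u ∉ b) (h1 : u < w) (h2 : w < y) :
    (∀ x ∈ b, u < x) ∧ ∀ x ∈ b, x < y := by
  have hy : y ∉ b := fun hy => hu ((same_iff_mem hb hy).1 h.symm)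
  constructor
  · intro x hx
    by_contra hxu
    have hne : x ≠ u := fun h => hu (h ▸ hx)
    have hxw : π.Same x w := ⟨b, hb, hx, hw⟩
    have := hxw.of_lt h (lt_of_le_of_ne (not_lt.1 hxu) hne) h1 h2
    exact hu ((same_iff_mem hb hx).1 this)
  · intro x hx
    by_contra hxy
    have hne : y ≠ x := fun h => hy (h ▸ hx)
    have hwx : π.Same w x := ⟨b, hb, hw, hx⟩
    have := h.of_lt hwx h1 h2 (lt_of_le_of_ne (not_lt.1 hxy) hne)
    exact hu ((same_iff_mem hb hw).1 this.symm)

theorem outside_eq_of_follows {π : NCPartition n} {b c : Finset (Fin n)} (hb : b ∈ π.parts)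
    (hc : c ∈ π.parts) (h : Follows b c) : π.outside b = π.outside c := by
  obtain ⟨i, hi, j, hj, hbi, hcj, hij⟩ := h
  have hlt : i < j := Fin.lt_def.2 (by omega)
  ext u
  rw [mem_outside, mem_outside]
  constructor
  · rintro ⟨hu, y, hs, hy⟩
    have huc : u ∉ c := fun huc => absurd ((hu i hi).trans hlt) (not_lt.2 (hcj u huc))
    have hyc : y ∉ c := fun hyc => huc ((same_iff_mem hc hyc).1 hs.symm)
    have hjy : j < y := by
      have h1 := Fin.lt_def.1 (hy i hi)
      refine lt_of_le_of_ne (Fin.le_def.2 (by omega)) ?_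
      rintro rfl
      exact hyc hj
    have := mem_outside_of_between hc hs hj huc ((hu i hi).trans hlt) hjy
    exact ⟨this.1, y, hs, this.2⟩
  · rintro ⟨hu, y, hs, hy⟩
    have hub : u ∉ b := fun hub => absurd ((hlt.trans (hy j hj)))
      (not_lt.2 (hbi y ((same_iff_mem hb hub).1 hs)))
    have hui : u < i := by
      have h1 := Fin.lt_def.1 (hu j hj)
      refine lt_of_le_of_ne (Fin.le_def.2 (by omega)) ?_
      rintro rfl
      exact hub hi
    have := mem_outside_of_between hb hs hi hub hui (hlt.trans (hy j hj))
    exact ⟨this.1, y, hs, this.2⟩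

theorem exists_min {π : NCPartition n} {b : Finset (Fin n)} (hb : b ∈ π.parts) :
    ∃ i ∈ b, ∀ x ∈ b, i ≤ x :=
  ⟨b.min' (π.nonempty_of_mem_parts hb), b.min'_mem _, fun x hx => b.min'_le x hx⟩

theorem reflTransGen_of_outside_eq {π : NCPartition n} {b : Finset (Fin n)} (hb : b ∈ π.parts)
    {i : Fin n} (hi : i ∈ b) (hbi : ∀ x ∈ b, i ≤ x) (m : ℕ) :
    ∀ c ∈ π.parts, ∀ j ∈ c, (∀ x ∈ c, j ≤ x) → (j : ℕ) = m → i ≤ j →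
      π.outside b = π.outside c →
      Relation.ReflTransGen (fun c c' => c ∈ π.parts ∧ c' ∈ π.parts ∧ Follows c c') b c := by
  induction m using Nat.strong_induction_on with
  | _ m ih =>
    intro c hc j hj hcj hjm hij hout
    rcases eq_or_lt_of_le hij with rfl | hlt
    · rw [π.eq_of_mem_parts hb hc hi hj]
    · have hlt' := Fin.lt_def.1 hlt
      obtain ⟨z, hz⟩ : ∃ z : Fin n, (z : ℕ) + 1 = j := ⟨⟨j - 1, by omega⟩, by simp; omega⟩
      have hzj : z < j := Fin.lt_def.2 (by omega)
      have hiz : i ≤ z := Fin.le_def.2 (by omega)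
      have hzc : z ∉ c := fun h => absurd hzj (not_lt.2 (hcj z h))
      obtain ⟨d, hd, hzd⟩ := π.exists_block z
      have hdz : ∀ x ∈ d, x ≤ z := by
        intro x hx
        by_contra hxz
        have hzx : π.Same z x := ⟨d, hd, hzd, hx⟩
        have hxc : x ∉ c := fun h => hzc ((same_iff_mem hc h).1 hzx.symm)
        have hjx : j < x := by
          have h1 := Fin.lt_def.1 (not_le.1 hxz)
          refine lt_of_le_of_ne (Fin.le_def.2 (by omega)) ?_
          rintro rfl
          exact hxc hj
        have h2 := mem_outside_of_between hc hzx hj hzc hzj hjx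
        have h3 : z ∈ π.outside c := mem_outside.2 ⟨h2.1, x, hzx, h2.2⟩
        rw [← hout, mem_outside] at h3
        exact absurd (h3.1 i hi) (not_lt.2 hiz)
      have hfol : Follows d c := ⟨z, hzd, j, hj, hdz, hcj, hz⟩
      have hdout := outside_eq_of_follows hd hc hfol
      obtain ⟨k, hk, hdk⟩ := exists_min hd
      have hik : i ≤ k := by
        by_contra hki
        rw [not_le] at hki
        have hkb : k ∉ b := fun h => absurd hki (not_lt.2 (hbi k h))
        have hkz : π.Same k z := ⟨d, hd, hk, hzd⟩
        have hzb : z ∉ b := fun h => hkb ((same_iff_mem hb h).1 hkz.symm)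
        have hiz' : i < z := lt_of_le_of_ne hiz (by rintro rfl; exact hzb hi)
        have h2 := mem_outside_of_between hb hkz hi hkb hki hiz'
        have h3 : k ∈ π.outside b := mem_outside.2 ⟨h2.1, z, hkz, h2.2⟩
        rw [hout, ← hdout, mem_outside] at h3
        exact lt_irrefl _ (h3.1 k hk)
      have hkz := Fin.le_def.1 (hdz k hk)
      exact (ih k (by omega) d hd k hk hdk rfl hik (hout.trans hdout.symm)).tail ⟨hd, hc, hfol⟩

theorem related_iff {π : NCPartition n} {b c : Finset (Fin n)} (hb : b ∈ π.parts)
    (hc : c ∈ π.parts) : π.Related b c ↔ π.outside b = π.outside c := by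
  have h1 : ∀ b c, Relation.ReflTransGen
      (fun c c' => c ∈ π.parts ∧ c' ∈ π.parts ∧ Follows c c') b c →
      π.outside b = π.outside c := by
    intro b c h
    induction h with
    | refl => rfl
    | tail _ h ih => exact ih.trans (outside_eq_of_follows h.1 h.2.1 h.2.2)
  constructor
  · rintro (h | h)
    exacts [h1 b c h, (h1 c b h).symm]
  · intro h
    obtain ⟨i, hi, hbi⟩ := exists_min hb
    obtain ⟨j, hj, hcj⟩ := exists_min hc
    rcases le_total i j with hij | hij
    · exact Or.inl (reflTransGen_of_outside_eq hb hi hbi _ c hc j hj hcj rfl hij h)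
    · exact Or.inr (reflTransGen_of_outside_eq hc hj hcj _ b hb i hi hbi rfl hij h.symm)

/-- The product of `catalan` of the cardinalities of the fibres of a map. -/
def catFibers {α ι : Type*} [Fintype ι] [DecidableEq ι] (P : Finset α) (κ : α → ι) : ℕ :=
  ∏ v, catalan (P.filter fun a => κ a = v).card

theorem prod_image_classes_eq {α ι : Type*} [DecidableEq α] [Fintype ι] [DecidableEq ι]
    (P : Finset α) (κ : α → ι) (r : α → α → Prop) [DecidableRel r]
    (h : ∀ a ∈ P, ∀ b ∈ P, r a b ↔ κ a = κ b) :
    ∏ X ∈ P.image (fun a => P.filter (r a)), catalan X.card = catFibers P κ := by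
  have h1 : P.image (fun a => P.filter (r a)) =
      (P.image κ).image fun v => P.filter fun b => κ b = v := by
    rw [Finset.image_image]
    refine Finset.image_congr fun a ha => ?_
    refine Finset.filter_congr fun b hb => ?_
    rw [h a ha b hb, eq_comm]
  rw [h1, Finset.prod_image, catFibers]
  · refine Finset.prod_subset (Finset.subset_univ _) fun v _ hv => ?_
    rw [Finset.filter_eq_empty_iff.2, Finset.card_empty, catalan_zero]
    intro a ha hav
    exact hv (hav ▸ Finset.mem_image_of_mem κ ha)
  · intro v hv w _ hvw
    obtain ⟨a, ha, rfl⟩ := Finset.mem_image.1 hv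
    have : a ∈ P.filter fun b => κ b = κ a := Finset.mem_filter.2 ⟨ha, rfl⟩
    dsimp only at hvw
    rw [hvw] at this
    exact (Finset.mem_filter.1 this).2

theorem catProd_eq (π : NCPartition n) : π.catProd = catFibers π.parts π.outside := by
  classical
  rw [← prod_image_classes_eq π.parts π.outside π.Related fun a ha b hb => related_iff ha hb,
    catProd, classes]

theorem catFibers_image {α β ι κ' : Type*} [DecidableEq α] [DecidableEq β] [Fintype ι]
    [DecidableEq ι]
    [Fintype κ'] [DecidableEq κ'] (P : Finset α) (φ : α → β) (hφ : Set.InjOn φ P)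
    (κ : α → ι) (κ₂ : β → κ')
    (h : ∀ a ∈ P, ∀ b ∈ P, κ a = κ b ↔ κ₂ (φ a) = κ₂ (φ b)) :
    catFibers P κ = catFibers (P.image φ) κ₂ := by
  classical
  rw [← prod_image_classes_eq P κ (fun a b => κ₂ (φ a) = κ₂ (φ b))
      (fun a ha b hb => (h a ha b hb).symm),
    ← prod_image_classes_eq (P.image φ) κ₂ (fun a b => κ₂ a = κ₂ b) (fun _ _ _ _ => Iff.rfl),
    Finset.image_image]
  have h1 : (P.image ((fun a => (P.image φ).filter fun b => κ₂ a = κ₂ b) ∘ φ)) =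
      (P.image fun a => P.filter fun b => κ₂ (φ a) = κ₂ (φ b)).image (Finset.image φ) := by
    rw [Finset.image_image]
    refine Finset.image_congr fun a _ => ?_
    rw [Function.comp_apply, Function.comp_apply, Finset.filter_image]
  rw [h1]
  symm
  rw [Finset.prod_image]
  · refine Finset.prod_congr rfl fun X hX => ?_
    obtain ⟨a, -, rfl⟩ := Finset.mem_image.1 hX
    rw [Finset.card_image_of_injOn (hφ.mono (Finset.filter_subset _ _))]
  · intro X hX Y hY hXY
    obtain ⟨a, -, rfl⟩ := Finset.mem_image.1 hX
    obtain ⟨b, -, rfl⟩ := Finset.mem_image.1 hY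
    refine Finset.coe_injective ?_
    have := congrArg (fun s : Finset β => (s : Set β)) hXY
    simp only [Finset.coe_image] at this
    exact (hφ.image_eq_image_iff (Finset.filter_subset _ _) (Finset.filter_subset _ _)).1 this

/-- The blocks of the restriction of `π` to a union of blocks. -/
theorem image_parts_restrict {π : NCPartition n} {s : Finset (Fin n)}
    (hs : ∀ x ∈ s, ∀ y, π.Same x y → y ∈ s) :
    (π.restrict s).parts.image (Finset.map (s.orderEmbOfFin rfl).toEmbedding) =
      π.parts.filter (· ⊆ s) := by
  have hr : ∀ y ∈ s, ∃ j, s.orderEmbOfFin rfl j = y := fun y hy => by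
    have : y ∈ Set.range (s.orderEmbOfFin rfl) := by rwa [Finset.range_orderEmbOfFin]
    exact this
  have hmem : ∀ j, s.orderEmbOfFin rfl j ∈ s := fun j => Finset.orderEmbOfFin_mem _ _ _
  have key : ∀ (i : Fin s.card) (b : Finset (Fin s.card)) (c : Finset (Fin n)),
      b ∈ (π.restrict s).parts → i ∈ b → c ∈ π.parts → s.orderEmbOfFin rfl i ∈ c →
      b.map (s.orderEmbOfFin rfl).toEmbedding = c := by
    intro i b c hb hi hc hic
    ext y
    rw [Finset.mem_map]
    constructor
    · rintro ⟨j, hj, rfl⟩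
      exact (same_iff_mem hc hic).1
        ((same_restrict _ _ _ _).1 ((same_iff_mem hb hi).2 hj))
    · intro hy
      have hy' := (same_iff_mem hc hic).2 hy
      obtain ⟨j, rfl⟩ := hr y (hs _ (hmem i) _ hy')
      exact ⟨j, (same_iff_mem hb hi).1 ((same_restrict _ _ _ _).2 hy'), rfl⟩
  ext c
  rw [Finset.mem_image, Finset.mem_filter]
  constructor
  · rintro ⟨b, hb, rfl⟩
    obtain ⟨i, hi⟩ := (π.restrict s).nonempty_of_mem_parts hb
    obtain ⟨c, hc, hic⟩ := π.exists_block (s.orderEmbOfFin rfl i)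
    refine ⟨?_, fun y hy => ?_⟩
    · rw [key i b c hb hi hc hic]
      exact hc
    · obtain ⟨j, -, rfl⟩ := Finset.mem_map.1 hy
      exact hmem j
  · rintro ⟨hc, hcs⟩
    obtain ⟨x, hx⟩ := π.nonempty_of_mem_parts hc
    obtain ⟨i, rfl⟩ := hr x (hcs hx)
    obtain ⟨b, hb, hi⟩ := (π.restrict s).exists_block i
    exact ⟨b, hb, key i b c hb hi hc hx⟩

theorem card_parts_restrict {π : NCPartition n} {s : Finset (Fin n)}
    (hs : ∀ x ∈ s, ∀ y, π.Same x y → y ∈ s) :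
    (π.restrict s).parts.card = (π.parts.filter (· ⊆ s)).card := by
  rw [← image_parts_restrict hs, Finset.card_image_of_injective _ (Finset.map_injective _)]

theorem catProd_restrict {π : NCPartition n} {s : Finset (Fin n)}
    (hs : ∀ x ∈ s, ∀ y, π.Same x y → y ∈ s)
    (hi : ∀ x ∈ s, ∀ y ∈ s, Finset.uIcc x y ⊆ s) :
    (π.restrict s).catProd = catFibers (π.parts.filter (· ⊆ s)) π.outside := by
  classical
  have hr : ∀ y ∈ s, ∃ j, s.orderEmbOfFin rfl j = y := fun y hy => by
    have : y ∈ Set.range (s.orderEmbOfFin rfl) := by rwa [Finset.range_orderEmbOfFin]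
    exact this
  have hmem : ∀ j, s.orderEmbOfFin rfl j ∈ s := fun j => Finset.orderEmbOfFin_mem _ _ _
  rw [catProd_eq, ← image_parts_restrict hs]
  refine catFibers_image _ _ (Finset.map_injective _).injOn _ _ fun a ha b hb => ?_
  have hin : ∀ (b : Finset (Fin s.card)), ∀ i, s.orderEmbOfFin rfl i ∈
      π.outside (b.map (s.orderEmbOfFin rfl).toEmbedding) ↔ i ∈ (π.restrict s).outside b := by
    intro b i
    rw [mem_outside, mem_outside]
    simp only [Finset.forall_mem_map, RelEmbedding.coe_toEmbedding, OrderEmbedding.lt_iff_lt]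
    refine and_congr_right fun _ => ⟨?_, ?_⟩
    · rintro ⟨y, hy, hby⟩
      obtain ⟨j, rfl⟩ := hr y (hs _ (hmem i) _ hy)
      exact ⟨j, (same_restrict _ _ _ _).2 hy, by simpa using hby⟩
    · rintro ⟨j, hj, hbj⟩
      exact ⟨_, (same_restrict _ _ _ _).1 hj, by simpa using hbj⟩
  have hout : ∀ b ∈ (π.restrict s).parts, ∀ u ∉ s,
      u ∈ π.outside (b.map (s.orderEmbOfFin rfl).toEmbedding) ↔
        (∀ x ∈ s, u < x) ∧ ∃ y, π.Same u y ∧ ∀ x ∈ s, x < y := by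
    intro b hb u hu
    obtain ⟨i, hib⟩ := (π.restrict s).nonempty_of_mem_parts hb
    rw [mem_outside]
    simp only [Finset.forall_mem_map, RelEmbedding.coe_toEmbedding]
    constructor
    · rintro ⟨h1, y, hy, h2⟩
      have hys : y ∉ s := fun h => hu (hs y h u hy.symm)
      refine ⟨fun x hx => ?_, y, hy, fun x hx => ?_⟩
      · by_contra hxu
        refine hu (hi x hx _ (hmem i) ?_)
        rw [Finset.mem_uIcc']
        exact Or.inl ⟨not_lt.1 hxu, (h1 i hib).le⟩
      · by_contra hyx
        refine hys (hi _ (hmem i) x hx ?_)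
        rw [Finset.mem_uIcc']
        exact Or.inl ⟨(h2 i hib).le, not_lt.1 hyx⟩
    · rintro ⟨h1, y, hy, h2⟩
      exact ⟨fun j _ => h1 _ (hmem j), y, hy, fun j _ => h2 _ (hmem j)⟩
  constructor
  · intro h
    ext u
    by_cases hu : u ∈ s
    · obtain ⟨i, rfl⟩ := hr u hu
      rw [hin, hin, h]
    · rw [hout a ha u hu, hout b hb u hu]
  · intro h
    ext i
    rw [← hin, ← hin, h]

end NCPartition

theorem sum_catalan_mul_catalan {α : Type*} [LinearOrder α] {S : Finset α} (hS : S.Nonempty) :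
    ∑ a ∈ S, catalan (S.filter (· < a)).card * catalan (S.filter (a < ·)).card =
      catalan S.card := by
  obtain ⟨k, hk⟩ : ∃ k, S.card = k + 1 := ⟨S.card - 1, by have := hS.card_pos; omega⟩
  obtain ⟨e, rfl⟩ : ∃ e : Fin (k + 1) ↪o α, Finset.univ.map e.toEmbedding = S :=
    ⟨_, S.map_orderEmbOfFin_univ hk⟩
  have h1 : ∀ i, ((Finset.univ.map e.toEmbedding).filter (· < e i)).card = i := by
    intro i
    have : (Finset.univ.map e.toEmbedding).filter (· < e i) =
        (Finset.Iio i).map e.toEmbedding := by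
      ext a
      simp only [Finset.mem_filter, Finset.mem_map, Finset.mem_univ, true_and, Finset.mem_Iio,
        RelEmbedding.coe_toEmbedding]
      constructor
      · rintro ⟨⟨j, rfl⟩, h⟩
        exact ⟨j, by simpa using h, rfl⟩
      · rintro ⟨j, h, rfl⟩
        exact ⟨⟨j, rfl⟩, by simpa using h⟩
    rw [this, Finset.card_map, Fin.card_Iio]
  have h2 : ∀ i : Fin (k + 1),
      ((Finset.univ.map e.toEmbedding).filter (e i < ·)).card = k - i := by
    intro i
    have : (Finset.univ.map e.toEmbedding).filter (e i < ·) =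
        (Finset.Ioi i).map e.toEmbedding := by
      ext a
      simp only [Finset.mem_filter, Finset.mem_map, Finset.mem_univ, true_and, Finset.mem_Ioi,
        RelEmbedding.coe_toEmbedding]
      constructor
      · rintro ⟨⟨j, rfl⟩, h⟩
        exact ⟨j, by simpa using h, rfl⟩
      · rintro ⟨j, h, rfl⟩
        exact ⟨⟨j, rfl⟩, by simpa using h⟩
    rw [this, Finset.card_map, Fin.card_Ioi]
    omega
  rw [hk, catalan_succ, Finset.sum_map]
  exact Finset.sum_congr rfl fun i _ => by
    rw [RelEmbedding.coe_toEmbedding, h1, h2]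

theorem prod_catalan_filter_subset {α : Type*} [DecidableEq α] {P : Finset (Finset α)}
    (hP : (P : Set (Finset α)).PairwiseDisjoint id) {D : Finset (Finset α)}
    (hne : ∀ d ∈ D, d.Nonempty) (hex : ∀ d ∈ D, ∃ c ∈ P, d ⊆ c)
    (hsame : ∀ d ∈ D, ∀ d' ∈ D, ∀ c ∈ P, d ⊆ c → d' ⊆ c) :
    ∏ c ∈ P, catalan (D.filter (· ⊆ c)).card = catalan D.card := by
  rcases D.eq_empty_or_nonempty with rfl | ⟨d, hd⟩
  · simp
  · obtain ⟨c, hc, hdc⟩ := hex d hd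
    rw [Finset.prod_eq_single c]
    · rw [Finset.filter_true_of_mem fun d' hd' => hsame d hd d' hd' c hc hdc]
    · intro c' hc' hcc
      rw [Finset.filter_false_of_mem, Finset.card_empty, catalan_zero]
      intro d' hd' hdc'
      obtain ⟨x, hx⟩ := hne d hd
      exact Finset.disjoint_left.1 (hP hc' hc hcc) (hsame d' hd' d hd c' hc' hdc' hx) (hdc hx)
    · exact fun h => absurd hc h

namespace NCPartition

variable {n : ℕ}

theorem biUnion_erase {π : NCPartition n} {b : Finset (Fin n)} (hb : b ∈ π.parts) :
    (π.parts.erase b).biUnion id = bᶜ := by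
  ext x
  rw [Finset.mem_biUnion, Finset.mem_compl]
  constructor
  · rintro ⟨c, hc, hx⟩ hxb
    rw [Finset.mem_erase] at hc
    exact hc.1 (π.eq_of_mem_parts hc.2 hb hx hxb)
  · intro hx
    obtain ⟨c, hc, hxc⟩ := π.exists_block x
    exact ⟨c, Finset.mem_erase.2 ⟨by rintro rfl; exact hx hxc, hc⟩, hxc⟩

theorem isIdeal_erase_iff {π : NCPartition n} {b : Finset (Fin n)} (hb : b ∈ π.parts) :
    π.IsIdeal (π.parts.erase b) ↔ π.outside b = ∅ := by
  rw [isIdeal_iff (Finset.erase_subset _ _), biUnion_erase hb]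
  constructor
  · intro h
    rw [Finset.eq_empty_iff_forall_notMem]
    intro u hu
    rw [mem_outside] at hu
    obtain ⟨h1, y, hy, h2⟩ := hu
    obtain ⟨x, hx⟩ := π.nonempty_of_mem_parts hb
    have hub : u ∈ bᶜ := by
      rw [Finset.mem_compl]
      exact fun hub => lt_irrefl _ (h1 u hub)
    have := (mem_component.1 (h u hub y hy)).2 (Finset.mem_uIcc'.2
      (Or.inl ⟨(h1 x hx).le, (h2 x hx).le⟩))
    exact Finset.mem_compl.1 this hx
  · intro h x hx y hxy
    rw [Finset.mem_compl] at hx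
    have hy : y ∉ b := fun hy => hx ((same_iff_mem hb hy).1 hxy.symm)
    have key : ∀ u v w, π.Same u v → u ∉ b → v ∉ b → u ≤ w → w ≤ v → w ∉ b := by
      intro u v w huv hu hv h1 h2 hw
      have h3 : u < w := lt_of_le_of_ne h1 (by rintro rfl; exact hu hw)
      have h4 : w < v := lt_of_le_of_ne h2 (by rintro rfl; exact hv hw)
      have h5 := mem_outside_of_between hb huv hw hu h3 h4
      have h6 : u ∈ π.outside b := mem_outside.2 ⟨h5.1, v, huv, h5.2⟩
      rw [h] at h6
      exact Finset.notMem_empty _ h6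
    rw [mem_component, Finset.mem_compl]
    refine ⟨hy, fun w hw => ?_⟩
    rw [Finset.mem_compl]
    rw [Finset.mem_uIcc'] at hw
    rcases hw with hw | hw
    · exact key x y w hxy hx hy hw.1 hw.2
    · exact key y x w hxy.symm hy hx hw.1 hw.2

theorem mem_of_same_of_mem_components {π : NCPartition n} {b : Finset (Fin n)} (hb : b ∈ π.parts)
    (hout : π.outside b = ∅) {c : Finset (Fin n)} (hc : c ∈ components bᶜ) :
    ∀ x ∈ c, ∀ y, π.Same x y → y ∈ c := by
  intro x hx y hxy
  have h := (isIdeal_iff (Finset.erase_subset _ _)).1 ((isIdeal_erase_iff hb).2 hout)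
  rw [biUnion_erase hb] at h
  rw [← component_eq_of_mem_components hc hx]
  exact h x (subset_of_mem_components hc hx) y hxy

theorem exists_component_of_ne {π : NCPartition n} {b d : Finset (Fin n)} (hb : b ∈ π.parts)
    (hout : π.outside b = ∅) (hd : d ∈ π.parts) (hne : d ≠ b) :
    ∃ c ∈ components bᶜ, d ⊆ c := by
  obtain ⟨x, hx⟩ := π.nonempty_of_mem_parts hd
  have hxb : x ∈ bᶜ := Finset.mem_compl.2 fun hxb => hne (π.eq_of_mem_parts hd hb hx hxb)
  refine ⟨_, component_mem_components hxb, fun y hy => ?_⟩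
  exact mem_of_same_of_mem_components hb hout (component_mem_components hxb) x
    (mem_component_self hxb) y ⟨d, hd, hx, hy⟩

theorem subset_component_of_uIcc {b d d' c : Finset (Fin n)} (hd : d.Nonempty)
    (h : ∀ x ∈ d, ∀ x' ∈ d', ∀ w ∈ b, w ∉ Finset.uIcc x x') (hc : c ∈ components bᶜ)
    (hdc : d ⊆ c) : d' ⊆ c := by
  obtain ⟨x, hx⟩ := hd
  intro x' hx'
  have h1 : Finset.uIcc x x' ⊆ bᶜ := fun w hw =>
    Finset.mem_compl.2 fun hwb => h x hx x' hx' w hwb hw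
  rw [← component_eq_of_mem_components hc (hdc hx), mem_component]
  exact ⟨h1 Finset.right_mem_uIcc, h1⟩

theorem lt_of_min_lt {π : NCPartition n} {b d : Finset (Fin n)} (hb : b ∈ π.parts)
    (hout : π.outside b = ∅) (hd : d ∈ π.parts) (h : d.min < b.min) :
    ∀ x ∈ d, ∀ w ∈ b, x < w := by
  obtain ⟨i, hi, hdi⟩ := exists_min hd
  obtain ⟨j, hj, hbj⟩ := exists_min hb
  have hij : i < j := by
    by_contra hij
    refine absurd h (not_lt.2 ?_)
    refine (Finset.min_le hj).trans (Finset.le_min fun x hx => ?_)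
    exact WithTop.coe_le_coe.2 ((not_lt.1 hij).trans (hdi x hx))
  have hib : i ∉ b := fun hib => absurd hij (not_lt.2 (hbj i hib))
  intro x hx w hw
  refine lt_of_lt_of_le ?_ (hbj w hw)
  by_contra hjx
  have hix : π.Same i x := ⟨d, hd, hi, hx⟩
  have hxj : j ≠ x := by
    rintro rfl
    exact hib ((same_iff_mem hb hj).1 hix.symm)
  have h5 := mem_outside_of_between hb hix hj hib hij (lt_of_le_of_ne (not_lt.1 hjx) hxj)
  have h6 : i ∈ π.outside b := mem_outside.2 ⟨h5.1, x, hix, h5.2⟩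
  rw [hout] at h6
  exact Finset.notMem_empty _ h6

theorem min_injOn (π : NCPartition n) :
    Set.InjOn (Finset.min : Finset (Fin n) → WithTop (Fin n)) π.parts := by
  intro b hb d hd h
  obtain ⟨i, hi, -⟩ := exists_min hb
  obtain ⟨j, hj⟩ := Finset.min_of_nonempty ⟨i, hi⟩
  exact π.eq_of_mem_parts hb hd (Finset.mem_of_min hj) (Finset.mem_of_min (h ▸ hj))

theorem prod_catalan_of_ne_empty {π : NCPartition n} {b : Finset (Fin n)} (hb : b ∈ π.parts)
    (hout : π.outside b = ∅) {V : Finset (Fin n)} (hV : V ≠ ∅) :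
    ∏ c ∈ components bᶜ,
        catalan ((π.parts.filter (· ⊆ c)).filter fun d => π.outside d = V).card =
      catalan (π.parts.filter fun d => π.outside d = V).card := by
  have hcomm : ∀ c, (π.parts.filter (· ⊆ c)).filter (fun d => π.outside d = V) =
      (π.parts.filter fun d => π.outside d = V).filter (· ⊆ c) :=
    fun c => Finset.filter_comm _ _ _
  simp only [hcomm]
  refine prod_catalan_filter_subset (components_pairwiseDisjoint _) ?_ ?_ ?_
  · exact fun d hd => π.nonempty_of_mem_parts (Finset.mem_filter.1 hd).1
  · intro d hd
    rw [Finset.mem_filter] at hd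
    refine exists_component_of_ne hb hout hd.1 ?_
    rintro rfl
    exact hV (hd.2.symm.trans hout)
  · intro d hd d' hd' c hc
    rw [Finset.mem_filter] at hd hd'
    obtain ⟨u, hu⟩ := Finset.nonempty_iff_ne_empty.2 hV
    refine subset_component_of_uIcc (π.nonempty_of_mem_parts hd.1) ?_ hc
    have key : ∀ d ∈ π.parts, ∀ d' ∈ π.parts, π.outside d = V → π.outside d' = V →
        ∀ x ∈ d, ∀ x' ∈ d', ∀ w ∈ b, x ≤ w → w ≤ x' → False := by
      intro d hd d' hd' hdV hdV' x hx x' hx' w hw h1 h2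
      have hne : ∀ e ∈ π.parts, π.outside e = V → w ∉ e := by
        intro e he heV hwe
        have := π.eq_of_mem_parts he hb hwe hw
        subst this
        exact hV (heV.symm.trans hout)
      have h1' : x < w := lt_of_le_of_ne h1 (by rintro rfl; exact hne d hd hdV hx)
      have h2' : w < x' := lt_of_le_of_ne h2 (by rintro rfl; exact hne d' hd' hdV' hx')
      obtain ⟨hud, -⟩ := mem_outside.1 (hdV ▸ hu)
      obtain ⟨hud', y, huy, hy⟩ := mem_outside.1 (hdV' ▸ hu)
      have huw : u < w := (hud x hx).trans h1'
      have hwy : w < y := h2'.trans (hy x' hx')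
      by_cases hub : u ∈ b
      · have hwu : π.Same w y := Same.trans ⟨b, hb, hw, hub⟩ huy
        have h5 := mem_outside_of_between hd' hwu hx' (hne d' hd' hdV') h2' (hy x' hx')
        have h6 : w ∈ π.outside d' := mem_outside.2 ⟨h5.1, y, hwu, hy⟩
        rw [hdV', ← hdV, mem_outside] at h6
        exact lt_asymm h1' (h6.1 x hx)
      · have h5 := mem_outside_of_between hb huy hw hub huw hwy
        have h6 : u ∈ π.outside b := mem_outside.2 ⟨h5.1, y, huy, h5.2⟩
        rw [hout] at h6
        exact Finset.notMem_empty _ h6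
    intro x hx x' hx' w hw hwx
    rw [Finset.mem_uIcc'] at hwx
    rcases hwx with h | h
    · exact key d hd.1 d' hd'.1 hd.2 hd'.2 x hx x' hx' w hw h.1 h.2
    · exact key d' hd'.1 d hd.1 hd'.2 hd.2 x' hx' x hx w hw h.1 h.2

theorem prod_catalan_of_empty {π : NCPartition n} {b : Finset (Fin n)} (hb : b ∈ π.parts)
    (hout : π.outside b = ∅) :
    ∏ c ∈ components bᶜ,
        catalan ((π.parts.filter (· ⊆ c)).filter fun d => π.outside d = ∅).card =
      catalan ((π.parts.filter fun d => π.outside d = ∅).filter fun d => d.min < b.min).card *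
      catalan ((π.parts.filter fun d => π.outside d = ∅).filter fun d => b.min < d.min).card := by
  set O := π.parts.filter fun d => π.outside d = ∅ with hO
  have hOmem : ∀ d, d ∈ O ↔ d ∈ π.parts ∧ π.outside d = ∅ := fun d => by rw [hO, Finset.mem_filter]
  have hsplit : ∀ c ∈ components bᶜ,
      catalan ((π.parts.filter (· ⊆ c)).filter fun d => π.outside d = ∅).card =
      catalan ((O.filter fun d => d.min < b.min).filter (· ⊆ c)).card *
      catalan ((O.filter fun d => b.min < d.min).filter (· ⊆ c)).card := by
    intro c hc
    have hbc : ∀ w ∈ b, w ∉ c := fun w hw hwc =>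
      Finset.mem_compl.1 (subset_of_mem_components hc hwc) hw
    have h1 : (π.parts.filter (· ⊆ c)).filter (fun d => π.outside d = ∅) =
        ((O.filter fun d => d.min < b.min).filter (· ⊆ c)) ∪
        ((O.filter fun d => b.min < d.min).filter (· ⊆ c)) := by
      ext d
      simp only [Finset.mem_filter, Finset.mem_union, hOmem]
      constructor
      · rintro ⟨⟨hd, hdc⟩, hdo⟩
        have hne : d.min ≠ b.min := by
          intro h
          have := π.min_injOn hd hb h
          subst this
          obtain ⟨x, hx⟩ := π.nonempty_of_mem_parts hd
          exact hbc x hx (hdc hx)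
        rcases lt_or_gt_of_ne hne with h | h
        · exact Or.inl ⟨⟨⟨hd, hdo⟩, h⟩, hdc⟩
        · exact Or.inr ⟨⟨⟨hd, hdo⟩, h⟩, hdc⟩
      · rintro (⟨⟨⟨hd, hdo⟩, h⟩, hdc⟩ | ⟨⟨⟨hd, hdo⟩, h⟩, hdc⟩) <;> exact ⟨⟨hd, hdc⟩, hdo⟩
    rcases ((O.filter fun d => d.min < b.min).filter (· ⊆ c)).eq_empty_or_nonempty with h | ⟨d, hd⟩
    · rw [h1, h, Finset.empty_union, Finset.card_empty, catalan_zero, one_mul]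
    · have h2 : (O.filter fun d => b.min < d.min).filter (· ⊆ c) = ∅ := by
        rw [Finset.eq_empty_iff_forall_notMem]
        intro d' hd'
        simp only [Finset.mem_filter, hOmem] at hd hd'
        obtain ⟨⟨⟨hd1, hd2⟩, hd3⟩, hd4⟩ := hd
        obtain ⟨⟨⟨he1, he2⟩, he3⟩, he4⟩ := hd'
        obtain ⟨x, hx⟩ := π.nonempty_of_mem_parts hd1
        obtain ⟨x', hx'⟩ := π.nonempty_of_mem_parts he1
        obtain ⟨w, hw⟩ := π.nonempty_of_mem_parts hb
        refine hbc w hw (uIcc_subset_of_mem_components hc (hd4 hx) (he4 hx') ?_)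
        rw [Finset.mem_uIcc']
        exact Or.inl ⟨(lt_of_min_lt hb hout hd1 hd3 x hx w hw).le,
          (lt_of_min_lt he1 he2 hb he3 w hw x' hx').le⟩
      rw [h1, h2, Finset.union_empty, Finset.card_empty, catalan_zero, mul_one]
  rw [Finset.prod_congr rfl hsplit, Finset.prod_mul_distrib]
  congr 1
  · refine prod_catalan_filter_subset (components_pairwiseDisjoint _) ?_ ?_ ?_
    · intro d hd
      rw [Finset.mem_filter, hOmem] at hd
      exact π.nonempty_of_mem_parts hd.1.1
    · intro d hd
      rw [Finset.mem_filter, hOmem] at hd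
      refine exists_component_of_ne hb hout hd.1.1 ?_
      rintro rfl
      exact lt_irrefl _ hd.2
    · intro d hd d' hd' c hc
      rw [Finset.mem_filter, hOmem] at hd hd'
      refine subset_component_of_uIcc (π.nonempty_of_mem_parts hd.1.1) ?_ hc
      intro x hx x' hx' w hw hwx
      have h1 := lt_of_min_lt hb hout hd.1.1 hd.2 x hx w hw
      have h2 := lt_of_min_lt hb hout hd'.1.1 hd'.2 x' hx' w hw
      rw [Finset.mem_uIcc'] at hwx
      rcases hwx with h | h
      · exact absurd h.2 (not_le.2 h2)
      · exact absurd h.2 (not_le.2 h1)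
  · refine prod_catalan_filter_subset (components_pairwiseDisjoint _) ?_ ?_ ?_
    · intro d hd
      rw [Finset.mem_filter, hOmem] at hd
      exact π.nonempty_of_mem_parts hd.1.1
    · intro d hd
      rw [Finset.mem_filter, hOmem] at hd
      refine exists_component_of_ne hb hout hd.1.1 ?_
      rintro rfl
      exact lt_irrefl _ hd.2
    · intro d hd d' hd' c hc
      rw [Finset.mem_filter, hOmem] at hd hd'
      refine subset_component_of_uIcc (π.nonempty_of_mem_parts hd.1.1) ?_ hc
      intro x hx x' hx' w hw hwx
      have h1 := lt_of_min_lt hd.1.1 hd.1.2 hb hd.2 w hw x hx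
      have h2 := lt_of_min_lt hd'.1.1 hd'.1.2 hb hd'.2 w hw x' hx'
      rw [Finset.mem_uIcc'] at hwx
      rcases hwx with h | h
      · exact absurd h.1 (not_le.2 h1)
      · exact absurd h.1 (not_le.2 h2)

/-- The recursion satisfied by `catProd`, by removal of an outer block. -/
theorem catProd_eq_sum (π : NCPartition n) (hn : 0 < n) :
    π.catProd = ∑ b ∈ π.parts.filter (fun b => π.outside b = ∅),
      ∏ c ∈ components bᶜ, (π.restrict c).catProd := by
  set O := π.parts.filter fun d => π.outside d = ∅ with hO
  have hOmem : ∀ d, d ∈ O ↔ d ∈ π.parts ∧ π.outside d = ∅ := fun d => by rw [hO, Finset.mem_filter]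
  have hOne : O.Nonempty := by
    obtain ⟨b, hb, h0⟩ := π.exists_block ⟨0, hn⟩
    refine ⟨b, (hOmem b).2 ⟨hb, ?_⟩⟩
    rw [Finset.eq_empty_iff_forall_notMem]
    intro u hu
    have := Fin.lt_def.1 ((mem_outside.1 hu).1 _ h0)
    simp at this
  have h1 : ∀ b ∈ O, ∏ c ∈ components bᶜ, (π.restrict c).catProd =
      (catalan (O.filter fun d => d.min < b.min).card *
        catalan (O.filter fun d => b.min < d.min).card) *
      ∏ V ∈ {∅}ᶜ, catalan (π.parts.filter fun d => π.outside d = V).card := by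
    intro b hb
    rw [hOmem] at hb
    have h2 : ∀ c ∈ components bᶜ, (π.restrict c).catProd =
        catFibers (π.parts.filter (· ⊆ c)) π.outside := fun c hc =>
      catProd_restrict (mem_of_same_of_mem_components hb.1 hb.2 hc)
        fun x hx y hy => uIcc_subset_of_mem_components hc hx hy
    rw [Finset.prod_congr rfl h2]
    unfold catFibers
    rw [Finset.prod_comm, Fintype.prod_eq_mul_prod_compl ∅, prod_catalan_of_empty hb.1 hb.2]
    congr 1
    refine Finset.prod_congr rfl fun V hV => prod_catalan_of_ne_empty hb.1 hb.2 ?_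
    simpa using hV
  rw [Finset.sum_congr rfl h1, ← Finset.sum_mul, catProd_eq, catFibers,
    Fintype.prod_eq_mul_prod_compl ∅, ← hO]
  congr 1
  have hinj : Set.InjOn (Finset.min : Finset (Fin n) → WithTop (Fin n)) O :=
    π.min_injOn.mono (Finset.filter_subset _ _)
  rw [← Finset.card_image_of_injOn hinj, ← sum_catalan_mul_catalan (hOne.image _),
    Finset.sum_image hinj]
  refine Finset.sum_congr rfl fun b _ => ?_
  rw [Finset.filter_image, Finset.filter_image,
    Finset.card_image_of_injOn (hinj.mono (Finset.filter_subset _ _)),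
    Finset.card_image_of_injOn (hinj.mono (Finset.filter_subset _ _))]

theorem card_parts_eq_sum {π : NCPartition n} {b : Finset (Fin n)} (hb : b ∈ π.parts)
    (hout : π.outside b = ∅) :
    π.parts.card = ∑ c ∈ components bᶜ, (π.restrict c).parts.card + 1 := by
  have h1 : ∀ c ∈ components bᶜ, (π.restrict c).parts.card = (π.parts.filter (· ⊆ c)).card :=
    fun c hc => card_parts_restrict (mem_of_same_of_mem_components hb hout hc)
  rw [Finset.sum_congr rfl h1, ← Finset.card_biUnion, ← Finset.card_erase_add_one hb]
  · congr 2
    ext d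
    rw [Finset.mem_erase, Finset.mem_biUnion]
    constructor
    · rintro ⟨hne, hd⟩
      obtain ⟨c, hc, hdc⟩ := exists_component_of_ne hb hout hd hne
      exact ⟨c, hc, Finset.mem_filter.2 ⟨hd, hdc⟩⟩
    · rintro ⟨c, hc, hd⟩
      rw [Finset.mem_filter] at hd
      refine ⟨?_, hd.1⟩
      rintro rfl
      obtain ⟨x, hx⟩ := π.nonempty_of_mem_parts hb
      exact Finset.mem_compl.1 (subset_of_mem_components hc (hd.2 hx)) hx
  · intro c hc c' hc' hne
    refine Finset.disjoint_left.2 fun d hd hd' => ?_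
    rw [Finset.mem_filter] at hd hd'
    obtain ⟨x, hx⟩ := π.nonempty_of_mem_parts hd.1
    exact Finset.disjoint_left.1 (components_pairwiseDisjoint _ hc hc' hne) (hd.2 hx) (hd'.2 hx)

theorem components_univ (hn : 0 < n) :
    components (Finset.univ : Finset (Fin n)) = {Finset.univ} := by
  ext c
  rw [mem_components, Finset.mem_singleton]
  have h : ∀ i : Fin n, component Finset.univ i = Finset.univ := fun i => by
    ext
    simp [mem_component]
  simp only [h, Finset.mem_univ, true_and, eq_comm]
  exact ⟨fun ⟨_, h⟩ => h, fun h => ⟨⟨0, hn⟩, h⟩⟩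

end NCPartition

namespace NCAlg

open NCPartition

variable {K : Type*} [Field K] [CharZero K] {n : ℕ}

theorem char_neg_one_eq_neg_sum (π : NCPartition n) (hn : 0 < n) :
    char K (-1) (of π) = -∑ b ∈ π.parts.filter (fun b => π.outside b = ∅),
      ∏ c ∈ components bᶜ, char K (-1) (of (π.restrict c)) := by
  classical
  have h1 : conv (deltaCounit K) (char K (-1)) = counit K := by
    have h := conv_scale_left_natCast (K := K) (-1) 1
    rw [Nat.cast_one, neg_add_cancel] at h
    rw [← char_one, ← char_zero, ← deltaCounit_comp_scale, ← deltaCounit_comp_scale,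
      ← deltaCounit_comp_scale, ← comp_conv, h]
  have h2 := AlgHom.congr_fun h1 (of π)
  rw [conv_of _ _ π hn, counit_of π hn] at h2
  have hp : π.parts ∈ π.parts.powerset.filter (fun I => π.IsIdeal I) := by
    rw [Finset.mem_filter]
    refine ⟨Finset.mem_powerset_self _, (isIdeal_iff subset_rfl).2 fun x _ y _ => ?_⟩
    rw [π.biUnion_parts]
    simp [mem_component]
  rw [← Finset.add_sum_erase _ _ hp, π.biUnion_parts, Finset.compl_univ, of_restrict_empty,
    map_one, one_mul, components_univ hn, Finset.prod_singleton, of_restrict_univ] at h2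
  rw [eq_neg_iff_add_eq_zero, ← h2]
  congr 1
  have hinj : Set.InjOn π.parts.erase
      (π.parts.filter fun b => π.outside b = ∅ : Finset (Finset (Fin n))) :=
    (Finset.erase_injOn π.parts).mono (Finset.filter_subset _ _)
  have h3 : ∑ b ∈ π.parts.filter (fun b => π.outside b = ∅),
      ∏ c ∈ components bᶜ, char K (-1) (of (π.restrict c)) =
      ∑ I ∈ (π.parts.filter fun b => π.outside b = ∅).image π.parts.erase,
        deltaCounit K (of (π.restrict (I.biUnion id)ᶜ)) *
          ∏ c ∈ components (I.biUnion id), char K (-1) (of (π.restrict c)) := by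
    rw [Finset.sum_image hinj]
    refine Finset.sum_congr rfl fun b hb => ?_
    have hb' := (Finset.mem_filter.1 hb).1
    rw [biUnion_erase hb', compl_compl, deltaCounit_of_restrict, if_pos, one_mul]
    exact fun x hx y hy => ⟨b, hb', hx, hy⟩
  rw [h3]
  refine Finset.sum_subset ?_ ?_
  · intro I hI
    obtain ⟨b, hb, rfl⟩ := Finset.mem_image.1 hI
    rw [Finset.mem_filter] at hb
    rw [Finset.mem_erase, Finset.mem_filter, Finset.mem_powerset]
    refine ⟨fun h => ?_, Finset.erase_subset _ _, (isIdeal_erase_iff hb.1).2 hb.2⟩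
    have := hb.1
    rw [← h] at this
    exact absurd this (Finset.notMem_erase _ _)
  · intro I hI hI'
    rw [Finset.mem_erase, Finset.mem_filter, Finset.mem_powerset] at hI
    obtain ⟨hne, hsub, hid⟩ := hI
    rw [deltaCounit_of_restrict, if_neg, zero_mul]
    intro hsame
    obtain ⟨b, hb, hbI⟩ := Finset.exists_of_ssubset (hsub.ssubset_of_ne hne)
    have hcompl : ∀ d ∈ π.parts, d ∉ I → ∀ x ∈ d, x ∈ (I.biUnion id)ᶜ := by
      intro d hd hdI x hx
      rw [Finset.mem_compl, Finset.mem_biUnion]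
      rintro ⟨e, he, hxe⟩
      exact hdI (π.eq_of_mem_parts hd (hsub he) hx hxe ▸ he)
    have hIe : π.parts.erase b = I := by
      ext d
      rw [Finset.mem_erase]
      constructor
      · rintro ⟨hdb, hd⟩
        by_contra hdI
        obtain ⟨x, hx⟩ := π.nonempty_of_mem_parts hb
        obtain ⟨y, hy⟩ := π.nonempty_of_mem_parts hd
        have := hsame x (hcompl b hb hbI x hx) y (hcompl d hd hdI y hy)
        exact hdb (π.eq_of_mem_parts hd hb hy ((same_iff_mem hb hx).1 this))
      · exact fun hd => ⟨by rintro rfl; exact hbI hd, hsub hd⟩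
    refine hI' (Finset.mem_image.2 ⟨b, Finset.mem_filter.2 ⟨hb, ?_⟩, hIe⟩)
    rw [← isIdeal_erase_iff hb, hIe]
    exact hid

theorem char_neg_one_of (π : NCPartition n) :
    char K (-1) (of π) = (-1) ^ π.parts.card * (π.catProd : K) := by
  induction n using Nat.strong_induction_on with
  | _ n ih =>
    rcases n.eq_zero_or_pos with rfl | hn
    · have h : π.parts = ∅ := by
        rw [← Finset.card_eq_zero]
        simp
      rw [of_eq_one, map_one, NCPartition.catProd, NCPartition.classes, h]
      simp
    · rw [char_neg_one_eq_neg_sum π hn, NCPartition.catProd_eq_sum π hn, Nat.cast_sum,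
        Finset.mul_sum, ← Finset.sum_neg_distrib]
      refine Finset.sum_congr rfl fun b hb => ?_
      rw [Finset.mem_filter] at hb
      have h1 : ∀ c ∈ components bᶜ, char K (-1) (of (π.restrict c)) =
          (-1) ^ (π.restrict c).parts.card * ((π.restrict c).catProd : K) := by
        intro c hc
        refine ih _ ?_ _
        have h2 := Finset.card_le_card (subset_of_mem_components hc)
        have h3 := (π.nonempty_of_mem_parts hb.1).card_pos
        rw [Finset.card_compl, Fintype.card_fin] at h2
        omega
      rw [Finset.prod_congr rfl h1, Finset.prod_mul_distrib, Finset.prod_pow_eq_pow_sum,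
        card_parts_eq_sum hb.1 hb.2, pow_succ, Nat.cast_prod]
      ring

end NCAlg

namespace NCPartition

variable {n : ℕ}

theorem card_pos_of_mem_parts {π : NCPartition n} {b : Finset (Fin n)} (hb : b ∈ π.parts) :
    0 < b.card := (π.nonempty_of_mem_parts hb).card_pos

theorem card_le_of_mem_parts {π : NCPartition n} {b : Finset (Fin n)} (_ : b ∈ π.parts) :
    b.card ≤ n := b.card_le_univ.trans_eq (Fintype.card_fin n)

@[to_additive]
theorem prod_parts_card {M : Type*} [CommMonoid M] (π : NCPartition n) (y : ℕ → M) :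
    ∏ b ∈ π.parts, y b.card = ∏ i : Fin n, y ((i : ℕ) + 1) ^ π.blockType i := by
  rw [← Finset.prod_fiberwise_of_maps_to (g := Finset.card)
    (t := Finset.univ.image fun i : Fin n => (i : ℕ) + 1), Finset.prod_image]
  · refine Finset.prod_congr rfl fun i _ => ?_
    exact Finset.prod_eq_pow_card fun b hb => congrArg y (Finset.mem_filter.1 hb).2
  · intro i _ j _ h
    exact Fin.ext (Nat.succ_injective h)
  · intro b hb
    have h1 := card_pos_of_mem_parts hb
    have h2 := card_le_of_mem_parts hb
    exact Finset.mem_image.2 ⟨⟨b.card - 1, by omega⟩, Finset.mem_univ _, by simp; omega⟩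

theorem card_parts_eq_sum_blockType (π : NCPartition n) :
    π.parts.card = ∑ i, π.blockType i := by
  have := π.sum_parts_card (fun _ => 1)
  simpa using this

theorem blockType_mem_intPartitions (π : NCPartition n) : π.blockType ∈ intPartitions n := by
  rw [mem_intPartitions]
  have h := π.sum_parts_card id
  have h2 := π.toFinpartition.sum_card_parts
  simp only [id, smul_eq_mul] at h
  rw [h, Finset.card_univ, Fintype.card_fin] at h2
  exact (Finset.sum_congr rfl fun _ _ => mul_comm _ _).trans h2

theorem typeCoeff_eq_sum (k : Fin n → ℕ) :
    typeCoeff n k = ∑ π ∈ (Finset.univ : Finset (NCPartition n)).filter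
      (fun π => π.blockType = k), (-1) ^ π.parts.card * (π.catProd : ℤ) := by
  rw [typeCoeff, Finset.mul_sum]
  refine Finset.sum_congr rfl fun π hπ => ?_
  rw [card_parts_eq_sum_blockType, (Finset.mem_filter.1 hπ).2]

theorem sum_typeCoeff_smul {K A : Type*} [Field K] [CommRing A] [Algebra K A] (y : ℕ → A) :
    ∑ k ∈ intPartitions n, (typeCoeff n k : K) • ∏ i : Fin n, y ((i : ℕ) + 1) ^ k i =
      ∑ π : NCPartition n, ((-1) ^ π.parts.card * (π.catProd : K)) • ∏ b ∈ π.parts, y b.card := by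
  rw [← Finset.sum_fiberwise_of_maps_to (g := blockType) (t := intPartitions n)
    fun π _ => π.blockType_mem_intPartitions]
  refine Finset.sum_congr rfl fun k _ => ?_
  rw [typeCoeff_eq_sum, Int.cast_sum, Finset.sum_smul]
  refine Finset.sum_congr rfl fun π hπ => ?_
  rw [prod_parts_card, (Finset.mem_filter.1 hπ).2]
  push_cast
  rfl

theorem catProd_eq_catalan {π : NCPartition n} (h : ∀ b ∈ π.parts, π.outside b = ∅) :
    π.catProd = catalan π.parts.card := by
  rw [catProd_eq, catFibers, Finset.prod_eq_single ∅]
  · rw [Finset.filter_true_of_mem h]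
  · intro V _ hV
    rw [Finset.filter_false_of_mem, Finset.card_empty, catalan_zero]
    intro b hb hbV
    exact hV (hbV.symm.trans (h b hb))
  · simp

theorem card_parts_J : (J n).parts.card = n := by
  have := Finpartition.card_bot (Finset.univ : Finset (Fin n))
  rwa [Finset.card_univ, Fintype.card_fin] at this

theorem catProd_J : (J n).catProd = catalan n := by
  rw [catProd_eq_catalan, card_parts_J]
  intro b hb
  rw [Finset.eq_empty_iff_forall_notMem]
  intro u hu
  obtain ⟨h1, y, hy, h2⟩ := mem_outside.1 hu
  obtain ⟨x, hx⟩ := (J n).nonempty_of_mem_parts hb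
  rw [same_J] at hy
  subst hy
  exact lt_asymm (h1 x hx) (h2 x hx)

theorem card_eq_one_of_mem_parts_J {b : Finset (Fin n)} (hb : b ∈ (J n).parts) : b.card = 1 := by
  obtain ⟨a, -, rfl⟩ := Finpartition.mem_bot_iff.1 hb
  simp

theorem eq_J_of_forall_card {π : NCPartition n} (h : ∀ b ∈ π.parts, b.card = 1) : π = J n := by
  refine ext_same fun x y => ?_
  rw [same_J]
  constructor
  · rintro ⟨b, hb, hx, hy⟩
    exact Finset.card_le_one.1 (h b hb).le x hx y hy
  · rintro rfl
    exact Same.refl _ _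

theorem blockType_eq_iff_eq_J {π : NCPartition n} :
    π.blockType = (fun i : Fin n => if (i : ℕ) = 0 then n else 0) ↔ π = J n := by
  constructor
  · intro h
    refine eq_J_of_forall_card fun b hb => ?_
    have h1 := card_pos_of_mem_parts hb
    have h2 := card_le_of_mem_parts hb
    have h3 := congrFun h ⟨b.card - 1, by omega⟩
    by_contra hne
    rw [if_neg (by simp; omega), blockType, Finset.card_eq_zero,
      Finset.filter_eq_empty_iff] at h3
    exact h3 hb (by simp; omega)
  · rintro rfl
    ext i
    rw [blockType]
    split_ifs with hi
    · rw [Finset.filter_true_of_mem, card_parts_J]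
      intro b hb
      rw [card_eq_one_of_mem_parts_J hb, hi]
    · rw [Finset.filter_false_of_mem, Finset.card_empty]
      intro b hb
      rw [card_eq_one_of_mem_parts_J hb]
      omega

theorem typeCoeff_J : typeCoeff n (fun i : Fin n => if (i : ℕ) = 0 then n else 0) =
    (-1) ^ n * (catalan n : ℤ) := by
  rw [typeCoeff_eq_sum]
  have : (Finset.univ : Finset (NCPartition n)).filter
      (fun π => π.blockType = fun i : Fin n => if (i : ℕ) = 0 then n else 0) = {J n} := by
    ext π
    rw [Finset.mem_filter, Finset.mem_singleton, blockType_eq_iff_eq_J]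
    simp
  rw [this, Finset.sum_singleton, card_parts_J, catProd_J]

theorem typeCoeff_single (hn : 0 < n) :
    typeCoeff n (fun i : Fin n => if (i : ℕ) + 1 = n then 1 else 0) = -1 := by
  rw [typeCoeff_eq_sum]
  have hall : ∀ π : NCPartition n, (π.blockType = fun i : Fin n => if (i : ℕ) + 1 = n then 1 else 0) ↔
      ∀ x y, π.Same x y := by
    intro π
    rw [← card_parts_eq_one_iff π hn]
    constructor
    · intro h
      rw [card_parts_eq_sum_blockType, h, Finset.sum_eq_single ⟨n - 1, by omega⟩]
      · rw [if_pos]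
        simp
        omega
      · intro i _ hi
        rw [if_neg]
        intro h'
        exact hi (Fin.ext (by simp; omega))
      · simp
    · intro h
      obtain ⟨b, hb⟩ := Finset.card_eq_one.1 h
      have h1 := π.biUnion_parts
      rw [hb, Finset.singleton_biUnion, id] at h1
      subst h1
      ext i
      rw [blockType, hb, Finset.filter_singleton, Finset.card_univ, Fintype.card_fin]
      by_cases hi : (i : ℕ) + 1 = n
      · rw [if_pos hi.symm, if_pos hi, Finset.card_singleton]
      · rw [if_neg (Ne.symm hi), if_neg hi, Finset.card_empty]
  have hsame : ∀ x y, (ofFun (fun _ : Fin n => 0)).Same x y := fun x y => by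
    rw [same_ofFun, mem_level]
    simp
  have : (Finset.univ : Finset (NCPartition n)).filter
      (fun π => π.blockType = fun i : Fin n => if (i : ℕ) + 1 = n then 1 else 0) =
      {ofFun fun _ : Fin n => 0} := by
    ext π
    rw [Finset.mem_filter, Finset.mem_singleton, hall]
    constructor
    · rintro ⟨-, h⟩
      exact ext_same fun x y => ⟨fun _ => hsame x y, fun _ => h x y⟩
    · rintro rfl
      exact ⟨Finset.mem_univ _, hsame⟩
  rw [this, Finset.sum_singleton, catProd_eq_catalan,
    (card_parts_eq_one_iff _ hn).2 hsame, catalan_one]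
  · norm_num
  · intro b hb
    rw [Finset.eq_empty_iff_forall_notMem]
    intro u hu
    obtain ⟨x, hx⟩ := (ofFun fun _ : Fin n => 0).nonempty_of_mem_parts hb
    have hub := (same_iff_mem hb hx).1 (hsame x u)
    exact lt_irrefl _ ((mem_outside.1 hu).1 u hub)

end NCPartition

namespace NCAlg

variable {K : Type*} [Field K] {n : ℕ}

theorem scale_J (t : K) (hn : 0 < n) :
    scale K t (J K n) = ∑ π : NCPartition n, char K t (of π) • ∏ b ∈ π.parts, J K b.card := by
  classical
  rw [J, scale_of t _ hn, Finset.filter_true_of_mem]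
  · simp only [of_restrict_J]
  · intro σ _
    rw [NCPartition.le_iff_same]
    intro x y h
    rw [NCPartition.same_J] at h
    rw [h]
    exact NCPartition.Same.refl _ _

theorem J_eq_X (n : ℕ+) :
    J K n = MvPolynomial.X (⟨n, NCPartition.J n⟩ : Σ n : ℕ+, NCPartition n) :=
  of_pos _ n.pos

open Classical in
theorem coeff_prod_J (π : NCPartition n) :
    MvPolynomial.coeff
      (Finsupp.single (⟨1, NCPartition.J 1⟩ : Σ m : ℕ+, NCPartition m) n)
      (∏ b ∈ π.parts, J K b.card) = if π = NCPartition.J n then 1 else 0 := by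
  split_ifs with h
  · subst h
    have h1 : ∀ b ∈ (NCPartition.J n).parts, J K b.card =
        MvPolynomial.X (⟨1, NCPartition.J 1⟩ : Σ m : ℕ+, NCPartition m) := by
      intro b hb
      rw [NCPartition.card_eq_one_of_mem_parts_J hb]
      exact J_eq_X 1
    rw [Finset.prod_congr rfl h1, Finset.prod_const, NCPartition.card_parts_J,
      MvPolynomial.coeff_X_pow, if_pos rfl]
  · obtain ⟨b, hb, hb1⟩ : ∃ b ∈ π.parts, b.card ≠ 1 := by
      by_contra! hc
      exact h (NCPartition.eq_J_of_forall_card hc)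
    have hpos := NCPartition.card_pos_of_mem_parts hb
    have hX : (J K b.card : NCAlg K) = MvPolynomial.X
        (⟨⟨b.card, hpos⟩, NCPartition.J b.card⟩ : Σ m : ℕ+, NCPartition m) := of_pos _ hpos
    rw [← Finset.mul_prod_erase _ _ hb, hX, mul_comm, MvPolynomial.coeff_mul_X', if_neg]
    rw [Finsupp.mem_support_iff, not_not, Finsupp.single_eq_of_ne]
    intro h'
    have := congrArg (fun p : Σ m : ℕ+, NCPartition m => (p.1 : ℕ)) h'
    simp at this
    exact hb1 this

variable [CharZero K]

theorem scale_neg_one_J (hn : 0 < n) :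
    scale K (-1) (J K n) = ∑ k ∈ intPartitions n,
      (typeCoeff n k : K) • ∏ i : Fin n, J K ((i : ℕ) + 1) ^ k i := by
  rw [NCPartition.sum_typeCoeff_smul, scale_J _ hn]
  exact Finset.sum_congr rfl fun π _ => by rw [char_neg_one_of]

theorem coeff_scale_neg_one_J (hn : 0 < n) :
    MvPolynomial.coeff
      (Finsupp.single (⟨1, NCPartition.J 1⟩ : Σ m : ℕ+, NCPartition m) n)
      (scale K (-1) (J K n)) = (-1) ^ n * (catalan n : K) := by
  rw [scale_J _ hn, MvPolynomial.coeff_sum, Finset.sum_eq_single (NCPartition.J n)]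
  · rw [MvPolynomial.coeff_smul, coeff_prod_J, if_pos rfl, char_neg_one_of,
      NCPartition.card_parts_J, NCPartition.catProd_J, smul_eq_mul, mul_one]
  · intro π _ h
    rw [MvPolynomial.coeff_smul, coeff_prod_J, if_neg h, smul_zero]
  · simp

end NCAlg

namespace NCPartition

variable {n : ℕ}

/-- The elements of `[n]` which are at least `a`, in the numbering starting from `0`. -/
def tailSet (n a : ℕ) : Finset (Fin n) := Finset.univ.filter fun x => a ≤ (x : ℕ)

theorem mem_tailSet {a : ℕ} {x : Fin n} : x ∈ tailSet n a ↔ a ≤ (x : ℕ) := by simp [tailSet]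

/-- The interval of all `x` with `a ≤ x < j`. -/
def segment (n a j : ℕ) : Finset (Fin n) :=
  Finset.univ.filter fun x => a ≤ (x : ℕ) ∧ (x : ℕ) < j

theorem mem_segment {a j : ℕ} {x : Fin n} : x ∈ segment n a j ↔ a ≤ (x : ℕ) ∧ (x : ℕ) < j := by
  simp [segment]

theorem card_segment {a j : ℕ} (hj : j ≤ n) : (segment n a j).card = j - a := by
  have h : (segment n a j).map Fin.valEmbedding = Finset.Ico a j := by
    ext x
    simp only [Finset.mem_map, mem_segment, Fin.valEmbedding_apply, Finset.mem_Ico]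
    constructor
    · rintro ⟨y, hy, rfl⟩
      exact hy
    · exact fun hx => ⟨⟨x, by omega⟩, hx, rfl⟩
  rw [← Finset.card_map Fin.valEmbedding, h, Nat.card_Ico]

theorem tailSet_eq_segment (a : ℕ) : tailSet n a = segment n a n := by
  ext x
  rw [mem_tailSet, mem_segment]
  exact ⟨fun h => ⟨h, x.isLt⟩, fun h => h.1⟩

theorem components_segment {a j : ℕ} (h : (segment n a j).Nonempty) :
    components (segment n a j) = {segment n a j} := by
  have hi : ∀ x ∈ segment n a j, component (segment n a j) x = segment n a j := by
    intro x hx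
    ext y
    rw [mem_component]
    refine ⟨fun h => h.1, fun hy => ⟨hy, fun w hw => ?_⟩⟩
    rw [mem_segment] at hx hy ⊢
    rw [Finset.mem_uIcc', Fin.le_def, Fin.le_def, Fin.le_def, Fin.le_def] at hw
    omega
  obtain ⟨x, hx⟩ := h
  ext c
  rw [mem_components, Finset.mem_singleton]
  exact ⟨fun ⟨y, hy, h⟩ => h ▸ hi y hy, fun h => ⟨x, hx, h ▸ hi x hx⟩⟩

variable {R : Type*} [CommRing R]

theorem prod_components_segment (z : ℕ → R) (hz : z 0 = 1) {a j : ℕ} (hj : j ≤ n) :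
    ∏ c ∈ components (segment n a j), z c.card = z (j - a) := by
  rcases (segment n a j).eq_empty_or_nonempty with h | h
  · rw [← card_segment (a := a) hj, h]
    simp [components, hz]
  · rw [components_segment h, Finset.prod_singleton, card_segment hj]

theorem component_union_of_separated {s t : Finset (Fin n)} {j : ℕ}
    (hs : ∀ x ∈ s, (x : ℕ) < j) (ht : ∀ x ∈ t, j < (x : ℕ)) {x : Fin n} (hx : x ∈ s) :
    component (s ∪ t) x = component s x := by
  ext y
  rw [mem_component, mem_component]
  refine ⟨fun h => ?_, fun h => ⟨Finset.mem_union_left _ h.1,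
    h.2.trans Finset.subset_union_left⟩⟩
  have hsub : Finset.uIcc x y ⊆ s := by
    intro w hw
    rcases Finset.mem_union.1 (h.2 hw) with h1 | h1
    · exact h1
    · exfalso
      have hxj := hs x hx
      have hwj := ht w h1
      have hw' := hw
      rw [Finset.mem_uIcc', Fin.le_def, Fin.le_def, Fin.le_def, Fin.le_def] at hw'
      have hjn : j < n := by have := w.isLt; omega
      have hj : (⟨j, hjn⟩ : Fin n) ∈ s ∪ t := by
        refine h.2 ?_
        rw [Finset.mem_uIcc', Fin.le_def, Fin.le_def, Fin.le_def, Fin.le_def]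
        dsimp only
        omega
      rcases Finset.mem_union.1 hj with h2 | h2
      · exact lt_irrefl j (hs _ h2)
      · exact lt_irrefl j (ht _ h2)
  exact ⟨hsub Finset.right_mem_uIcc, hsub⟩

theorem component_union_of_separated' {s t : Finset (Fin n)} {j : ℕ}
    (hs : ∀ x ∈ s, (x : ℕ) < j) (ht : ∀ x ∈ t, j < (x : ℕ)) {x : Fin n} (hx : x ∈ t) :
    component (s ∪ t) x = component t x := by
  ext y
  rw [mem_component, mem_component]
  refine ⟨fun h => ?_, fun h => ⟨Finset.mem_union_right _ h.1,
    h.2.trans Finset.subset_union_right⟩⟩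
  have hsub : Finset.uIcc x y ⊆ t := by
    intro w hw
    rcases Finset.mem_union.1 (h.2 hw) with h1 | h1
    · exfalso
      have hxj := ht x hx
      have hwj := hs w h1
      have hw' := hw
      rw [Finset.mem_uIcc', Fin.le_def, Fin.le_def, Fin.le_def, Fin.le_def] at hw'
      have hjn : j < n := by have := x.isLt; omega
      have hj : (⟨j, hjn⟩ : Fin n) ∈ s ∪ t := by
        refine h.2 ?_
        rw [Finset.mem_uIcc', Fin.le_def, Fin.le_def, Fin.le_def, Fin.le_def]
        dsimp only
        omega
      rcases Finset.mem_union.1 hj with h2 | h2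
      · exact lt_irrefl j (hs _ h2)
      · exact lt_irrefl j (ht _ h2)
    · exact h1
  exact ⟨hsub Finset.right_mem_uIcc, hsub⟩

theorem prod_components_union (z : ℕ → R) {s t : Finset (Fin n)} {j : ℕ}
    (hs : ∀ x ∈ s, (x : ℕ) < j) (ht : ∀ x ∈ t, j < (x : ℕ)) :
    ∏ c ∈ components (s ∪ t), z c.card =
      (∏ c ∈ components s, z c.card) * ∏ c ∈ components t, z c.card := by
  have h : components (s ∪ t) = components s ∪ components t := by
    unfold components
    rw [Finset.image_union]
    congr 1
    · exact Finset.image_congr fun x hx => component_union_of_separated hs ht hx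
    · exact Finset.image_congr fun x hx => component_union_of_separated' hs ht hx
  rw [h, Finset.prod_union]
  refine Finset.disjoint_left.2 fun c hc hc' => ?_
  obtain ⟨x, hx⟩ := components_nonempty hc
  have h1 := hs x (subset_of_mem_components hc hx)
  have h2 := ht x (subset_of_mem_components hc' hx)
  omega

/-- The subsets of `tailSet n a` with `m` missing elements. -/
def tailSubsets (n a m : ℕ) : Finset (Finset (Fin n)) :=
  (tailSet n a).powerset.filter fun T => (tailSet n a \ T).card = m

theorem mem_tailSubsets {a m : ℕ} {T : Finset (Fin n)} :
    T ∈ tailSubsets n a m ↔ (∀ x ∈ T, a ≤ (x : ℕ)) ∧ (tailSet n a \ T).card = m := by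
  rw [tailSubsets, Finset.mem_filter, Finset.mem_powerset]
  refine and_congr_left fun _ => ⟨fun h x hx => mem_tailSet.1 (h hx),
    fun h x hx => mem_tailSet.2 (h x hx)⟩

theorem tailSet_sdiff_union {a : ℕ} {j : Fin n} (hj : a ≤ (j : ℕ)) {T : Finset (Fin n)}
    (hT : ∀ x ∈ T, (j : ℕ) + 1 ≤ x) :
    tailSet n a \ (segment n a j ∪ T) = insert j (tailSet n (j + 1) \ T) := by
  ext x
  simp only [Finset.mem_sdiff, Finset.mem_union, Finset.mem_insert, mem_tailSet, mem_segment,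
    not_or, not_and, not_lt, Fin.ext_iff]
  constructor
  · rintro ⟨h1, h2, h3⟩
    have := h2 h1
    by_cases hx : (x : ℕ) = j
    · exact Or.inl hx
    · exact Or.inr ⟨by omega, h3⟩
  · rintro (h | ⟨h1, h2⟩)
    · refine ⟨by omega, fun _ => by omega, fun hx => ?_⟩
      have := hT x hx
      omega
    · exact ⟨by omega, fun _ => by omega, h2⟩

theorem tailSubsets_succ (a m : ℕ) :
    tailSubsets n a (m + 1) = (tailSet n a).biUnion fun j =>
      (tailSubsets n (j + 1) m).image fun T => segment n a j ∪ T := by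
  ext T
  simp only [Finset.mem_biUnion, Finset.mem_image]
  constructor
  · intro hT
    rw [mem_tailSubsets] at hT
    have hne : (tailSet n a \ T).Nonempty := by
      rw [← Finset.card_pos]
      omega
    obtain ⟨hj1, hj2⟩ := Finset.mem_sdiff.1 (Finset.min'_mem _ hne)
    set j := (tailSet n a \ T).min' hne with hj
    have hmin : ∀ x : Fin n, a ≤ (x : ℕ) → (x : ℕ) < j → x ∈ T := by
      intro x hx hxj
      by_contra hxT
      have h1 := Finset.min'_le _ x (Finset.mem_sdiff.2 ⟨mem_tailSet.2 hx, hxT⟩)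
      rw [← hj, Fin.le_def] at h1
      omega
    have hTj : ∀ x ∈ T.filter (fun x => j < x), (j : ℕ) + 1 ≤ x := fun x hx => by
      have := Fin.lt_def.1 (Finset.mem_filter.1 hx).2
      omega
    have hU : segment n a j ∪ T.filter (fun x => j < x) = T := by
      ext x
      rw [Finset.mem_union, mem_segment, Finset.mem_filter, Fin.lt_def]
      constructor
      · rintro (h | h)
        · exact hmin x h.1 h.2
        · exact h.1
      · intro hx
        have h1 := hT.1 x hx
        have h2 : (x : ℕ) ≠ j := fun h => hj2 (Fin.ext h ▸ hx)
        by_cases h3 : (x : ℕ) < j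
        · exact Or.inl ⟨h1, h3⟩
        · exact Or.inr ⟨hx, by omega⟩
    refine ⟨j, hj1, T.filter (fun x => j < x), ?_, hU⟩
    rw [mem_tailSubsets]
    refine ⟨hTj, ?_⟩
    have h1 := hT.2
    rw [← hU, tailSet_sdiff_union (mem_tailSet.1 hj1) hTj, Finset.card_insert_of_notMem] at h1
    · omega
    · simp [mem_tailSet]
  · rintro ⟨j, hj, T, hT, rfl⟩
    rw [mem_tailSet] at hj
    rw [mem_tailSubsets] at hT ⊢
    constructor
    · intro x hx
      rcases Finset.mem_union.1 hx with h | h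
      · exact (mem_segment.1 h).1
      · have := hT.1 x h
        omega
    · rw [tailSet_sdiff_union hj hT.1, Finset.card_insert_of_notMem, hT.2]
      simp [mem_tailSet]

theorem sum_tailSubsets_succ (z : ℕ → R) (hz : z 0 = 1) (a m : ℕ) :
    ∑ T ∈ tailSubsets n a (m + 1), ∏ c ∈ components T, z c.card =
      ∑ j ∈ tailSet n a, z ((j : ℕ) - a) *
        ∑ T ∈ tailSubsets n (j + 1) m, ∏ c ∈ components T, z c.card := by
  rw [tailSubsets_succ, Finset.sum_biUnion]
  · refine Finset.sum_congr rfl fun j hj => ?_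
    rw [Finset.sum_image, Finset.mul_sum]
    · refine Finset.sum_congr rfl fun T hT => ?_
      rw [mem_tailSubsets] at hT
      rw [prod_components_union z (j := j) (fun x hx => (mem_segment.1 hx).2)
        (fun x hx => hT.1 x hx), prod_components_segment z hz j.isLt.le]
    · intro T hT T' hT' h
      have hdisj : ∀ T ∈ tailSubsets n (j + 1) m,
          (segment n a j ∪ T).filter (fun x => j < x) = T := by
        intro T hT
        rw [mem_tailSubsets] at hT
        ext x
        rw [Finset.mem_filter, Finset.mem_union, mem_segment, Fin.lt_def]
        constructor
        · rintro ⟨h | h, h'⟩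
          · omega
          · exact h
        · intro h
          have := hT.1 x h
          exact ⟨Or.inr h, by omega⟩
      dsimp only at h
      rw [← hdisj T hT, ← hdisj T' hT', h]
  · have key : ∀ i j : Fin n, i ∈ tailSet n a → i < j → ∀ T ∈ tailSubsets n (i + 1) m, ∀ T',
        segment n a i ∪ T ≠ segment n a j ∪ T' := by
      intro i j hi hij T hT T' h
      rw [mem_tailSubsets] at hT
      have h1 : i ∈ segment n a j ∪ T' :=
        Finset.mem_union_left _ (mem_segment.2 ⟨mem_tailSet.1 hi, Fin.lt_def.1 hij⟩)
      rw [← h, Finset.mem_union, mem_segment] at h1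
      rcases h1 with h1 | h1
      · omega
      · have := hT.1 i h1
        omega
    intro i hi j hj hne
    refine Finset.disjoint_left.2 fun S hS hS' => ?_
    obtain ⟨T, hT, rfl⟩ := Finset.mem_image.1 hS
    obtain ⟨T', hT', h⟩ := Finset.mem_image.1 hS'
    rcases lt_or_gt_of_ne hne with hij | hij
    · exact key i j hi hij T hT T' h.symm
    · exact key j i hj hij T' hT' T h

theorem sum_tailSubsets_eq_coeff {G : PowerSeries R} (hG : PowerSeries.coeff 0 G = 0)
    (hG1 : PowerSeries.coeff 1 G = 1) (m : ℕ) :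
    ∀ a ≤ n, ∑ T ∈ tailSubsets n a m, ∏ c ∈ components T, PowerSeries.coeff (c.card + 1) G =
      PowerSeries.coeff (n - a + 1) (G ^ (m + 1)) := by
  induction m with
  | zero =>
    intro a ha
    have h : tailSubsets n a 0 = {tailSet n a} := by
      ext T
      rw [tailSubsets, Finset.mem_filter, Finset.mem_powerset, Finset.mem_singleton,
        Finset.card_eq_zero, Finset.sdiff_eq_empty_iff_subset]
      exact ⟨fun h => h.1.antisymm h.2, fun h => h ▸ ⟨subset_rfl, subset_rfl⟩⟩
    rw [h, Finset.sum_singleton, tailSet_eq_segment, zero_add, pow_one,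
      prod_components_segment (fun i => PowerSeries.coeff (i + 1) G) hG1 le_rfl]
  | succ m ih =>
    intro a ha
    have h1 : ∀ j ∈ tailSet n a, PowerSeries.coeff ((j : ℕ) - a + 1) G *
        ∑ T ∈ tailSubsets n (j + 1) m, ∏ c ∈ components T, PowerSeries.coeff (c.card + 1) G =
        PowerSeries.coeff ((j : ℕ) - a + 1) G *
          PowerSeries.coeff (n - (j + 1) + 1) (G ^ (m + 1)) := fun j _ => by
      rw [ih (j + 1) j.isLt]
    rw [sum_tailSubsets_succ (fun i => PowerSeries.coeff (i + 1) G) hG1,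
      Finset.sum_congr rfl h1, pow_succ' G (m + 1), PowerSeries.coeff_mul,
      Finset.Nat.sum_antidiagonal_eq_sum_range_succ (fun i j => PowerSeries.coeff i G *
        PowerSeries.coeff j (G ^ (m + 1))), Finset.sum_range_succ', hG, zero_mul, add_zero,
      Finset.sum_range_succ]
    have h0 : PowerSeries.coeff 0 (G ^ (m + 1)) = 0 := by
      rw [PowerSeries.coeff_zero_eq_constantCoeff_apply] at hG ⊢
      rw [map_pow, hG, zero_pow (Nat.succ_ne_zero m)]
    rw [Nat.add_sub_add_right, Nat.sub_self, h0, mul_zero, add_zero]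
    refine Finset.sum_bij (fun j _ => (j : ℕ) - a) ?_ ?_ ?_ ?_
    · intro j hj
      rw [mem_tailSet] at hj
      have := j.isLt
      exact Finset.mem_range.2 (by omega)
    · intro i hi j hj h
      rw [mem_tailSet] at hi hj
      exact Fin.ext (by omega)
    · intro i hi
      rw [Finset.mem_range] at hi
      exact ⟨⟨a + i, by omega⟩, mem_tailSet.2 (by simp), by simp⟩
    · intro j hj
      rw [mem_tailSet] at hj
      have := j.isLt
      congr 3
      omega

end NCPartition

section Series

variable {R : Type*} [CommRing R]

theorem coeff_subst_eq_sum {G : PowerSeries R} (hG : PowerSeries.coeff 0 G = 0)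
    (F : PowerSeries R) (e : ℕ) :
    PowerSeries.coeff e (PowerSeries.subst G F) =
      ∑ d ∈ Finset.range (e + 1), PowerSeries.coeff d F * PowerSeries.coeff e (G ^ d) := by
  rw [PowerSeries.coeff_zero_eq_constantCoeff_apply] at hG
  rw [PowerSeries.coeff_subst' (PowerSeries.HasSubst.of_constantCoeff_zero' hG)]
  simp only [smul_eq_mul]
  refine finsum_eq_sum_of_support_subset _ fun d hd => ?_
  rw [Finset.coe_range, Set.mem_Iio]
  by_contra hde
  refine hd ?_
  have h1 : PowerSeries.X ^ d ∣ G ^ d := pow_dvd_pow_of_dvd (PowerSeries.X_dvd_iff.2 hG) d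
  dsimp only
  rw [PowerSeries.X_pow_dvd_iff.1 h1 e (by omega), mul_zero]

theorem coeff_zero_fdbSeries (a : ℕ+ → R) : PowerSeries.coeff 0 (fdbSeries a) = 0 := by
  rw [fdbSeries, PowerSeries.coeff_mk]

theorem coeff_one_fdbSeries (a : ℕ+ → R) : PowerSeries.coeff 1 (fdbSeries a) = 1 := by
  rw [fdbSeries, PowerSeries.coeff_mk]

theorem coeff_succ_fdbSeries (y : ℕ → R) (h : y 0 = 1) (m : ℕ) :
    PowerSeries.coeff (m + 1) (fdbSeries fun k : ℕ+ => y k) = y m := by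
  rcases m with _ | m
  · rw [zero_add, coeff_one_fdbSeries, h]
  · rw [fdbSeries, PowerSeries.coeff_mk]
    rfl

theorem map_fdbSeries {S : Type*} [CommRing S] (g : R →+* S) (a : ℕ+ → R) :
    PowerSeries.map g (fdbSeries a) = fdbSeries fun k => g (a k) := by
  ext m
  rw [PowerSeries.coeff_map, fdbSeries, fdbSeries, PowerSeries.coeff_mk, PowerSeries.coeff_mk]
  rcases m with _ | _ | m
  · simp
  · simp
  · rfl

theorem map_coeff_subst_fdbSeries {S : Type*} [CommRing S] (g : R →+* S) (a b : ℕ+ → R) (e : ℕ) :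
    g (PowerSeries.coeff e (PowerSeries.subst (fdbSeries b) (fdbSeries a))) =
      PowerSeries.coeff e (PowerSeries.subst (fdbSeries fun k => g (b k))
        (fdbSeries fun k => g (a k))) := by
  rw [coeff_subst_eq_sum (coeff_zero_fdbSeries _), coeff_subst_eq_sum (coeff_zero_fdbSeries _),
    map_sum, ← map_fdbSeries, ← map_fdbSeries]
  refine Finset.sum_congr rfl fun d _ => ?_
  rw [map_mul, ← map_pow, PowerSeries.coeff_map, PowerSeries.coeff_map]

theorem subst_fdbSeries_eq_X {a b : ℕ+ → R}
    (h : ∀ n : ℕ+, PowerSeries.coeff ((n : ℕ) + 1)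
      (PowerSeries.subst (fdbSeries b) (fdbSeries a)) = 0) :
    PowerSeries.subst (fdbSeries b) (fdbSeries a) = PowerSeries.X := by
  ext e
  rw [PowerSeries.coeff_X]
  rcases e with _ | _ | e
  · rw [coeff_subst_eq_sum (coeff_zero_fdbSeries _), zero_add, Finset.sum_range_one,
      coeff_zero_fdbSeries, zero_mul, if_neg zero_ne_one]
  · rw [coeff_subst_eq_sum (coeff_zero_fdbSeries _), zero_add, Finset.sum_range_succ,
      Finset.sum_range_one, coeff_zero_fdbSeries, zero_mul, zero_add, pow_one,
      coeff_one_fdbSeries, coeff_one_fdbSeries, mul_one, if_pos rfl]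
  · rw [if_neg (by omega)]
    exact h e.succPNat

end Series

namespace FdB

variable (K : Type*) [Field K]

/-- The generator `x_m`, with `x_0 = 1`. -/
def gen (m : ℕ) : FdB K := if h : 0 < m then MvPolynomial.X ⟨m, h⟩ else 1

theorem gen_zero : gen K 0 = 1 := by simp [gen]

variable {K}

theorem gen_coe (n : ℕ+) : gen K n = MvPolynomial.X n := by
  rw [gen, dif_pos n.pos]
  rfl

theorem toNCAlg_gen (m : ℕ) : toNCAlg K (gen K m) = NCAlg.J K m := by
  rcases m.eq_zero_or_pos with rfl | h
  · rw [gen_zero, map_one, NCAlg.J, NCAlg.of_eq_one]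
  · lift m to ℕ+ using h
    rw [gen_coe, toNCAlg, MvPolynomial.aeval_X]

theorem comul_X (n : ℕ+) :
    comul K (MvPolynomial.X n) = ∑ m ∈ Finset.range ((n : ℕ) + 1),
      ∑ T ∈ NCPartition.tailSubsets n 0 m,
        gen K m ⊗ₜ[K] ∏ c ∈ NCPartition.components T, gen K c.card := by
  have hF := coeff_succ_fdbSeries (fun k => gen K k ⊗ₜ[K] (1 : FdB K))
    (by rw [gen_zero]; rfl)
  have hG := coeff_succ_fdbSeries (fun k => (1 : FdB K) ⊗ₜ[K] gen K k)
    (by rw [gen_zero]; rfl)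
  simp only [gen_coe] at hF hG
  rw [comul, MvPolynomial.aeval_X, coeff_subst_eq_sum (coeff_zero_fdbSeries _),
    Finset.sum_range_succ', coeff_zero_fdbSeries, zero_mul, add_zero]
  refine Finset.sum_congr rfl fun m _ => ?_
  rw [hF]
  have h := NCPartition.sum_tailSubsets_eq_coeff (n := n) (coeff_zero_fdbSeries
    fun m => (1 : FdB K) ⊗ₜ[K] (MvPolynomial.X m : FdB K)) (coeff_one_fdbSeries _) m 0
    (Nat.zero_le _)
  rw [Nat.sub_zero] at h
  rw [← h, Finset.mul_sum]
  refine Finset.sum_congr rfl fun T _ => ?_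
  simp only [hG]
  have hp : ∏ c ∈ NCPartition.components T, ((1 : FdB K) ⊗ₜ[K] gen K c.card) =
      1 ⊗ₜ[K] ∏ c ∈ NCPartition.components T, gen K c.card := by
    simp only [← Algebra.TensorProduct.includeRight_apply, map_prod]
  rw [hp, Algebra.TensorProduct.tmul_mul_tmul, mul_one, one_mul]

theorem algHom_comul_X {B : Type*} [CommRing B] [Algebra K B] (f g : FdB K →ₐ[K] B) (n : ℕ+) :
    Algebra.TensorProduct.lift f g (fun _ _ => Commute.all _ _) (comul K (MvPolynomial.X n)) =
      PowerSeries.coeff ((n : ℕ) + 1) (PowerSeries.subst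
        (fdbSeries fun k => g (MvPolynomial.X k)) (fdbSeries fun k => f (MvPolynomial.X k))) := by
  rw [comul, MvPolynomial.aeval_X, ← AlgHom.coe_toRingHom, map_coeff_subst_fdbSeries]
  simp

theorem comulTwist_comul_surjective : Function.Surjective (comulTwist (comul K)) := by
  refine comulTwist_surjective (fun n : ℕ+ => (n : ℕ)) _ fun n B h1 h2 => ?_
  have hn : NCPartition.tailSubsets n 0 n = {∅} := by
    ext T
    have hu : NCPartition.tailSet n 0 = Finset.univ := by
      ext
      simp [NCPartition.mem_tailSet]
    rw [NCPartition.mem_tailSubsets, hu, ← Finset.compl_eq_univ_sdiff, Finset.card_compl,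
      Fintype.card_fin, Finset.mem_singleton, ← Finset.card_eq_zero]
    have h3 := T.card_le_univ
    rw [Fintype.card_fin] at h3
    have := n.pos
    constructor
    · rintro ⟨-, h⟩
      omega
    · exact fun h => ⟨fun _ _ => Nat.zero_le _, by omega⟩
  rw [comul_X, Finset.sum_range_succ, hn, Finset.sum_singleton, gen_coe]
  have h0 : NCPartition.components (∅ : Finset (Fin n)) = ∅ := by simp [NCPartition.components]
  rw [h0, Finset.prod_empty, add_sub_cancel_right]
  refine Subalgebra.sum_mem _ fun m hm => Subalgebra.sum_mem _ fun T _ => ?_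
  have h3 : (gen K m) ⊗ₜ[K] (1 : FdB K) ∈ B := by
    rcases m.eq_zero_or_pos with rfl | h
    · rw [gen_zero]
      exact h1 1
    · rw [gen, dif_pos h]
      exact h2 _ (Finset.mem_range.1 hm)
  have := Subalgebra.mul_mem _ h3 (h1 (∏ c ∈ NCPartition.components T, gen K c.card))
  simpa using this

theorem toNCAlg_injective : Function.Injective (toNCAlg K) := by
  have h : toNCAlg K = MvPolynomial.rename
      fun n : ℕ+ => (⟨n, NCPartition.J n⟩ : Σ n : ℕ+, NCPartition n) := by
    refine MvPolynomial.algHom_ext fun n => ?_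
    rw [toNCAlg, MvPolynomial.aeval_X, MvPolynomial.rename_X, NCAlg.J_eq_X]
  rw [h]
  refine MvPolynomial.rename_injective _ fun m n hmn => ?_
  exact congrArg Sigma.fst hmn

theorem toNCAlg_X (n : ℕ+) : toNCAlg K (MvPolynomial.X n) = NCAlg.J K n := by
  rw [toNCAlg, MvPolynomial.aeval_X]

end FdB

namespace NCAlg

variable {K : Type*} [Field K]

theorem comul_J {n : ℕ} (hn : 0 < n) :
    comul K (J K n) = ∑ T : Finset (Fin n),
      J K Tᶜ.card ⊗ₜ[K] ∏ c ∈ NCPartition.components T, J K c.card := by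
  classical
  have hmem : ∀ x, ({x} : Finset (Fin n)) ∈ (NCPartition.J n).parts := fun x =>
    Finpartition.mem_bot_iff.2 ⟨x, Finset.mem_univ x, rfl⟩
  rw [J, comul_of _ hn]
  refine Finset.sum_nbij' (fun I => I.biUnion id) (fun T => T.image fun x => {x}) ?_ ?_ ?_ ?_ ?_
  · exact fun _ _ => Finset.mem_univ _
  · intro T _
    have hsub : T.image (fun x => ({x} : Finset (Fin n))) ⊆ (NCPartition.J n).parts := by
      intro b hb
      obtain ⟨x, -, rfl⟩ := Finset.mem_image.1 hb
      exact hmem x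
    rw [Finset.mem_filter, Finset.mem_powerset]
    refine ⟨hsub, (NCPartition.isIdeal_iff hsub).2 fun x hx y hxy => ?_⟩
    rw [NCPartition.same_J] at hxy
    subst hxy
    exact NCPartition.mem_component_self hx
  · intro I hI
    rw [Finset.mem_filter, Finset.mem_powerset] at hI
    ext b
    rw [Finset.mem_image]
    constructor
    · rintro ⟨x, hx, rfl⟩
      obtain ⟨b, hb, hxb⟩ := Finset.mem_biUnion.1 hx
      rwa [(NCPartition.J n).eq_of_mem_parts (hmem x) (hI.1 hb) (Finset.mem_singleton_self x) hxb]
    · intro hb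
      obtain ⟨x, -, rfl⟩ := Finpartition.mem_bot_iff.1 (hI.1 hb)
      exact ⟨x, Finset.mem_biUnion.2 ⟨_, hb, Finset.mem_singleton_self x⟩, rfl⟩
  · intro T _
    ext x
    simp
  · intro I _
    simp only [of_restrict_J]

end NCAlg

namespace FdB

variable {K : Type*} [Field K]

theorem map_comp_comul :
    (Algebra.TensorProduct.map (toNCAlg K) (toNCAlg K)).comp (comul K) =
      (NCAlg.comul K).comp (toNCAlg K) := by
  refine MvPolynomial.algHom_ext fun n => ?_
  rw [AlgHom.comp_apply, AlgHom.comp_apply, toNCAlg_X, NCAlg.comul_J n.pos, comul_X, map_sum,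
    ← Finset.sum_fiberwise_of_maps_to (g := fun T : Finset (Fin n) => Tᶜ.card)
      (t := Finset.range ((n : ℕ) + 1))]
  · refine Finset.sum_congr rfl fun m _ => ?_
    rw [map_sum]
    refine Finset.sum_congr ?_ fun T hT => ?_
    · ext T
      have hu : NCPartition.tailSet n 0 = Finset.univ := by
        ext
        simp [NCPartition.mem_tailSet]
      rw [NCPartition.mem_tailSubsets, hu, ← Finset.compl_eq_univ_sdiff]
      simp
    · rw [Algebra.TensorProduct.map_tmul, toNCAlg_gen, (Finset.mem_filter.1 hT).2, map_prod]
      simp only [toNCAlg_gen]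
  · intro T _
    rw [Finset.mem_range, Nat.lt_succ_iff]
    exact Tᶜ.card_le_univ.trans_eq (Fintype.card_fin _)

theorem counit_comp_toNCAlg : (NCAlg.counit K).comp (toNCAlg K) = counit K := by
  refine MvPolynomial.algHom_ext fun n => ?_
  rw [AlgHom.comp_apply, toNCAlg_X, NCAlg.J, NCAlg.counit_of _ n.pos, counit,
    MvPolynomial.aeval_X]

variable (K)

/-- The antipode of the Faà di Bruno algebra. -/
def antipode : FdB K →ₐ[K] FdB K :=
  MvPolynomial.aeval fun n : ℕ+ => ∑ k ∈ intPartitions n,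
    (typeCoeff n k : K) • ∏ i : Fin n, gen K ((i : ℕ) + 1) ^ k i

variable {K}

theorem lift_comp_comul_eq {f g : FdB K →ₐ[K] FdB K} {f' g' : NCAlg K →ₐ[K] NCAlg K}
    (hf : (toNCAlg K).comp f = f'.comp (toNCAlg K))
    (hg : (toNCAlg K).comp g = g'.comp (toNCAlg K))
    (h : NCAlg.conv f' g' = (Algebra.ofId K (NCAlg K)).comp (NCAlg.counit K)) :
    (Algebra.TensorProduct.lift f g fun _ _ => Commute.all _ _).comp (comul K) =
      (Algebra.ofId K (FdB K)).comp (counit K) := by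
  have h1 : (toNCAlg K).comp
      ((Algebra.TensorProduct.lift f g fun _ _ => Commute.all _ _).comp (comul K)) =
      (toNCAlg K).comp ((Algebra.ofId K (FdB K)).comp (counit K)) := by
    have h2 : (toNCAlg K).comp (Algebra.TensorProduct.lift f g fun _ _ => Commute.all _ _) =
        (Algebra.TensorProduct.lift f' g' fun _ _ => Commute.all _ _).comp
          (Algebra.TensorProduct.map (toNCAlg K) (toNCAlg K)) := by
      refine Algebra.TensorProduct.ext ?_ ?_
      · refine AlgHom.ext fun x => ?_
        simpa using AlgHom.congr_fun hf x
      · refine AlgHom.ext fun x => ?_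
        simpa using AlgHom.congr_fun hg x
    have h3 : (toNCAlg K).comp (Algebra.ofId K (FdB K)) = Algebra.ofId K (NCAlg K) :=
      Subsingleton.elim _ _
    rw [← AlgHom.comp_assoc, h2, AlgHom.comp_assoc, map_comp_comul, ← AlgHom.comp_assoc,
      ← AlgHom.comp_assoc, h3]
    rw [NCAlg.conv] at h
    rw [h, AlgHom.comp_assoc, counit_comp_toNCAlg]
  exact AlgHom.ext fun x => toNCAlg_injective (AlgHom.congr_fun h1 x)

theorem aeval_antipode_X (a : ℕ+ → K) (n : ℕ+) :
    MvPolynomial.aeval a (antipode K (MvPolynomial.X n)) = ∑ k ∈ intPartitions n,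
        (typeCoeff n k : K) * ∏ i : Fin n, a (i : ℕ).succPNat ^ k i := by
  rw [antipode, MvPolynomial.aeval_X, map_sum]
  refine Finset.sum_congr rfl fun k _ => ?_
  rw [map_smul, map_prod, smul_eq_mul]
  congr 1
  refine Finset.prod_congr rfl fun i _ => ?_
  have : gen K ((i : ℕ) + 1) = MvPolynomial.X (i : ℕ).succPNat := gen_coe (i : ℕ).succPNat
  rw [map_pow, this, MvPolynomial.aeval_X]

theorem lift_aeval_comul_X {f g : FdB K →ₐ[K] FdB K} (a : ℕ+ → K)
    (h : (Algebra.TensorProduct.lift f g fun _ _ => Commute.all _ _).comp (comul K) =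
      (Algebra.ofId K (FdB K)).comp (counit K)) (n : ℕ+) :
    PowerSeries.coeff ((n : ℕ) + 1) (PowerSeries.subst
      (fdbSeries fun k => MvPolynomial.aeval a (g (MvPolynomial.X k)))
      (fdbSeries fun k => MvPolynomial.aeval a (f (MvPolynomial.X k)))) = 0 := by
  have h1 := algHom_comul_X ((MvPolynomial.aeval a).comp f) ((MvPolynomial.aeval a).comp g) n
  simp only [AlgHom.comp_apply] at h1
  have h2 : Algebra.TensorProduct.lift ((MvPolynomial.aeval a).comp f)
      ((MvPolynomial.aeval a).comp g) (fun _ _ => Commute.all _ _) =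
      (MvPolynomial.aeval a).comp
        (Algebra.TensorProduct.lift f g fun _ _ => Commute.all _ _) := by
    refine Algebra.TensorProduct.ext ?_ ?_ <;> ext <;> simp
  have h3 := AlgHom.congr_fun h (MvPolynomial.X n)
  rw [AlgHom.comp_apply] at h3
  rw [← h1, h2, AlgHom.comp_apply, h3, AlgHom.comp_apply, counit, MvPolynomial.aeval_X, map_zero,
    map_zero]

variable [CharZero K]

theorem toNCAlg_comp_antipode :
    (toNCAlg K).comp (antipode K) = (NCAlg.scale K (-1)).comp (toNCAlg K) := by
  refine MvPolynomial.algHom_ext fun n => ?_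
  rw [AlgHom.comp_apply, AlgHom.comp_apply, toNCAlg_X, NCAlg.scale_neg_one_J n.pos, antipode,
    MvPolynomial.aeval_X, map_sum]
  refine Finset.sum_congr rfl fun k _ => ?_
  rw [map_smul, map_prod]
  simp only [map_pow, toNCAlg_gen]

theorem lift_antipode_id :
    (Algebra.TensorProduct.lift (antipode K) (AlgHom.id K _) fun _ _ => Commute.all _ _).comp
      (comul K) = (Algebra.ofId K (FdB K)).comp (counit K) := by
  refine lift_comp_comul_eq toNCAlg_comp_antipode (g' := NCAlg.scale K 1) ?_ ?_
  · rw [NCAlg.scale_one]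
    rfl
  · have h := NCAlg.conv_scale_right_natCast (K := K) (-1) 1
    rwa [Nat.cast_one, neg_add_cancel, NCAlg.scale_zero] at h

theorem lift_id_antipode :
    (Algebra.TensorProduct.lift (AlgHom.id K _) (antipode K) fun _ _ => Commute.all _ _).comp
      (comul K) = (Algebra.ofId K (FdB K)).comp (counit K) := by
  refine lift_comp_comul_eq (f' := NCAlg.scale K 1) ?_ toNCAlg_comp_antipode ?_
  · rw [NCAlg.scale_one]
    rfl
  · have h := NCAlg.conv_scale_left_natCast (K := K) (-1) 1
    rwa [Nat.cast_one, neg_add_cancel, NCAlg.scale_zero] at h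

theorem isAntipode_antipode : IsAntipode (comul K) (counit K) (antipode K).toLinearMap :=
  isAntipode_of_lift lift_antipode_id lift_id_antipode

theorem eq_antipode {S : FdB K →ₗ[K] FdB K} (hS : IsAntipode (comul K) (counit K) S) :
    S = (antipode K).toLinearMap :=
  antipode_unique comulTwist_comul_surjective hS isAntipode_antipode

end FdB

end

theorem proposition3p6 (K : Type*) [Field K] [CharZero K] :
    -- there is exactly one morphism of double bialgebras from `K[NCP]` to `K[X]`
    (∃! φ : NCAlg K →ₐ[K] Polynomial K, IsDoubleBialgebraHom K φ) ∧
    -- `K[NCP]` and the Faà di Bruno algebra have exactly one antipode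
    (∃! S : NCAlg K →ₗ[K] NCAlg K, IsAntipode (NCAlg.comul K) (NCAlg.counit K) S) ∧
    (∃! S : FdB K →ₗ[K] FdB K, IsAntipode (FdB.comul K) (FdB.counit K) S) ∧
    -- the two formulas for `S(J_n)`, with `μ(π) = φ(π)(-1)`, and the coefficient of `J_1 ^ n`
    (∀ (φ : NCAlg K →ₐ[K] Polynomial K) (S : NCAlg K →ₗ[K] NCAlg K),
      IsDoubleBialgebraHom K φ → IsAntipode (NCAlg.comul K) (NCAlg.counit K) S →
      ∀ n : ℕ, 1 ≤ n →
        S (NCAlg.J K n) =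
          ∑ π : NCPartition n, (φ (NCAlg.of π)).eval (-1) • ∏ b ∈ π.parts, NCAlg.J K b.card ∧
        S (NCAlg.J K n) =
          ∑ k ∈ intPartitions n,
            (typeCoeff n k : K) • ∏ i : Fin n, NCAlg.J K ((i : ℕ) + 1) ^ k i ∧
        MvPolynomial.coeff
            (Finsupp.single (⟨1, NCPartition.J 1⟩ : Σ m : ℕ+, NCPartition m) n)
            (S (NCAlg.J K n)) = (-1) ^ n * (catalan n : K)) ∧
    -- `x_n ↦ J_n` is a morphism of Hopf algebras
    (Algebra.TensorProduct.map (FdB.toNCAlg K) (FdB.toNCAlg K)).comp (FdB.comul K) =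
      (NCAlg.comul K).comp (FdB.toNCAlg K) ∧
    (NCAlg.counit K).comp (FdB.toNCAlg K) = FdB.counit K ∧
    (∀ (S : NCAlg K →ₗ[K] NCAlg K) (S' : FdB K →ₗ[K] FdB K),
      IsAntipode (NCAlg.comul K) (NCAlg.counit K) S →
      IsAntipode (FdB.comul K) (FdB.counit K) S' →
      ∀ x : FdB K, FdB.toNCAlg K (S' x) = S (FdB.toNCAlg K x)) ∧
    -- the coefficients of the compositional inverse of `x + ∑ a_n x ^ (n + 1)`
    (∀ a b : ℕ+ → K,
      (∀ n : ℕ+, b n = ∑ k ∈ intPartitions n,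
        (typeCoeff n k : K) * ∏ i : Fin n, a (i : ℕ).succPNat ^ k i) →
      PowerSeries.subst (fdbSeries b) (fdbSeries a) = PowerSeries.X ∧
      PowerSeries.subst (fdbSeries a) (fdbSeries b) = PowerSeries.X ∧
      ∀ S' : FdB K →ₗ[K] FdB K, IsAntipode (FdB.comul K) (FdB.counit K) S' →
        ∀ n : ℕ+, MvPolynomial.aeval a (S' (MvPolynomial.X n)) = b n) ∧
    -- two particular coefficients
    (∀ n : ℕ, 1 ≤ n →
      typeCoeff n (fun i => if (i : ℕ) = 0 then n else 0) = (-1) ^ n * (catalan n : ℤ) ∧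
      typeCoeff n (fun i => if (i : ℕ) + 1 = n then 1 else 0) = -1) := by
  have hanti : ∀ S : NCAlg K →ₗ[K] NCAlg K, IsAntipode (NCAlg.comul K) (NCAlg.counit K) S →
      ∀ x, S x = NCAlg.scale K (-1) x := fun S hS x => by
    rw [NCAlg.eq_scale hS]
    rfl
  have hanti' : ∀ S : FdB K →ₗ[K] FdB K, IsAntipode (FdB.comul K) (FdB.counit K) S →
      ∀ x, S x = FdB.antipode K x := fun S hS x => by
    rw [FdB.eq_antipode hS]
    rfl
  refine ⟨⟨NCAlg.toPoly K, NCAlg.isDoubleBialgebraHom_toPoly, fun φ h => NCAlg.eq_toPoly h⟩,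
    ⟨_, NCAlg.isAntipode_scale, fun S h => NCAlg.eq_scale h⟩,
    ⟨_, FdB.isAntipode_antipode, fun S h => FdB.eq_antipode h⟩, ?_, FdB.map_comp_comul,
    FdB.counit_comp_toNCAlg, ?_, ?_, ?_⟩
  · intro φ S hφ hS n hn
    rw [hanti S hS, NCAlg.eq_toPoly hφ]
    refine ⟨?_, NCAlg.scale_neg_one_J hn, NCAlg.coeff_scale_neg_one_J hn⟩
    rw [NCAlg.scale_J _ hn]
    rfl
  · intro S S' hS hS' x
    rw [hanti S hS, hanti' S' hS']
    exact AlgHom.congr_fun FdB.toNCAlg_comp_antipode x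
  · intro a b hb
    have hb' : ∀ n, b n = MvPolynomial.aeval a (FdB.antipode K (MvPolynomial.X n)) := fun n => by
      rw [hb, FdB.aeval_antipode_X]
    have ha : ∀ n, a n = MvPolynomial.aeval a (AlgHom.id K (FdB K) (MvPolynomial.X n)) :=
      fun n => by simp
    refine ⟨subst_fdbSeries_eq_X fun n => ?_, subst_fdbSeries_eq_X fun n => ?_,
      fun S' hS' n => ?_⟩
    · rw [← FdB.lift_aeval_comul_X a FdB.lift_id_antipode n]
      simp only [← ha, ← hb']
    · rw [← FdB.lift_aeval_comul_X a FdB.lift_antipode_id n]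
      simp only [← ha, ← hb']
    · rw [hanti' S' hS', hb']
  · exact fun n hn => ⟨NCPartition.typeCoeff_J, NCPartition.typeCoeff_single hn⟩
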